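/- **Proposition (fast-slow separation).** Let $A\in\mathbb R^{m\times m}$, $B\in\mathbb R^{n\times n}$, let $\mathfrak p\ge 2$ be an integer, and let $\alpha\ge 0$, $\beta,\tilde\mu$ be real numbers such that every eigenvalue $\alpha_i\in\mathbb C$ of $A$ and $\beta_j\in\mathbb C$ of $B$ satisfies $$|\alpha_i|\le\alpha<\tilde\mu,\qquad |\beta_j|\ge\beta,\qquad \mathfrak p\,\alpha\le\tilde\mu<\beta-(\mathfrak p-1)\alpha$$ (so $\beta>\tilde\mu$: the variables $x\in\mathbb R^m$ are slow, the variables $y\in\mathbb R^n$ are fast). Let $T\subseteq\mathbb R$ be an open time interval (possibly $\mathbb R$) and $d\subset\mathbb R^{m+n}$ a bounded connected open set containing $0$. Consider $$\dot x=Ax+f(t,x,y),\qquad \dot y=By+g(t,x,y),\tag{1}$$ where, for $t\in T$, $f$ and $g$ are $C^{\mathfrak p}$ in $(x,y)\in d$. For functions of $(t,x,y)$ or of $(t,X,Y)$ write $O(q)$ for $O(|x|^q+|y|^q)$ as $(x,y)\to0$, respectively $O(|X|^q+|Y|^q)$ as $(X,Y)\to0$, uniformly in $t\in T$. Suppose $f$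 and $g$ are $O(2)$. Call a function $a$ *slow at rate $\nu\ge 0$ on $T$ with constant $M$* if it is smooth on $T$ and $|a^{(j)}(t)|\le M\nu^j$ for all $t\in T$ and all $j\ge 0$ (for example superpositions of $e^{i\omega t}$ with $|\omega|\le\nu$). Suppose that for some $\nu\ge0$ the time dependence of (1) is slow at rate $\nu$: there is a constant $M$ such that for all $(x,y)$ in a neighbourhood of $0$ the $(x,y)$-derivatives of $f$ and $g$ of all orders $0,\dots,\mathfrak p$ at $(x,y)$ are, as functions of $t$, slow at rate $\nu$ on $T$ with constant $M$. Then for every $p$ with $2\le p\le\mathfrak p$ and $(p-2)\nu\le\tilde\mu$ there exist a time dependent coordinate transform $x=x(t,X,Y)$, $y=y(t,X,Y)$ and a system $$\dot X=AX+F(t,X,Y)=AX+F_c(t,X)+\mathcal F(t,X,Y)YY,\qquad \dot Y=[B+G(t,X,Y)]Y,\tag{2}$$ where $\mathcal F$ is a rank three tensor, $x(t,X,Y),y(t,X,Y),F_c,\mathcal F,G$ are multinomial (polynomial in $X,Y$) with time dependent coefficients that are slow at rate $\tilde\mu$ on $T$ (in particular bounded on $T$), such that 1. the transform is near identity, $x-X=O(2)$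 and $y-Y=O(2)$, and $F=O(2)$, $GY=O(2)$; 2. substituting the transform and (2) in (1) leaves residuals $O(p)$; 3. for some $\rho>0$ the transform restricted to $|(X,Y)|<\rho$ (where $|(X,Y)|=\max(|X|,|Y|)$ with Euclidean norms) is, for $t\in T$, a diffeomorphism, smooth also in $t$ and with inverse smooth also in $t$, onto an open set $d_\rho(t)\subseteq d$; the sets $d_\rho(t)$ contain a common ball about $0$. Let $\dot u=W(t,u)$ be the system (2) transformed to the variables $u=(x,y)\in d_\rho(t)$. The right-hand side of this nearby system differs from that of (1) by $O(p)$; 4. the nearby system has the exact slow manifold $\mathcal M(t)=\{(x,y)(t,X,0):|X|<\rho\}$, i.e. $Y=0$: if a solution of $\dot u=W(t,u)$ on an open interval $J\subseteq T$ stays in $d_\rho(t)$ and lies in $\mathcal M(t_0)$ at some time $t_0\in J$, then it lies in $\mathcal M(t)$ for all $t\in J$ and equals $(x,y)(t,X(t),0)$ with $\dot X=AX+F_c(t,X)$, $|X(t)|<\rho$; conversely every solution of $\dot X=AX+F_c(t,X)$ on $J$ with $|X(t)|<\rho$ gives in this way a solution of $\dot u=W(t,u)$. -/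

import Mathlib

open scoped ContDiff

noncomputable section

namespace FastSlow

/-- Euclidean `k`-space. -/
abbrev Vec (k : ℕ) := EuclideanSpace ℝ (Fin k)

/-- The state space of pairs `(x, y)`, with `m` slow and `n` fast variables. -/
abbrev State (m n : ℕ) := Vec m × Vec n

/-- `a` varies slowly, at rate at most `ν`, over the (open) set of times `T`: it is smooth there
and its `j`-th derivative is at most `M * ν ^ j`. For example `exp (l * t)` with `|l| ≤ ν` on a
bounded interval, or (on all of `ℝ`) superpositions of oscillations of frequency at most `ν`;
rate `0` on an interval means constant. -/
def SlowOn {V : Type*} [NormedAddCommGroup V] [NormedSpace ℝ V]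
    (T : Set ℝ) (ν M : ℝ) (a : ℝ → V) : Prop :=
  ContDiffOn ℝ ∞ a T ∧ ∀ j : ℕ, ∀ t ∈ T, ‖iteratedDeriv j a t‖ ≤ M * ν ^ j

/-- The order symbol: `h = O(|X|^q + |Y|^q)` as `(X, Y) → 0`, uniformly for times in `T`. -/
def IsOrc {m n : ℕ} {V : Type*} [NormedAddCommGroup V]
    (T : Set ℝ) (q : ℕ) (h : ℝ → State m n → V) : Prop :=
  ∃ C : ℝ, ∃ r > 0, ∀ t ∈ T, ∀ U : State m n, ‖U‖ < r →
    ‖h t U‖ ≤ C * (‖U.1‖ ^ q + ‖U.2‖ ^ q)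

/-- The given vector field `(A x + f(t,x,y), B y + g(t,x,y))`. -/
def givenField {m n : ℕ} (A : Matrix (Fin m) (Fin m) ℝ) (B : Matrix (Fin n) (Fin n) ℝ)
    (f : ℝ → State m n → Vec m) (g : ℝ → State m n → Vec n) (t : ℝ) (u : State m n) :
    State m n :=
  (Matrix.toEuclideanLin A u.1 + f t u, Matrix.toEuclideanLin B u.2 + g t u)

/-- Multinomials in variables `σ` whose coefficients are functions of time. -/
abbrev TPoly (σ : Type) := MvPolynomial σ (ℝ → ℝ)

/-- The value of a multinomial at time `t` and at the values `v` of its variables. -/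
def TPoly.val {σ : Type} (P : TPoly σ) (t : ℝ) (v : σ → ℝ) : ℝ :=
  MvPolynomial.eval₂ (Pi.evalRingHom (fun _ : ℝ => ℝ) t) v P

/-- All coefficients of `P` are slow at rate `ν` over `T` (in particular bounded on `T`). -/
def TPoly.SlowCoeffs {σ : Type} (T : Set ℝ) (ν : ℝ) (P : TPoly σ) : Prop :=
  ∀ s : σ →₀ ℕ, ∃ M : ℝ, SlowOn T ν M (MvPolynomial.coeff s P)

/-- The coordinates of a state, as values for multinomial variables. -/
def coords {m n : ℕ} (U : State m n) : Fin m ⊕ Fin n → ℝ :=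
  Sum.elim (fun i => U.1 i) (fun j => U.2 j)

/-- A multinomial coordinate transform `x = ξ(t,X,Y)`, `y = η(t,X,Y)`, and the multinomial
ingredients `F_c(t,X)`, `𝓕(t,X,Y)` (three indices) and `G(t,X,Y)` (a square matrix) of a system
in normal form. -/
structure NormalForm (m n : ℕ) where
  xi : Fin m → TPoly (Fin m ⊕ Fin n)
  eta : Fin n → TPoly (Fin m ⊕ Fin n)
  Fc : Fin m → TPoly (Fin m)
  quad : Fin m → Fin n → Fin n → TPoly (Fin m ⊕ Fin n)
  G : Fin n → Fin n → TPoly (Fin m ⊕ Fin n)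

namespace NormalForm

variable {m n : ℕ} (N : NormalForm m n)

/-- Every time dependent coefficient is slow at rate `ν` over `T`. -/
def SlowCoeffs (T : Set ℝ) (ν : ℝ) : Prop :=
  (∀ i, (N.xi i).SlowCoeffs T ν) ∧ (∀ j, (N.eta j).SlowCoeffs T ν) ∧
  (∀ i, (N.Fc i).SlowCoeffs T ν) ∧ (∀ i j k, (N.quad i j k).SlowCoeffs T ν) ∧
  (∀ j k, (N.G j k).SlowCoeffs T ν)

/-- The coordinate transform `(X, Y) ↦ (x, y)` at time `t`. -/
def transform (t : ℝ) (U : State m n) : State m n :=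
  (WithLp.toLp 2 fun i => (N.xi i).val t (coords U),
   WithLp.toLp 2 fun j => (N.eta j).val t (coords U))

/-- `F_c(t, X)`. -/
def FcVec (t : ℝ) (X : Vec m) : Vec m :=
  WithLp.toLp 2 fun i => (N.Fc i).val t (fun l => X l)

/-- `F(t, X, Y) = F_c(t, X) + 𝓕(t, X, Y) Y Y`. -/
def FVec (t : ℝ) (U : State m n) : Vec m :=
  N.FcVec t U.1 +
    WithLp.toLp 2 fun i => ∑ j, ∑ k, (N.quad i j k).val t (coords U) * U.2 j * U.2 k

/-- `G(t, X, Y) Y`. -/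
def GVec (t : ℝ) (U : State m n) : Vec n :=
  WithLp.toLp 2 fun j => ∑ k, (N.G j k).val t (coords U) * U.2 k

/-- The normal form vector field `(A X + F_c + 𝓕 Y Y, [B + G] Y)`. -/
def field (A : Matrix (Fin m) (Fin m) ℝ) (B : Matrix (Fin n) (Fin n) ℝ)
    (t : ℝ) (U : State m n) : State m n :=
  (Matrix.toEuclideanLin A U.1 + N.FVec t U, Matrix.toEuclideanLin B U.2 + N.GVec t U)

/-- The velocity `d/dt (x, y)` of the image, under the transform, of the solution of the normal
form system that is at `U` at time `t`. -/
def velocity (A : Matrix (Fin m) (Fin m) ℝ) (B : Matrix (Fin n) (Fin n) ℝ)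
    (t : ℝ) (U : State m n) : State m n :=
  deriv (fun s => N.transform s U) t + fderiv ℝ (N.transform t) U (N.field A B t U)

/-- The image at time `t` of the ball of radius `ρ`. -/
def domain (ρ : ℝ) (t : ℝ) : Set (State m n) := N.transform t '' Metric.ball 0 ρ

/-- The image at time `t` of the part `Y = 0` of the ball of radius `ρ`. -/
def slowManifold (ρ : ℝ) (t : ℝ) : Set (State m n) :=
  N.transform t '' {U | U ∈ Metric.ball 0 ρ ∧ U.2 = 0}

/-- On the ball of radius `ρ`, the transforms at times in `T` are diffeomorphisms, smooth also in
time, with inverses `ψ t`; the images lie in `d` and contain a common ball about the origin. -/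
def IsDiffeo (T : Set ℝ) (d : Set (State m n)) (ρ : ℝ) (ψ : ℝ → State m n → State m n) : Prop :=
  (∀ t ∈ T, Set.LeftInvOn (ψ t) (N.transform t) (Metric.ball 0 ρ) ∧
    IsOpen (N.domain ρ t) ∧ N.domain ρ t ⊆ d) ∧
  ContDiffOn ℝ ∞ (fun q : ℝ × State m n => N.transform q.1 q.2) (T ×ˢ Metric.ball 0 ρ) ∧
  ContDiffOn ℝ ∞ (fun q : ℝ × State m n => ψ q.1 q.2) {q | q.1 ∈ T ∧ q.2 ∈ N.domain ρ q.1} ∧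
  ∃ r > 0, ∀ t ∈ T, Metric.ball 0 r ⊆ N.domain ρ t

end NormalForm

/-- `u` solves `du/dt = W(t, u)` on the set of times `J`. -/
def Solves {V : Type*} [NormedAddCommGroup V] [NormedSpace ℝ V]
    (W : ℝ → V → V) (J : Set ℝ) (u : ℝ → V) : Prop :=
  ∀ t ∈ J, HasDerivAt u (W t (u t)) t

/-- For the system `du/dt = W(t, u)` in the moving domain `N.domain ρ t`, the manifold
`N.slowManifold ρ t` is invariant, and the evolution on it is the image of
`dX/dt = A X + F_c(t, X)`. -/
def HasSlowManifold {m n : ℕ} (N : NormalForm m n) (A : Matrix (Fin m) (Fin m) ℝ)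
    (T : Set ℝ) (ρ : ℝ) (W : ℝ → State m n → State m n) : Prop :=
  ∀ J : Set ℝ, IsOpen J → J.OrdConnected → J ⊆ T →
    (∀ u : ℝ → State m n, Solves W J u → (∀ t ∈ J, u t ∈ N.domain ρ t) →
      (∃ t₀ ∈ J, u t₀ ∈ N.slowManifold ρ t₀) →
      (∀ t ∈ J, u t ∈ N.slowManifold ρ t) ∧
      ∃ X : ℝ → Vec m, Solves (fun t X => Matrix.toEuclideanLin A X + N.FcVec t X) J X ∧
        ∀ t ∈ J, ‖X t‖ < ρ ∧ u t = N.transform t (X t, 0)) ∧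
    (∀ X : ℝ → Vec m, Solves (fun t X => Matrix.toEuclideanLin A X + N.FcVec t X) J X →
      (∀ t ∈ J, ‖X t‖ < ρ) → Solves W J (fun t => N.transform t (X t, 0)))

end FastSlow

end

/-! The transform and the system (2) are sought as multinomials, and the order of the residual is
raised one degree at a time (`exists_normalForm`). If the residual has order q, a homogeneous
correction h of the transform and w of the velocity, both of degree q, change it by h_t + (∂h) Λu −
Λh + w (`homological`) up to terms of order q + 1, where Λ = diag(A, B); see
`residual_add_sub_mem_OT`. It remains to cancel each monomial of degree q of the residual through h
or w.

The shape of (2) lets the velocity absorb most monomials: in the slow equation those without fast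
factors (F_c) and those with at least two (𝓕YY), in the fast equation those with at least one (GY).
Two kinds are left for the transform: exactly one fast factor in the slow equation
(`correctable_xi`) and none in the fast equation (`correctable_eta`). For these the homological
equation is a linear equation c' + Lc = −r for a tensor of coefficients, where L is a sum of
commuting actions: q copies of ±A or its transpose, and one of −B or the transpose of B. Hence the
eigenvalues of L have modulus at least β − qα, which exceeds the rate κ at which r varies.

Then c = −∑ (−1)^k L^(−k−1) r^(k) converges and is again slow at rate κ (`exists_isSlow_solution`).
It uses only derivatives of r at the present time: there are no history integrals, no sign condition
on real parts, and any time interval will do. Control of the powers of the inverse of L (`PowBound`)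
replaces diagonalisation, so that Jordan blocks cost an arbitrarily small part of the spectral gap.

The rates close up because the coefficients of degree d vary at rate (d − 1)ν, a property stable
under products, derivatives and substitution in f and g (`GSlow` with j = 1). Corrections of degree
q ≤ p − 1 are thus slow at rate (p − 2)ν ≤ μ, and μ < β − (p − 1)α is the gap needed above.

Analysis enters last. Taylor multinomials of degree below p replace f and g with an error O(p)
uniform in time; the transform is near the identity, so it is a diffeomorphism with inverse smooth
also in time (`exists_inverse_family`); and along any given solution the equation for Y is linear in
Y, so that uniqueness makes Y = 0 invariant (`NormalForm.hasSlowManifold`). -/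

namespace FastSlow

/-! ### Calculus of slowly varying functions -/

section Slow

variable {V W : Type*} [NormedAddCommGroup V] [NormedSpace ℝ V]
  [NormedAddCommGroup W] [NormedSpace ℝ W] {T : Set ℝ} {κ κ' : ℝ}

/-- `a` is slow at rate `κ` over `T`, with some constant. -/
def IsSlow (T : Set ℝ) (κ : ℝ) (a : ℝ → V) : Prop := ∃ M, SlowOn T κ M a

theorem contDiffOn_of_hasDerivAt_seq (hT : IsOpen T) {D : ℕ → ℝ → V}
    (h : ∀ j, ∀ t ∈ T, HasDerivAt (D j) (D (j + 1) t) t) (n : ℕ) :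
    ∀ j, ContDiffOn ℝ n (D j) T := by
  induction n with
  | zero =>
    intro j
    rw [Nat.cast_zero, contDiffOn_zero]
    exact fun t ht => (h j t ht).continuousAt.continuousWithinAt
  | succ n ih =>
    intro j
    push_cast
    rw [contDiffOn_succ_iff_deriv_of_isOpen hT]
    refine ⟨fun t ht => (h j t ht).differentiableAt.differentiableWithinAt, by simp, ?_⟩
    exact (ih (j + 1)).congr fun t ht => (h j t ht).deriv

theorem iteratedDeriv_eq_of_hasDerivAt_seq (hT : IsOpen T) {D : ℕ → ℝ → V}
    (h : ∀ j, ∀ t ∈ T, HasDerivAt (D j) (D (j + 1) t) t) (j : ℕ) :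
    ∀ t ∈ T, iteratedDeriv j (D 0) t = D j t := by
  induction j with
  | zero => simp
  | succ j ih =>
    intro t ht
    rw [iteratedDeriv_succ]
    have : iteratedDeriv j (D 0) =ᶠ[nhds t] D j := by
      filter_upwards [hT.mem_nhds ht] with s hs using ih s hs
    rw [this.deriv_eq, (h j t ht).deriv]

/-- Slowness is proved by exhibiting all the derivatives at once; this suits sums, linear images and
series, whose iterated derivatives need not be computed separately. -/
theorem isSlow_of_hasDerivAt_seq (hT : IsOpen T) {D : ℕ → ℝ → V} {M : ℝ}
    (h : ∀ j, ∀ t ∈ T, HasDerivAt (D j) (D (j + 1) t) t)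
    (hM : ∀ j, ∀ t ∈ T, ‖D j t‖ ≤ M * κ ^ j) : IsSlow T κ (D 0) := by
  refine ⟨M, contDiffOn_infty.2 fun n => contDiffOn_of_hasDerivAt_seq hT h n 0, ?_⟩
  intro j t ht
  rw [iteratedDeriv_eq_of_hasDerivAt_seq hT h j t ht]
  exact hM j t ht

theorem IsSlow.contDiffOn {a : ℝ → V} (ha : IsSlow T κ a) : ContDiffOn ℝ ∞ a T := by
  obtain ⟨M, h, -⟩ := ha
  exact h

theorem IsSlow.contDiffAt {a : ℝ → V} (hT : IsOpen T) (ha : IsSlow T κ a) {t : ℝ} (ht : t ∈ T) :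
    ContDiffAt ℝ ∞ a t :=
  ha.contDiffOn.contDiffAt (hT.mem_nhds ht)

theorem IsSlow.differentiableAt {a : ℝ → V} (hT : IsOpen T) (ha : IsSlow T κ a) {t : ℝ}
    (ht : t ∈ T) : DifferentiableAt ℝ a t :=
  (ha.contDiffAt hT ht).differentiableAt (by simp)

theorem IsSlow.hasDerivAt_iteratedDeriv {a : ℝ → V} (hT : IsOpen T) (ha : IsSlow T κ a) (j : ℕ)
    {t : ℝ} (ht : t ∈ T) :
    HasDerivAt (iteratedDeriv j a) (iteratedDeriv (j + 1) a t) t := by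
  rw [iteratedDeriv_succ]
  apply DifferentiableAt.hasDerivAt
  have h1 : DifferentiableOn ℝ (iteratedDerivWithin j a T) T :=
    ha.contDiffOn.differentiableOn_iteratedDerivWithin
      (by exact_mod_cast WithTop.coe_lt_top j) hT.uniqueDiffOn
  refine (h1.differentiableAt (hT.mem_nhds ht)).congr_of_eventuallyEq ?_
  filter_upwards [hT.mem_nhds ht] with s hs using (iteratedDerivWithin_of_isOpen hT hs).symm

theorem IsSlow.exists_bound {a : ℝ → V} (hκ : 0 ≤ κ) (ha : IsSlow T κ a) :
    ∃ M, 0 ≤ M ∧ ∀ j : ℕ, ∀ t ∈ T, ‖iteratedDeriv j a t‖ ≤ M * κ ^ j := by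
  obtain ⟨M, -, h⟩ := ha
  refine ⟨max M 0, le_max_right _ _, fun j t ht => (h j t ht).trans ?_⟩
  gcongr
  exact le_max_left _ _

theorem IsSlow.exists_norm_le {a : ℝ → V} (ha : IsSlow T κ a) : ∃ M, 0 ≤ M ∧ ∀ t ∈ T, ‖a t‖ ≤ M := by
  obtain ⟨M, -, h⟩ := ha
  refine ⟨max M 0, le_max_right _ _, fun t ht => le_trans ?_ (le_max_left _ _)⟩
  simpa using h 0 t ht

theorem IsSlow.congr {a b : ℝ → V} (hT : IsOpen T) (ha : IsSlow T κ a)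
    (h : ∀ t ∈ T, b t = a t) : IsSlow T κ b := by
  obtain ⟨M, h1, h2⟩ := ha
  refine ⟨M, h1.congr h, fun j t ht => ?_⟩
  have : b =ᶠ[nhds t] a := by filter_upwards [hT.mem_nhds ht] with s hs using h s hs
  rw [this.iteratedDeriv_eq]
  exact h2 j t ht

theorem IsSlow.mono {a : ℝ → V} (hκ : 0 ≤ κ) (h : κ ≤ κ') (ha : IsSlow T κ a) :
    IsSlow T κ' a := by
  obtain ⟨M, hM, h2⟩ := ha.exists_bound hκ
  refine ⟨M, ha.contDiffOn, fun j t ht => (h2 j t ht).trans ?_⟩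
  gcongr

theorem IsSlow.clm_apply {a : ℝ → V} (hT : IsOpen T) (hκ : 0 ≤ κ) (ha : IsSlow T κ a)
    (φ : V →L[ℝ] W) : IsSlow T κ (fun t => φ (a t)) := by
  obtain ⟨M, hM, h2⟩ := ha.exists_bound hκ
  refine isSlow_of_hasDerivAt_seq (D := fun j t => φ (iteratedDeriv j a t)) (M := ‖φ‖ * M) hT
    (fun j t ht => φ.hasFDerivAt.comp_hasDerivAt t (ha.hasDerivAt_iteratedDeriv hT j ht)) ?_
  intro j t ht
  refine (φ.le_opNorm _).trans ?_
  rw [mul_assoc]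
  gcongr
  exact h2 j t ht

theorem IsSlow.const (hT : IsOpen T) (hκ : 0 ≤ κ) (v : V) : IsSlow T κ (fun _ => v) := by
  refine isSlow_of_hasDerivAt_seq (D := fun j _ => if j = 0 then v else 0) (M := ‖v‖) hT
    (fun j t _ => by simpa using hasDerivAt_const t _) ?_
  intro j t _
  rcases j with _ | j
  · simp
  · simp only [Nat.add_eq_zero_iff, one_ne_zero, and_false, if_false, norm_zero]
    positivity

theorem IsSlow.zero (hT : IsOpen T) (hκ : 0 ≤ κ) : IsSlow T κ (fun _ => (0 : V)) :=
  .const hT hκ 0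

theorem IsSlow.add {a b : ℝ → V} (hT : IsOpen T) (ha : IsSlow T κ a) (hb : IsSlow T κ b) :
    IsSlow T κ (fun t => a t + b t) := by
  obtain ⟨M, -, h⟩ := id ha
  obtain ⟨M', -, h'⟩ := id hb
  refine isSlow_of_hasDerivAt_seq (D := fun j t => iteratedDeriv j a t + iteratedDeriv j b t)
    (M := M + M') hT (fun j t ht => (ha.hasDerivAt_iteratedDeriv hT j ht).add
      (hb.hasDerivAt_iteratedDeriv hT j ht)) ?_
  intro j t ht
  rw [add_mul]
  exact (norm_add_le _ _).trans (add_le_add (h j t ht) (h' j t ht))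

theorem IsSlow.sum {ι : Type*} (hT : IsOpen T) (hκ : 0 ≤ κ) (s : Finset ι) {a : ι → ℝ → V}
    (h : ∀ i ∈ s, IsSlow T κ (a i)) : IsSlow T κ (fun t => ∑ i ∈ s, a i t) := by
  classical
  induction s using Finset.induction_on with
  | empty => simpa using IsSlow.zero hT hκ
  | insert i s hi ih =>
    simp only [Finset.sum_insert hi]
    exact (h i (by simp)).add hT (ih fun j hj => h j (by simp [hj]))

theorem IsSlow.pi {ι : Type*} [Fintype ι] (hT : IsOpen T) (hκ : 0 ≤ κ) {a : ℝ → ι → ℝ}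
    (h : ∀ i, IsSlow T κ (fun t => a t i)) : IsSlow T κ a := by
  classical
  refine (IsSlow.sum hT hκ Finset.univ
    (a := fun i t => (ContinuousLinearMap.toSpanSingleton ℝ (Pi.single i (1 : ℝ) : ι → ℝ)) (a t i))
    fun i _ => (h i).clm_apply hT hκ _).congr hT ?_
  intro t _
  ext k
  simp [Finset.sum_apply, Pi.single_apply]

/-- Leibniz's rule pairs κ^i with κ'^(j−i), and the binomial theorem sums these to (κ + κ')^j: rates
add under products, as frequencies do. -/
theorem IsSlow.mul {a b : ℝ → ℝ} (hT : IsOpen T) (hκ : 0 ≤ κ) (hκ' : 0 ≤ κ')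
    (ha : IsSlow T κ a) (hb : IsSlow T κ' b) : IsSlow T (κ + κ') (fun t => a t * b t) := by
  obtain ⟨M, hM, h⟩ := ha.exists_bound hκ
  obtain ⟨M', hM', h'⟩ := hb.exists_bound hκ'
  refine ⟨M * M', ha.contDiffOn.mul hb.contDiffOn, fun j t ht => ?_⟩
  rw [iteratedDeriv_fun_mul ((ha.contDiffAt hT ht).of_le (by exact_mod_cast le_top))
    ((hb.contDiffAt hT ht).of_le (by exact_mod_cast le_top)), add_pow, Finset.mul_sum]
  refine (norm_sum_le _ _).trans (Finset.sum_le_sum fun i _ => ?_)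
  rw [norm_mul, norm_mul, RCLike.norm_natCast]
  calc (j.choose i : ℝ) * ‖iteratedDeriv i a t‖ * ‖iteratedDeriv (j - i) b t‖
      ≤ (j.choose i : ℝ) * (M * κ ^ i) * (M' * κ' ^ (j - i)) := by
        gcongr
        · exact h i t ht
        · exact h' (j - i) t ht
    _ = _ := by ring

theorem IsSlow.deriv {a : ℝ → V} (hT : IsOpen T) (ha : IsSlow T κ a) :
    IsSlow T κ (deriv a) := by
  obtain ⟨M, -, h⟩ := id ha
  rw [← iteratedDeriv_one]
  refine isSlow_of_hasDerivAt_seq (D := fun j => iteratedDeriv (j + 1) a)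
    (M := M * κ) hT (fun j t ht => ha.hasDerivAt_iteratedDeriv hT _ ht) ?_
  intro j t ht
  rw [mul_assoc, ← pow_succ']
  exact h (j + 1) t ht

end Slow

end FastSlow

namespace FastSlow

/-! ### Growth of powers in a normed ring -/

section Growth

variable {𝒜 : Type*} [NormedRing 𝒜] {x y : 𝒜} {a b : ℝ}

/-- The powers of `x` grow at most like those of `a`. -/
def PowBound (x : 𝒜) (a : ℝ) : Prop := ∃ C, 0 ≤ C ∧ ∀ r : ℕ, ‖x ^ r‖ ≤ C * a ^ r

/-- The binomial expansion of commuting elements makes the rates add exactly; the constants multiply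
but do not enter the rate. -/
theorem PowBound.add (ha : 0 ≤ a) (h : Commute x y) (hx : PowBound x a)
    (hy : PowBound y b) : PowBound (x + y) (a + b) := by
  obtain ⟨C, hC, hx⟩ := hx
  obtain ⟨C', hC', hy⟩ := hy
  refine ⟨C * C', by positivity, fun r => ?_⟩
  rw [h.add_pow, add_pow, Finset.mul_sum]
  refine (norm_sum_le _ _).trans (Finset.sum_le_sum fun i _ => ?_)
  rw [← nsmul_eq_mul']
  refine (norm_nsmul_le).trans ?_
  calc ((r.choose i : ℕ) : ℝ) * ‖x ^ i * y ^ (r - i)‖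
      ≤ (r.choose i : ℝ) * ((C * a ^ i) * (C' * b ^ (r - i))) := by
        gcongr
        refine (norm_mul_le _ _).trans ?_
        gcongr
        · exact hx i
        · exact hy _
    _ = _ := by ring

theorem PowBound.mul (ha : 0 ≤ a) (h : Commute x y) (hx : PowBound x a)
    (hy : PowBound y b) : PowBound (x * y) (a * b) := by
  obtain ⟨C, hC, hx⟩ := hx
  obtain ⟨C', hC', hy⟩ := hy
  refine ⟨C * C', by positivity, fun r => ?_⟩
  rw [h.mul_pow]
  refine (norm_mul_le _ _).trans ?_
  calc ‖x ^ r‖ * ‖y ^ r‖ ≤ (C * a ^ r) * (C' * b ^ r) := by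
        gcongr
        · exact hx r
        · exact hy r
    _ = _ := by ring

theorem PowBound.neg (hx : PowBound x a) : PowBound (-x) a := by
  obtain ⟨C, hC, hx⟩ := hx
  refine ⟨C, hC, fun r => ?_⟩
  rcases neg_one_pow_eq_or 𝒜 r with h | h
  · rw [neg_pow, h, one_mul]; exact hx r
  · rw [neg_pow, h, neg_one_mul, norm_neg]; exact hx r

theorem PowBound.sum {ι : Type*} (ha : 0 ≤ a) (s : Finset ι) {x : ι → 𝒜}
    (hc : ∀ i j, Commute (x i) (x j)) (h : ∀ i ∈ s, PowBound (x i) a) :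
    PowBound (∑ i ∈ s, x i) (s.card * a) := by
  classical
  induction s using Finset.induction_on with
  | empty =>
    refine ⟨‖(1 : 𝒜)‖, norm_nonneg _, fun r => ?_⟩
    rcases r with _ | r <;> simp
  | insert i s hi ih =>
    rw [Finset.sum_insert hi, Finset.card_insert_of_notMem hi]
    have := PowBound.add ha (Commute.sum_right s _ _ fun j _ => hc i j)
      (h i (by simp)) (ih fun j hj => h j (by simp [hj]))
    convert this using 1
    push_cast; ring

variable [CompleteSpace 𝒜]

/-- If the powers of `y` decay geometrically then `1 - y` is invertible, and the powers of the
inverse are controlled. -/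
theorem PowBound.exists_inv_one_sub (ha : 0 < a) (ha1 : a < 1) (hy : PowBound y a) :
    ∃ z, (1 - y) * z = 1 ∧ z * (1 - y) = 1 ∧ PowBound z (1 - a)⁻¹ := by
  obtain ⟨C, hC, hy⟩ := hy
  have hs : Summable fun r : ℕ => y ^ r :=
    Summable.of_norm_bounded ((summable_geometric_of_lt_one ha.le ha1).mul_left C) hy
  have h1 : (1 - y) * ∑' r : ℕ, y ^ r = 1 := hs.one_sub_mul_tsum_pow
  have h2 : (∑' r : ℕ, y ^ r) * (1 - y) = 1 := hs.tsum_pow_mul_one_sub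
  set z := ∑' r : ℕ, y ^ r
  -- an adapted norm
  let q : 𝒜 → ℝ := fun w => ⨆ i : ℕ, a⁻¹ ^ i * ‖y ^ i * w‖
  have hbd : ∀ w, BddAbove (Set.range fun i : ℕ => a⁻¹ ^ i * ‖y ^ i * w‖) := by
    intro w
    refine ⟨C * ‖w‖, ?_⟩
    rintro _ ⟨i, rfl⟩
    calc a⁻¹ ^ i * ‖y ^ i * w‖ ≤ a⁻¹ ^ i * ((C * a ^ i) * ‖w‖) := by
          gcongr
          exact (norm_mul_le _ _).trans (by gcongr; exact hy i)
      _ = C * ‖w‖ := by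
          rw [inv_pow]; field_simp
  have hq1 : ∀ w, ‖w‖ ≤ q w := fun w => by
    simpa only [pow_zero, one_mul] using le_ciSup (hbd w) 0
  have hqC : ∀ w, q w ≤ C * ‖w‖ := by
    intro w
    refine ciSup_le fun i => ?_
    calc a⁻¹ ^ i * ‖y ^ i * w‖ ≤ a⁻¹ ^ i * ((C * a ^ i) * ‖w‖) := by
          gcongr
          exact (norm_mul_le _ _).trans (by gcongr; exact hy i)
      _ = C * ‖w‖ := by
          rw [inv_pow]; field_simp
  -- A factor y shifts the index of the supremum by one, so it costs exactly a, with no constant.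
  have hqy : ∀ w, q (y * w) ≤ a * q w := by
    intro w
    refine ciSup_le fun i => ?_
    calc a⁻¹ ^ i * ‖y ^ i * (y * w)‖ = a * (a⁻¹ ^ (i + 1) * ‖y ^ (i + 1) * w‖) := by
          rw [pow_succ y, mul_assoc (y ^ i), pow_succ a⁻¹]; field_simp
      _ ≤ a * q w := by
          gcongr
          exact le_ciSup (hbd w) (i + 1)
  have hqadd : ∀ v w, q (v + w) ≤ q v + q w := by
    intro v w
    refine ciSup_le fun i => ?_
    calc a⁻¹ ^ i * ‖y ^ i * (v + w)‖
        ≤ a⁻¹ ^ i * ‖y ^ i * v‖ + a⁻¹ ^ i * ‖y ^ i * w‖ := by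
          rw [← mul_add, mul_add (y ^ i)]
          gcongr
          exact norm_add_le _ _
      _ ≤ _ := add_le_add (le_ciSup (hbd v) i) (le_ciSup (hbd w) i)
  have ha1' : 0 < 1 - a := by linarith
  have hqz : ∀ w, q (z * w) ≤ (1 - a)⁻¹ * q w := by
    intro w
    have h3 : z * w = w + y * (z * w) := by
      have : (1 - y) * (z * w) = w := by rw [← mul_assoc, h1, one_mul]
      rw [sub_mul, one_mul] at this
      exact sub_eq_iff_eq_add.1 this
    have h4 : q (z * w) ≤ q w + a * q (z * w) := by
      calc q (z * w) = q (w + y * (z * w)) := by rw [← h3]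
        _ ≤ _ := (hqadd _ _).trans (by gcongr; exact hqy _)
    rw [inv_mul_eq_div, le_div_iff₀ ha1']
    linarith
  -- In the adapted norm each factor z costs exactly (1 − a)⁻¹; the constant of comparison with the
  -- original norm is paid once, not r times.
  have hqpow : ∀ r : ℕ, q (z ^ r) ≤ (1 - a)⁻¹ ^ r * q 1 := by
    intro r
    induction r with
    | zero => simp
    | succ r ih =>
      rw [pow_succ', pow_succ', mul_assoc]
      exact (hqz _).trans (by gcongr)
  refine ⟨z, h1, h2, C * ‖(1 : 𝒜)‖, by positivity, fun r => ?_⟩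
  calc ‖z ^ r‖ ≤ (1 - a)⁻¹ ^ r * q 1 := (hq1 _).trans (hqpow r)
    _ ≤ (1 - a)⁻¹ ^ r * (C * ‖(1 : 𝒜)‖) := by gcongr; exact hqC 1
    _ = _ := by ring

/-- A perturbation of an expanding `n` by a commuting, less expanding `x`. -/
theorem PowBound.exists_inv_add (ha : 0 < a) (hab : a < b) {n n' : 𝒜} (hx : PowBound x a)
    (h1 : n * n' = 1) (h2 : n' * n = 1) (hn : PowBound n' b⁻¹) (hc : Commute x n) :
    ∃ z, (x + n) * z = 1 ∧ z * (x + n) = 1 ∧ PowBound z (b - a)⁻¹ := by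
  have hb : 0 < b := ha.trans hab
  have hc' : Commute x n' := by
    have : x * n' = n' * x := by
      calc x * n' = (n' * n) * (x * n') := by rw [h2, one_mul]
        _ = n' * (n * x) * n' := by simp only [mul_assoc]
        _ = n' * (x * n) * n' := by rw [hc.eq]
        _ = n' * x * (n * n') := by simp only [mul_assoc]
        _ = n' * x := by rw [h1, mul_one]
    exact this
  -- The factorisation x + n = (1 + x n') n is used: the powers of x n' decay at rate a/b < 1, and
  -- b⁻¹ (1 − a/b)⁻¹ = (b − a)⁻¹.
  obtain ⟨z, hz1, hz2, hz⟩ := PowBound.exists_inv_one_sub (y := -(x * n')) (a := a * b⁻¹)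
    (by positivity) (by rw [← div_eq_mul_inv, div_lt_one hb]; exact hab)
    (hx.mul ha.le hc' hn).neg
  rw [sub_neg_eq_add] at hz1 hz2
  have hcz : Commute n' z := by
    have hy : Commute n' (1 + x * n') :=
      (Commute.one_right _).add_right (hc'.symm.mul_right (Commute.refl _))
    have : n' * z = z * n' := by
      calc n' * z = (z * (1 + x * n')) * n' * z := by rw [hz2, one_mul]
        _ = z * ((1 + x * n') * n') * z := by simp only [mul_assoc]
        _ = z * (n' * (1 + x * n')) * z := by rw [hy.eq]
        _ = z * n' * ((1 + x * n') * z) := by simp only [mul_assoc]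
        _ = z * n' := by rw [hz1, mul_one]
    exact this
  have hfac : x + n = (1 + x * n') * n := by
    rw [add_mul, one_mul, mul_assoc, h2, mul_one, add_comm]
  refine ⟨n' * z, ?_, ?_, ?_⟩
  · rw [hfac, mul_assoc, ← mul_assoc n, h1, one_mul, hz1]
  · rw [hfac, mul_assoc, ← mul_assoc z, hz2, one_mul, h2]
  · convert hn.mul (by positivity) hcz hz using 1
    rw [← mul_inv]
    congr 1
    field_simp

end Growth

/-! ### Slow solutions of linear equations with constant coefficients -/

section LinearODE

variable {E : Type*} [NormedAddCommGroup E] [NormedSpace ℝ E] [CompleteSpace E] {T : Set ℝ}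
  {κ b : ℝ}

/-- A linear equation with constant coefficients has a slow solution when it is forced slowly,
at a rate below that of all its own modes. -/
theorem exists_isSlow_solution (hT : IsOpen T) (hTc : T.OrdConnected) (hκ : 0 ≤ κ) (hκb : κ < b)
    {L Z : E →L[ℝ] E} (hLZ : L * Z = 1) (hZ : PowBound Z b⁻¹) {R : ℝ → E} (hR : IsSlow T κ R) :
    ∃ c : ℝ → E, IsSlow T κ c ∧ ∀ t ∈ T, deriv c t + L (c t) = R t := by
  rcases T.eq_empty_or_nonempty with rfl | ⟨t₀, ht₀⟩
  · exact ⟨0, IsSlow.zero hT hκ, by simp⟩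
  obtain ⟨C, hC, hZ⟩ := hZ
  obtain ⟨M, hM, hRM⟩ := hR.exists_bound hκ
  have hb : 0 < b := hκ.trans_lt hκb
  -- `g j r` is the j-th derivative of the term (−1)^r Z^(r+1) R^(r) of the formal inverse of d/dt +
  -- L, applied to R. The terms decay like (κ/b)^r.
  let g : ℕ → ℕ → ℝ → E := fun j r t => ((-1) ^ r : ℝ) • (Z ^ (r + 1)) (iteratedDeriv (r + j) R t)
  have hgd : ∀ j r, ∀ t ∈ T, HasDerivAt (g j r) (g (j + 1) r t) t := by
    intro j r t ht
    have := ((Z ^ (r + 1)).hasFDerivAt.comp_hasDerivAt t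
      (hR.hasDerivAt_iteratedDeriv hT (r + j) ht)).const_smul ((-1) ^ r : ℝ)
    exact this
  have hgb : ∀ j r, ∀ t ∈ T, ‖g j r t‖ ≤ (C * b⁻¹ * M * κ ^ j) * (κ / b) ^ r := by
    intro j r t ht
    calc ‖g j r t‖ = ‖(Z ^ (r + 1)) (iteratedDeriv (r + j) R t)‖ := by
          simp [g, norm_smul]
      _ ≤ (C * b⁻¹ ^ (r + 1)) * (M * κ ^ (r + j)) :=
          (ContinuousLinearMap.le_opNorm _ _).trans (mul_le_mul (hZ _) (hRM _ t ht)
            (norm_nonneg _) (by positivity))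
      _ = _ := by rw [div_pow, pow_add, pow_succ, div_eq_mul_inv, inv_pow]; ring
  have hgeo : Summable fun r : ℕ => (κ / b) ^ r :=
    summable_geometric_of_lt_one (by positivity) ((div_lt_one hb).2 hκb)
  have hsum : ∀ j, ∀ t ∈ T, Summable fun r => g j r t := fun j t ht =>
    Summable.of_norm_bounded (hgeo.mul_left _) fun r => hgb j r t ht
  have hD : ∀ j, ∀ t ∈ T, HasDerivAt (fun s => ∑' r, g j r s) (∑' r, g (j + 1) r t) t :=
    fun j t ht => hasDerivAt_tsum_of_isPreconnected (hgeo.mul_left _) hT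
      hTc.isPreconnected (hgd j) (fun r s hs => hgb (j + 1) r s hs) ht₀ (hsum j t₀ ht₀) ht
  refine ⟨fun t => ∑' r, g 0 r t, ?_, ?_⟩
  · refine isSlow_of_hasDerivAt_seq (D := fun j t => ∑' r, g j r t)
      (M := C * b⁻¹ * M * ∑' r : ℕ, (κ / b) ^ r) hT hD fun j t ht => ?_
    calc ‖∑' r, g j r t‖ ≤ ∑' r : ℕ, (C * b⁻¹ * M * κ ^ j) * (κ / b) ^ r :=
          tsum_of_norm_bounded (hgeo.mul_left _).hasSum fun r => hgb j r t ht
      _ = _ := by rw [tsum_mul_left]; ring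
  · intro t ht
    rw [(hD 0 t ht).deriv, L.map_tsum (hsum 0 t ht)]
    have hL : ∀ r, L (g 0 r t) = ((-1) ^ r : ℝ) • (Z ^ r) (iteratedDeriv r R t) := by
      intro r
      simp only [g, map_smul, add_zero]
      rw [pow_succ', ← mul_apply_eq_comp, ← mul_assoc, hLZ, one_mul]
    have hs : Summable fun r => L (g 0 r t) := (hsum 0 t ht).mapL L
    -- The first term of L c is R; each later term cancels one term of the series for the derivative
    -- of c.
    rw [hs.tsum_eq_zero_add, hL 0]
    have : ∀ r, L (g 0 (r + 1) t) = - g 1 r t := by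
      intro r
      rw [hL]
      simp [g, pow_succ']
    simp_rw [this, tsum_neg]
    simp

end LinearODE

end FastSlow

namespace FastSlow

/-! ### From eigenvalues to powers of matrices -/

section MatrixBound

/-- The entries of the powers of `M` grow at most like the powers of `a`. -/
def MatBound {F : Type*} [Fintype F] [DecidableEq F] (M : Matrix F F ℝ) (a : ℝ) : Prop :=
  ∃ C, 0 ≤ C ∧ ∀ r : ℕ, ∀ i j, |(M ^ r) i j| ≤ C * a ^ r

variable {F : Type*} [Fintype F] [DecidableEq F] {M : Matrix F F ℝ} {a α : ℝ}

theorem MatBound.transpose (h : MatBound M a) : MatBound M.transpose a := by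
  obtain ⟨C, hC, h⟩ := h
  refine ⟨C, hC, fun r i j => ?_⟩
  rw [← Matrix.transpose_pow]
  exact h r j i

theorem MatBound.neg (h : MatBound M a) : MatBound (-M) a := by
  obtain ⟨C, hC, h⟩ := h
  refine ⟨C, hC, fun r i j => ?_⟩
  rcases neg_one_pow_eq_or (Matrix F F ℝ) r with h' | h'
  · rw [neg_pow, h', one_mul]; exact h r i j
  · rw [neg_pow, h', neg_one_mul, Matrix.neg_apply, abs_neg]; exact h r i j

/-- Gelfand's formula over ℂ: ‖A^r‖^(1/r) tends to the spectral radius, which is at most α, so it is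
eventually below a. The strict inequality α < a absorbs the polynomial factors from Jordan blocks.
-/
theorem matBound_of_spectrum (hα : 0 ≤ α) (ha : α < a)
    (h : ∀ l ∈ spectrum ℂ (M.map ((↑) : ℝ → ℂ)), ‖l‖ ≤ α) : MatBound M a := by
  let _ : NormedRing (Matrix F F ℂ) := Matrix.linftyOpNormedRing
  let _ : NormedAlgebra ℂ (Matrix F F ℂ) := Matrix.linftyOpNormedAlgebra
  have _ : CompleteSpace (Matrix F F ℂ) := FiniteDimensional.complete ℂ _
  have ha0 : 0 < a := hα.trans_lt ha
  set A : Matrix F F ℂ := M.map ((↑) : ℝ → ℂ) with hA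
  have hrad : spectralRadius ℂ A ≤ ENNReal.ofReal α := by
    refine iSup₂_le fun l hl => ?_
    rw [← ENNReal.ofReal_coe_nnreal]
    exact ENNReal.ofReal_le_ofReal (h l hl)
  have hlim := spectrum.pow_norm_pow_one_div_tendsto_nhds_spectralRadius A
  have hlt : spectralRadius ℂ A < ENNReal.ofReal a :=
    hrad.trans_lt ((ENNReal.ofReal_lt_ofReal_iff ha0).2 ha)
  obtain ⟨N, hN⟩ := Filter.eventually_atTop.1 (hlim.eventually_lt_const hlt)
  have hbig : ∀ r, N ≤ r → r ≠ 0 → ‖A ^ r‖ ≤ a ^ r := by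
    intro r hr hr0
    have h1 := (ENNReal.ofReal_lt_ofReal_iff ha0).1 (hN r hr)
    calc ‖A ^ r‖ = (‖A ^ r‖ ^ (1 / r : ℝ)) ^ r := by
          rw [one_div, Real.rpow_inv_natCast_pow (norm_nonneg _) hr0]
      _ ≤ a ^ r := by gcongr
  have hentry : ∀ r i j, |(M ^ r) i j| ≤ ‖A ^ r‖ := by
    intro r i j
    have h1 : A ^ r = (M ^ r).map ((↑) : ℝ → ℂ) :=
      ((Complex.ofRealHom.mapMatrix : Matrix F F ℝ →+* Matrix F F ℂ).map_pow M r).symm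
    have h2 : ‖(A ^ r) i j‖ = |(M ^ r) i j| := by
      rw [h1]; simp
    rw [← h2, Matrix.linfty_opNorm_def]
    have h3 : ‖(A ^ r) i j‖₊ ≤ ∑ k, ‖(A ^ r) i k‖₊ :=
      Finset.single_le_sum (f := fun k => ‖(A ^ r) i k‖₊) (fun _ _ => zero_le) (Finset.mem_univ j)
    have h4 : ∑ k, ‖(A ^ r) i k‖₊ ≤ Finset.univ.sup fun i => ∑ k, ‖(A ^ r) i k‖₊ :=
      Finset.le_sup (f := fun i => ∑ k, ‖(A ^ r) i k‖₊) (Finset.mem_univ i)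
    exact_mod_cast h3.trans h4
  -- The sum covers the finitely many powers up to N; the 1 covers those beyond, where Gelfand's
  -- bound holds.
  refine ⟨1 + ∑ r ∈ Finset.range (N + 1), ‖A ^ r‖ * a⁻¹ ^ r, by positivity, fun r i j => ?_⟩
  refine (hentry r i j).trans ?_
  have hpos : 0 ≤ ∑ r ∈ Finset.range (N + 1), ‖A ^ r‖ * a⁻¹ ^ r := by positivity
  rcases le_or_gt r N with hr | hr
  · have : ‖A ^ r‖ * a⁻¹ ^ r ≤ ∑ r ∈ Finset.range (N + 1), ‖A ^ r‖ * a⁻¹ ^ r :=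
      Finset.single_le_sum (f := fun r => ‖A ^ r‖ * a⁻¹ ^ r) (fun _ _ => by positivity)
        (Finset.mem_range.2 (by omega))
    calc ‖A ^ r‖ = (‖A ^ r‖ * a⁻¹ ^ r) * a ^ r := by
          rw [inv_pow, mul_assoc, inv_mul_cancel₀ (by positivity), mul_one]
      _ ≤ _ := by gcongr; linarith
  · calc ‖A ^ r‖ ≤ 1 * a ^ r := by rw [one_mul]; exact hbig r hr.le (by omega)
      _ ≤ _ := by gcongr; linarith

/-- A matrix all of whose eigenvalues are large is invertible, and the powers of the inverse are
small. -/
theorem exists_inverse_matBound {β b : ℝ} (hb : 0 < b) (hβ : b < β)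
    (h : ∀ l ∈ spectrum ℂ (M.map ((↑) : ℝ → ℂ)), β ≤ ‖l‖) :
    ∃ M', M * M' = 1 ∧ M' * M = 1 ∧ MatBound M' b⁻¹ := by
  set A : Matrix F F ℂ := M.map ((↑) : ℝ → ℂ) with hA
  have hmap : ∀ X : Matrix F F ℝ, (Complex.ofRealHom.mapMatrix X : Matrix F F ℂ) =
    X.map ((↑) : ℝ → ℂ) := fun X => rfl
  have h0 : IsUnit A := by
    by_contra h0
    have := h 0 (spectrum.zero_mem_iff ℂ |>.2 h0)
    rw [norm_zero] at this
    linarith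
  have hdet : IsUnit M.det := by
    rw [Matrix.isUnit_iff_isUnit_det, hA, ← hmap, ← RingHom.map_det, isUnit_iff_ne_zero] at h0
    rw [isUnit_iff_ne_zero]
    rintro h1
    simp [h1] at h0
  have hM1 : M * M⁻¹ = 1 := Matrix.mul_nonsing_inv M hdet
  have hM2 : M⁻¹ * M = 1 := Matrix.nonsing_inv_mul M hdet
  refine ⟨M⁻¹, hM1, hM2, ?_⟩
  let u : (Matrix F F ℂ)ˣ := ⟨A, M⁻¹.map ((↑) : ℝ → ℂ),
    by rw [hA, ← hmap, ← hmap, ← map_mul, hM1, map_one],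
    by rw [hA, ← hmap, ← hmap, ← map_mul, hM2, map_one]⟩
  -- The eigenvalues of the inverse are the reciprocals, of modulus at most β⁻¹ < b⁻¹.
  refine matBound_of_spectrum (α := β⁻¹) (inv_nonneg.2 (by linarith)) (inv_strictAnti₀ hb hβ) ?_
  intro l hl
  have hl' : l ∈ spectrum ℂ (↑u⁻¹ : Matrix F F ℂ) := hl
  have hl0 : l ≠ 0 := spectrum.ne_zero_of_mem_of_unit hl'
  have h1 : l⁻¹ ∈ spectrum ℂ (u : Matrix F F ℂ) := by
    have := (spectrum.inv_mem_iff (r := Units.mk0 l hl0) (a := u⁻¹)).1 hl'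
    simpa using this
  have h2 := h _ h1
  rw [norm_inv] at h2
  rw [← inv_inv ‖l‖]
  exact inv_anti₀ (by linarith) h2

end MatrixBound

/-! ### Matrices acting on separate tensor factors -/

section Slots

variable {I F G : Type*} [Fintype I] [Fintype F] [Fintype G]

/-- A component, of type `F`, of indices of type `I`. -/
structure Slot (I F : Type*) where
  get : I → F
  set : I → F → I
  get_set : ∀ x l, get (set x l) = l
  set_get : ∀ x, set x (get x) = x
  set_set : ∀ x l l', set (set x l) l' = set x l'

/-- The action of a matrix on one component of the indices. -/
noncomputable def Slot.op (s : Slot I F) (M : Matrix F F ℝ) : (I → ℝ) →L[ℝ] (I → ℝ) :=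
  LinearMap.toContinuousLinearMap
    { toFun := fun c x => ∑ l, M (s.get x) l * c (s.set x l)
      map_add' := fun c c' => by
        ext x; simp [mul_add, Finset.sum_add_distrib]
      map_smul' := fun r c => by
        ext x; simp [Finset.mul_sum, mul_left_comm] }

theorem Slot.op_apply (s : Slot I F) (M : Matrix F F ℝ) (c : I → ℝ) (x : I) :
    s.op M c x = ∑ l, M (s.get x) l * c (s.set x l) := rfl

theorem Slot.op_mul (s : Slot I F) (M M' : Matrix F F ℝ) : s.op (M * M') = s.op M * s.op M' := by
  ext c x
  simp only [mul_apply_eq_comp, Slot.op_apply, Matrix.mul_apply, s.get_set, s.set_set,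
    Finset.sum_mul, Finset.mul_sum]
  rw [Finset.sum_comm]
  simp only [mul_assoc]

theorem Slot.op_one [DecidableEq F] (s : Slot I F) : s.op 1 = 1 := by
  ext c x
  simp [Slot.op_apply, Matrix.one_apply, s.set_get]

theorem Slot.op_pow [DecidableEq F] (s : Slot I F) (M : Matrix F F ℝ) (r : ℕ) : s.op (M ^ r) = s.op M ^ r := by
  induction r with
  | zero => simp [s.op_one]
  | succ r ih => rw [pow_succ, s.op_mul, ih, pow_succ]

theorem Slot.powBound_op [DecidableEq F] (s : Slot I F) {M : Matrix F F ℝ} {a : ℝ} (ha : 0 ≤ a)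
    (h : MatBound M a) : PowBound (s.op M) a := by
  obtain ⟨C, hC, h⟩ := h
  refine ⟨Fintype.card F * C, by positivity, fun r => ?_⟩
  rw [← s.op_pow]
  refine ContinuousLinearMap.opNorm_le_bound _ (by positivity) fun c => ?_
  refine (pi_norm_le_iff_of_nonneg (by positivity)).2 fun x => ?_
  rw [Slot.op_apply]
  calc ‖∑ l, (M ^ r) (s.get x) l * c (s.set x l)‖
      ≤ ∑ _l : F, (C * a ^ r) * ‖c‖ := by
        refine (norm_sum_le _ _).trans (Finset.sum_le_sum fun l _ => ?_)
        rw [norm_mul]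
        exact mul_le_mul (h r _ _) (norm_le_pi_norm c _) (norm_nonneg _) (by positivity)
    _ = _ := by simp; ring

/-- `h1`, `h2` and `h3` say that the two components of the index are independent, so the matrices
act on different tensor factors. -/
theorem Slot.commute_op (s : Slot I F) (t : Slot I G) (h1 : ∀ x l, s.get (t.set x l) = s.get x)
    (h2 : ∀ x l, t.get (s.set x l) = t.get x)
    (h3 : ∀ x l l', s.set (t.set x l) l' = t.set (s.set x l') l)
    (M : Matrix F F ℝ) (N : Matrix G G ℝ) : Commute (s.op M) (t.op N) := by
  have : s.op M * t.op N = t.op N * s.op M := by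
    ext c x
    simp only [mul_apply_eq_comp, Slot.op_apply, h1, h2, h3, Finset.mul_sum]
    rw [Finset.sum_comm]
    simp only [mul_left_comm]
  exact this

/-- The `i`-th entry of the tuple in the first component. -/
def tupleSlot {k : ℕ} (F G : Type*) (i : Fin k) : Slot ((Fin k → F) × G) F where
  get x := x.1 i
  set x l := (Function.update x.1 i l, x.2)
  get_set := by simp
  set_get := by simp
  set_set := by simp

/-- The second component. -/
def sndSlot (F' G : Type*) : Slot (F' × G) G where
  get x := x.2
  set x l := (x.1, l)
  get_set := by simp
  set_get := by simp
  set_set := by simp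

/-- The operator is a Kronecker sum: k commuting actions with powers of rate a perturb one expanding
action. By `PowBound.exists_inv_add` the powers of its inverse have rate (b − k a)⁻¹, and `hab` puts
the forcing rate κ below b − k a. -/
theorem exists_isSlow_tensor_solution [DecidableEq F] [DecidableEq G] {T : Set ℝ} {κ a b : ℝ} (hT : IsOpen T)
    (hTc : T.OrdConnected) (hκ : 0 ≤ κ) (ha : 0 < a) {k : ℕ} (hk : 0 < k) (hab : k * a + κ < b)
    (M : Fin k → Matrix F F ℝ) (hM : ∀ i, MatBound (M i) a) {N N' : Matrix G G ℝ}
    (hN : N * N' = 1) (hN' : N' * N = 1) (hNb : MatBound N' b⁻¹)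
    (R : (Fin k → F) × G → ℝ → ℝ) (hR : ∀ x, IsSlow T κ (R x)) :
    ∃ c : (Fin k → F) × G → ℝ → ℝ, (∀ x, IsSlow T κ (c x)) ∧ ∀ t ∈ T, ∀ τ j,
      deriv (c (τ, j)) t + (∑ i, ∑ l, M i (τ i) l * c (Function.update τ i l, j) t +
        ∑ l, N j l * c (τ, l) t) = R (τ, j) t := by
  have hka : 0 < k * a := by positivity
  have hb : 0 < b := by linarith
  have hcomm : ∀ i j, Commute ((tupleSlot F G i).op (M i)) ((tupleSlot F G j).op (M j)) := by
    intro i j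
    by_cases hij : i = j
    · subst hij; exact Commute.refl _
    · refine Slot.commute_op _ _ ?_ ?_ ?_ _ _
      · intro x l; simp [tupleSlot, Function.update_of_ne hij]
      · intro x l; simp [tupleSlot, Function.update_of_ne (Ne.symm hij)]
      · intro x l l'; simp [tupleSlot, Function.update_comm hij]
  have hsum := PowBound.sum (x := fun i => (tupleSlot F G i).op (M i)) ha.le Finset.univ hcomm
    fun i _ => Slot.powBound_op _ ha.le (hM i)
  rw [Finset.card_univ, Fintype.card_fin] at hsum
  obtain ⟨Z, hZ, -, hZb⟩ := PowBound.exists_inv_add hka (by linarith : k * a < b) hsum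
    (n := (sndSlot (Fin k → F) G).op N) (n' := (sndSlot (Fin k → F) G).op N')
    (by rw [← Slot.op_mul, hN, Slot.op_one]) (by rw [← Slot.op_mul, hN', Slot.op_one])
    (Slot.powBound_op _ (by positivity) hNb)
    (Commute.sum_left _ _ _ fun i _ => Slot.commute_op _ _ (by simp [tupleSlot, sndSlot])
      (by simp [tupleSlot, sndSlot]) (by simp [tupleSlot, sndSlot]) _ _)
  obtain ⟨c, hc, hce⟩ := exists_isSlow_solution hT hTc hκ (by linarith : κ < b - k * a) hZ hZb
    (R := fun t x => R x t) (IsSlow.pi hT hκ hR)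
  refine ⟨fun x t => c t x, fun x => hc.clm_apply hT hκ (ContinuousLinearMap.proj x), ?_⟩
  intro t ht τ j
  have h1 := congrFun (hce t ht) (τ, j)
  rw [← h1]
  have h2 : deriv (fun t => c t (τ, j)) t = deriv c t (τ, j) :=
    ((hasDerivAt_pi.1 (hc.differentiableAt hT ht).hasDerivAt) (τ, j)).deriv
  simp [h2, Slot.op_apply, tupleSlot, sndSlot]

end Slots

end FastSlow

namespace FastSlow

/-! ### Order of vanishing of multinomials -/

section Order

open MvPolynomial

variable {σ : Type} {T : Set ℝ} {ν : ℝ} {q q' : ℕ}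

/-- The multinomials that, over the times in `T`, have no terms of degree less than `q`. -/
def OT (T : Set ℝ) (q : ℕ) : Ideal (TPoly σ) where
  carrier := {P | ∀ s : σ →₀ ℕ, s.degree < q → ∀ t ∈ T, coeff s P t = 0}
  zero_mem' := by simp
  add_mem' := by
    intro P Q hP hQ s hs t ht
    simp [hP s hs t ht, hQ s hs t ht]
  smul_mem' := by
    classical
    intro P Q hQ s hs t ht
    rw [smul_eq_mul, coeff_mul, Finset.sum_apply]
    refine Finset.sum_eq_zero fun x hx => ?_
    have h1 : x.1.degree + x.2.degree = s.degree := by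
      rw [← map_add, Finset.HasAntidiagonal.mem_antidiagonal.1 hx]
    simp [hQ x.2 (by omega) t ht]

theorem OT_mono {P : TPoly σ} (h : q' ≤ q) (hP : P ∈ OT T q) : P ∈ OT T q' :=
  fun s hs => hP s (hs.trans_le h)

theorem mul_mem_OT {P Q : TPoly σ} (hP : P ∈ OT T q) (hQ : Q ∈ OT T q') :
    P * Q ∈ OT T (q + q') := by
  classical
  intro s hs t ht
  rw [coeff_mul, Finset.sum_apply]
  refine Finset.sum_eq_zero fun x hx => ?_
  have h1 : x.1.degree + x.2.degree = s.degree := by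
    rw [← map_add, Finset.HasAntidiagonal.mem_antidiagonal.1 hx]
  rcases lt_or_ge x.1.degree q with h | h
  · simp [hP x.1 h t ht]
  · simp [hQ x.2 (by omega) t ht]

theorem prod_mem_OT {ι : Type*} (I : Finset ι) {P : ι → TPoly σ} {d : ι → ℕ}
    (h : ∀ i ∈ I, P i ∈ OT T (d i)) : ∏ i ∈ I, P i ∈ OT T (∑ i ∈ I, d i) := by
  classical
  induction I using Finset.induction_on with
  | empty => intro s hs; simp at hs
  | insert i I hi ih =>
    rw [Finset.prod_insert hi, Finset.sum_insert hi]
    exact mul_mem_OT (h i (by simp)) (ih fun j hj => h j (by simp [hj]))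

theorem pow_mem_OT {P : TPoly σ} (h : P ∈ OT T 1) (k : ℕ) : P ^ k ∈ OT T k := by
  simpa using prod_mem_OT (Finset.range k) (P := fun _ => P) (d := fun _ => 1) (fun _ _ => h)

theorem pderiv_mem_OT {P : TPoly σ} (h : P ∈ OT T (q + 1)) (i : σ) : pderiv i P ∈ OT T q := by
  intro s hs t ht
  rw [coeff_pderiv, Pi.mul_apply, h _ _ t ht, zero_mul]
  rw [map_add, Finsupp.degree_single]
  omega

theorem X_mem_OT (i : σ) : (X i : TPoly σ) ∈ OT T 1 := by
  classical
  intro s hs t _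
  rw [coeff_X, if_neg]
  · rfl
  · rintro rfl
    simp at hs

/-- Telescoping: exchanging the factors one at a time always leaves a difference of order q + d − 1
against the remaining factors. The truncated subtraction is harmless because q ≥ 1. -/
theorem prod_sub_prod_mem_OT {ι : Type*} (hq : 1 ≤ q) (I : Finset ι) {P Q : ι → TPoly σ}
    {d : ι → ℕ} (hP : ∀ i ∈ I, P i ∈ OT T (d i)) (hQ : ∀ i ∈ I, Q i ∈ OT T (d i))
    (h : ∀ i ∈ I, P i - Q i ∈ OT T (q + d i - 1)) :
    ∏ i ∈ I, P i - ∏ i ∈ I, Q i ∈ OT T (q + ∑ i ∈ I, d i - 1) := by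
  classical
  induction I using Finset.induction_on with
  | empty => simp
  | insert i I hi ih =>
    rw [Finset.prod_insert hi, Finset.prod_insert hi, Finset.sum_insert hi]
    have h1 := ih (fun j hj => hP j (by simp [hj])) (fun j hj => hQ j (by simp [hj]))
      (fun j hj => h j (by simp [hj]))
    have h2 := prod_mem_OT I fun j hj => hP j (Finset.mem_insert_of_mem hj)
    have : P i * ∏ j ∈ I, P j - Q i * ∏ j ∈ I, Q j =
      (P i - Q i) * ∏ j ∈ I, P j + Q i * (∏ j ∈ I, P j - ∏ j ∈ I, Q j) := by ring
    rw [this]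
    exact add_mem (OT_mono (by omega) (mul_mem_OT (h i (by simp)) h2))
      (OT_mono (by omega) (mul_mem_OT (hQ i (by simp)) h1))

theorem pow_sub_pow_mem_OT {P Q : TPoly σ} (hq : 1 ≤ q) (hP : P ∈ OT T 1) (hQ : Q ∈ OT T 1)
    (h : P - Q ∈ OT T q) (k : ℕ) : P ^ k - Q ^ k ∈ OT T (q + k - 1) := by
  simpa using prod_sub_prod_mem_OT hq (Finset.range k) (P := fun _ => P) (Q := fun _ => Q)
    (d := fun _ => 1) (fun _ _ => hP) (fun _ _ => hQ) (fun _ _ => by simpa using h)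

theorem C_mul_mem_OT_of_eq_zero {a : ℝ → ℝ} (ha : ∀ t ∈ T, a t = 0) (P : TPoly σ) :
    C a * P ∈ OT T q := by
  intro s _ t ht
  simp [coeff_C_mul, ha t ht]

variable [Fintype σ]

theorem bind_eq_sum (Ξ : σ → TPoly σ) (φ : TPoly σ) :
    bind₁ Ξ φ = ∑ s ∈ φ.support, C (coeff s φ) * ∏ i, Ξ i ^ s i := by
  rw [bind₁, aeval_def, eval₂_eq']
  rfl

theorem bind_mem_OT {Ξ : σ → TPoly σ} {φ : TPoly σ} (hΞ : ∀ i, Ξ i ∈ OT T 1)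
    (hφ : φ ∈ OT T q) : bind₁ Ξ φ ∈ OT T q := by
  rw [bind_eq_sum]
  refine sum_mem fun s _ => ?_
  rcases lt_or_ge s.degree q with h | h
  · exact C_mul_mem_OT_of_eq_zero (hφ s h) _
  · refine Ideal.mul_mem_left _ _ (OT_mono ?_
      (prod_mem_OT Finset.univ fun i _ => pow_mem_OT (hΞ i) (s i)))
    rwa [← Finsupp.degree_eq_sum]

/-- Since φ has no terms of degree below 2 over T, a change of order q in one factor is multiplied
by at least one more factor of order 1. -/
theorem bind_sub_bind_mem_OT (hq : 1 ≤ q) {Ξ Ξ' : σ → TPoly σ} {φ : TPoly σ}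
    (hΞ : ∀ i, Ξ i ∈ OT T 1) (hΞ' : ∀ i, Ξ' i ∈ OT T 1) (h : ∀ i, Ξ' i - Ξ i ∈ OT T q)
    (hφ : φ ∈ OT T 2) : bind₁ Ξ' φ - bind₁ Ξ φ ∈ OT T (q + 1) := by
  rw [bind_eq_sum, bind_eq_sum, ← Finset.sum_sub_distrib]
  refine sum_mem fun s _ => ?_
  rw [← mul_sub]
  rcases lt_or_ge s.degree 2 with h2 | h2
  · exact C_mul_mem_OT_of_eq_zero (hφ s h2) _
  · refine Ideal.mul_mem_left _ _ (OT_mono ?_ (prod_sub_prod_mem_OT hq Finset.univ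
      (fun i _ => pow_mem_OT (hΞ' i) (s i)) (fun i _ => pow_mem_OT (hΞ i) (s i))
      fun i _ => pow_sub_pow_mem_OT hq (hΞ' i) (hΞ i) (h i) (s i)))
    rw [← Finsupp.degree_eq_sum]
    omega

end Order

/-! ### Time derivatives of coefficients -/

section TimeDerivative

open MvPolynomial

variable {σ : Type} {T : Set ℝ}

/-- The time derivative of the coefficients. -/
noncomputable def dt (P : TPoly σ) : TPoly σ := ∑ s ∈ P.support, monomial s (deriv (coeff s P))

theorem coeff_dt (P : TPoly σ) (s : σ →₀ ℕ) : coeff s (dt P) = deriv (coeff s P) := by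
  classical
  rw [dt, coeff_sum]
  simp only [coeff_monomial, Finset.sum_ite_eq']
  split_ifs with h
  · rfl
  · rw [notMem_support_iff.1 h]
    ext t
    exact (deriv_const t (0 : ℝ)).symm

/-- Away from T the coefficients need not be differentiable and `deriv` need not be additive;
additivity is therefore stated at the times in T only, that is, modulo `OT T q` for any q. -/
theorem dt_add_sub_mem_OT {P Q : TPoly σ} (hP : ∀ s, ∀ t ∈ T, DifferentiableAt ℝ (coeff s P) t)
    (hQ : ∀ s, ∀ t ∈ T, DifferentiableAt ℝ (coeff s Q) t) (q : ℕ) :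
    dt (P + Q) - dt P - dt Q ∈ OT T q := by
  intro s _ t ht
  rw [coeff_sub, coeff_sub, coeff_dt, coeff_dt, coeff_dt, coeff_add]
  simp only [Pi.sub_apply]
  rw [deriv_add (hP s t ht) (hQ s t ht)]
  ring

end TimeDerivative

/-! ### Multinomials whose rates grow with the degree -/

section Graded

open MvPolynomial

variable {σ : Type} {T : Set ℝ} {ν : ℝ} {j j' : ℕ}

/-- The coefficients of degree `d` are slow at rate `(d - j) * ν`, those with `d < j` vanish. -/
def GSlow (T : Set ℝ) (ν : ℝ) (j : ℕ) (P : TPoly σ) : Prop :=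
  P ∈ OT T j ∧ ∀ s, IsSlow T ((s.degree - j : ℕ) * ν) (coeff s P)

theorem GSlow.mem_OT {P : TPoly σ} (h : GSlow T ν j P) : P ∈ OT T j := h.1

theorem GSlow.of_eq_zero (hT : IsOpen T) (hν : 0 ≤ ν) {P : TPoly σ}
    (h : ∀ s, ∀ t ∈ T, coeff s P t = 0) : GSlow T ν j P :=
  ⟨fun s _ => h s, fun s => (IsSlow.zero hT (by positivity)).congr hT (h s)⟩

theorem GSlow.add (hT : IsOpen T) {P Q : TPoly σ} (hP : GSlow T ν j P) (hQ : GSlow T ν j Q) :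
    GSlow T ν j (P + Q) :=
  ⟨add_mem hP.1 hQ.1, fun s => by rw [coeff_add]; exact (hP.2 s).add hT (hQ.2 s)⟩

theorem GSlow.sum {ι : Type*} (hT : IsOpen T) (hν : 0 ≤ ν) (I : Finset ι) {P : ι → TPoly σ}
    (h : ∀ i ∈ I, GSlow T ν j (P i)) : GSlow T ν j (∑ i ∈ I, P i) := by
  refine Finset.sum_induction _ _ (fun _ _ => GSlow.add hT) ?_ h
  exact GSlow.of_eq_zero hT hν (by simp)

/-- Degrees, offsets and rates add together: (d − j) + (d' − j') = (d + d') − (j + j'). Where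
truncated subtraction would spoil this, one of the factors vanishes on T. -/
theorem GSlow.mul (hT : IsOpen T) (hν : 0 ≤ ν) {P Q : TPoly σ} (hP : GSlow T ν j P)
    (hQ : GSlow T ν j' Q) : GSlow T ν (j + j') (P * Q) := by
  classical
  refine ⟨mul_mem_OT hP.1 hQ.1, fun s => ?_⟩
  rw [coeff_mul]
  have : ∑ x ∈ Finset.HasAntidiagonal.antidiagonal s, coeff x.1 P * coeff x.2 Q =
    fun t => ∑ x ∈ Finset.HasAntidiagonal.antidiagonal s, coeff x.1 P t * coeff x.2 Q t := by
    ext t; simp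
  rw [this]
  refine IsSlow.sum hT (by positivity) _ fun x hx => ?_
  have h1 : x.1.degree + x.2.degree = s.degree := by
    rw [← map_add, Finset.HasAntidiagonal.mem_antidiagonal.1 hx]
  rcases lt_or_ge x.1.degree j with h | h
  · exact (IsSlow.zero hT (by positivity)).congr hT fun t ht => by simp [hP.1 x.1 h t ht]
  rcases lt_or_ge x.2.degree j' with h' | h'
  · exact (IsSlow.zero hT (by positivity)).congr hT fun t ht => by simp [hQ.1 x.2 h' t ht]
  have h2 := (hP.2 x.1).mul hT (by positivity) (by positivity) (hQ.2 x.2)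
  rw [← add_mul, ← Nat.cast_add] at h2
  rwa [show s.degree - (j + j') = x.1.degree - j + (x.2.degree - j') by omega]

theorem GSlow.mono (hν : 0 ≤ ν) {P : TPoly σ} (h : j' ≤ j) (hP : GSlow T ν j P) :
    GSlow T ν j' P := by
  refine ⟨OT_mono h hP.1, fun s => (hP.2 s).mono (by positivity) ?_⟩
  gcongr

theorem GSlow.C_const (hT : IsOpen T) (hν : 0 ≤ ν) (r : ℝ) :
    GSlow T ν 0 (C (Function.const ℝ r) : TPoly σ) := by
  classical
  refine ⟨fun s hs => by simp at hs, fun s => ?_⟩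
  rw [coeff_C]
  split_ifs
  · exact IsSlow.const hT (by positivity) r
  · exact IsSlow.zero hT (by positivity)

theorem GSlow.X (hT : IsOpen T) (hν : 0 ≤ ν) (i : σ) : GSlow T ν 1 (X i : TPoly σ) := by
  classical
  refine ⟨X_mem_OT i, fun s => ?_⟩
  rw [coeff_X]
  split_ifs
  · exact IsSlow.const hT (by positivity) 1
  · exact IsSlow.zero hT (by positivity)

theorem GSlow.pderiv (hT : IsOpen T) (hν : 0 ≤ ν) {P : TPoly σ} (hP : GSlow T ν (j + 1) P)
    (i : σ) : GSlow T ν j (pderiv i P) := by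
  refine ⟨pderiv_mem_OT hP.1 i, fun s => ?_⟩
  have h1 := hP.2 (s + Finsupp.single i 1)
  rw [map_add, Finsupp.degree_single, Nat.add_sub_add_right] at h1
  rw [coeff_pderiv]
  refine (h1.clm_apply hT (by positivity) (ContinuousLinearMap.mul ℝ ℝ (s i + 1))).congr hT ?_
  intro t _
  simp; ring

theorem GSlow.dt (hT : IsOpen T) {P : TPoly σ} (hP : GSlow T ν j P) : GSlow T ν j (dt P) := by
  refine ⟨fun s hs t ht => ?_, fun s => ?_⟩
  · rw [coeff_dt]
    have : coeff s P =ᶠ[nhds t] fun _ => 0 := by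
      filter_upwards [hT.mem_nhds ht] with u hu using hP.1 s hs u hu
    rw [this.deriv_eq, deriv_const]
  · rw [coeff_dt]
    exact (hP.2 s).deriv hT

theorem GSlow.pow (hT : IsOpen T) (hν : 0 ≤ ν) {P : TPoly σ} (hP : GSlow T ν 1 P) (k : ℕ) :
    GSlow T ν k (P ^ k) := by
  induction k with
  | zero => exact GSlow.C_const hT hν 1
  | succ k ih => rw [pow_succ]; exact ih.mul hT hν hP

theorem GSlow.prod {ι : Type*} (hT : IsOpen T) (hν : 0 ≤ ν) (I : Finset ι) {P : ι → TPoly σ}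
    {d : ι → ℕ} (h : ∀ i ∈ I, GSlow T ν (d i) (P i)) :
    GSlow T ν (∑ i ∈ I, d i) (∏ i ∈ I, P i) := by
  classical
  induction I using Finset.induction_on with
  | empty => exact GSlow.C_const hT hν 1
  | insert i I hi ih =>
    rw [Finset.prod_insert hi, Finset.sum_insert hi]
    exact (h i (by simp)).mul hT hν (ih fun j hj => h j (by simp [hj]))

/-- A coefficient of rate ν uses up one unit of the offset. -/
theorem GSlow.C_mul (hT : IsOpen T) (hν : 0 ≤ ν) {a : ℝ → ℝ} (ha : IsSlow T ν a) {P : TPoly σ}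
    (hP : GSlow T ν (j + 1) P) : GSlow T ν j (C a * P) := by
  refine ⟨Ideal.mul_mem_left _ _ (OT_mono (by omega) hP.1), fun s => ?_⟩
  rw [coeff_C_mul]
  rcases lt_or_ge s.degree (j + 1) with h | h
  · exact (IsSlow.zero hT (by positivity)).congr hT fun t ht => by simp [hP.1 s h t ht]
  · have h1 := ha.mul hT hν (by positivity) (hP.2 s)
    rw [← one_add_mul, ← Nat.cast_one_add] at h1
    rwa [show s.degree - j = 1 + (s.degree - (j + 1)) by omega]

/-- A monomial of degree k ≥ 2 in entries of offset 1 has offset k; its coefficient of rate ν lowers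
this to k − 1 ≥ 1. Offset 1 is thus preserved by the nonlinearity. -/
theorem GSlow.bind [Fintype σ] (hT : IsOpen T) (hν : 0 ≤ ν) {Ξ : σ → TPoly σ} {φ : TPoly σ}
    (hΞ : ∀ i, GSlow T ν 1 (Ξ i)) (hφ : φ ∈ OT T 2) (hφ' : ∀ s, IsSlow T ν (coeff s φ)) :
    GSlow T ν 1 (bind₁ Ξ φ) := by
  rw [bind_eq_sum]
  refine GSlow.sum hT hν _ fun s _ => ?_
  rcases lt_or_ge s.degree 2 with h | h
  · exact GSlow.of_eq_zero hT hν fun s' => C_mul_mem_OT_of_eq_zero (hφ s h) _ s'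
      (Nat.lt_succ_self _)
  · have h1 := GSlow.prod hT hν Finset.univ fun i _ => (hΞ i).pow hT hν (s i)
    rw [← Finsupp.degree_eq_sum] at h1
    exact GSlow.C_mul hT hν (hφ' s) (h1.mono hν h)

theorem GSlow.differentiableAt (hT : IsOpen T) {P : TPoly σ} (h : GSlow T ν j P) (s : σ →₀ ℕ) :
    ∀ t ∈ T, DifferentiableAt ℝ (coeff s P) t := fun _ ht => (h.2 s).differentiableAt hT ht

end Graded

/-! ### The residual and its linearisation -/

section Residual

open MvPolynomial

variable {σ : Type} [Fintype σ] {T : Set ℝ} {ν : ℝ} {q : ℕ}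

/-- The `i`-th component of the linear field with matrix `Λ`, at the variables `Ξ`. -/
noncomputable def linPoly (Λ : Matrix σ σ ℝ) (Ξ : σ → TPoly σ) (i : σ) : TPoly σ :=
  ∑ l, C (Function.const ℝ (Λ i l)) * Ξ l

/-- The residual of the field `Λ u + φ` after the substitution of `u = Ξ` and of the velocity
`V`. -/
noncomputable def residual (Λ : Matrix σ σ ℝ) (φ Ξ V : σ → TPoly σ) (i : σ) : TPoly σ :=
  dt (Ξ i) + ∑ l, pderiv l (Ξ i) * V l - linPoly Λ Ξ i - bind₁ Ξ (φ i)

/-- The linearised effect, on the residual, of corrections `h` and `w` of the substitution and of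
the velocity. -/
noncomputable def homological (Λ : Matrix σ σ ℝ) (h w : σ → TPoly σ) (i : σ) : TPoly σ :=
  dt (h i) + ∑ l, pderiv l (h i) * linPoly Λ X l + w i - linPoly Λ h i

theorem GSlow.linPoly (hT : IsOpen T) (hν : 0 ≤ ν) {j : ℕ} (Λ : Matrix σ σ ℝ) {Ξ : σ → TPoly σ}
    (h : ∀ i, GSlow T ν j (Ξ i)) (i : σ) : GSlow T ν j (linPoly Λ Ξ i) :=
  GSlow.sum hT hν _ fun l _ => by
    simpa using (GSlow.C_const hT hν (Λ i l)).mul hT hν (h l)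

/-- This fixes the forcing rate of the next correction: coefficients of degree q of the residual are
slow at rate (q − 1)ν. -/
theorem GSlow.residual (hT : IsOpen T) (hν : 0 ≤ ν) (Λ : Matrix σ σ ℝ) {φ Ξ V : σ → TPoly σ}
    (hΞ : ∀ i, GSlow T ν 1 (Ξ i)) (hV : ∀ i, GSlow T ν 1 (V i))
    (hφ : ∀ i, φ i ∈ OT T 2) (hφ' : ∀ i s, IsSlow T ν (coeff s (φ i))) (i : σ) :
    GSlow T ν 1 (residual Λ φ Ξ V i) := by
  have hneg : ∀ {P : TPoly σ}, GSlow T ν 1 P → GSlow T ν 1 (-P) := by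
    intro P hP
    refine ⟨neg_mem hP.1, fun s => ?_⟩
    rw [coeff_neg]
    exact (hP.2 s).clm_apply hT (by positivity) (-ContinuousLinearMap.id ℝ ℝ)
  rw [FastSlow.residual, sub_eq_add_neg, sub_eq_add_neg]
  refine GSlow.add hT (GSlow.add hT (GSlow.add hT ((hΞ i).dt hT) ?_)
    (hneg (GSlow.linPoly hT hν Λ hΞ i))) (hneg (GSlow.bind hT hν hΞ (hφ i) (hφ' i)))
  refine GSlow.sum hT hν _ fun l _ => ?_
  simpa using (GSlow.pderiv hT hν (j := 0) (hΞ i) l).mul hT hν (hV l)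

/-- What the linearisation drops is small: ∂h times the nonlinear part of V, ∂(Ξ − X) times w, ∂h
times w, and the change of φ(Ξ). The third has order 2q − 1, which is why q ≥ 2 is needed. -/
theorem residual_add_sub_mem_OT (hq : 2 ≤ q) (Λ : Matrix σ σ ℝ) {φ Ξ V h w : σ → TPoly σ}
    (hΞd : ∀ i s, ∀ t ∈ T, DifferentiableAt ℝ (coeff s (Ξ i)) t)
    (hhd : ∀ i s, ∀ t ∈ T, DifferentiableAt ℝ (coeff s (h i)) t)
    (hΞ : ∀ i, Ξ i - X i ∈ OT T 2) (hV : ∀ i, V i - linPoly Λ X i ∈ OT T 2)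
    (hφ : ∀ i, φ i ∈ OT T 2) (hh : ∀ i, h i ∈ OT T q) (hw : ∀ i, w i ∈ OT T q) (i : σ) :
    residual Λ φ (Ξ + h) (V + w) i - (residual Λ φ Ξ V i + homological Λ h w i) ∈
      OT T (q + 1) := by
  classical
  have hΞ1 : ∀ i, Ξ i ∈ OT T 1 := fun i => by
    simpa using add_mem (OT_mono (by norm_num) (hΞ i)) (X_mem_OT (T := T) i)
  -- Written as the derivative of the identity along w, the term w turns (∂Ξ) w − w into ∂(Ξ − X) w.
  have hw' : w i = ∑ l, pderiv l (X i : TPoly σ) * w l := by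
    simp [pderiv_X, Pi.single_apply, Finset.sum_ite_eq]
  have hlin : linPoly Λ (Ξ + h) i = linPoly Λ Ξ i + linPoly Λ h i := by
    simp [linPoly, mul_add, Finset.sum_add_distrib]
  have hkey : residual Λ φ (Ξ + h) (V + w) i - (residual Λ φ Ξ V i + homological Λ h w i) =
      (dt (Ξ i + h i) - dt (Ξ i) - dt (h i)) +
      (∑ l, (pderiv l (h i) * (V l - linPoly Λ X l) + pderiv l (Ξ i - X i) * w l +
        pderiv l (h i) * w l)) - (bind₁ (Ξ + h) (φ i) - bind₁ Ξ (φ i)) := by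
    rw [residual, residual, homological, hlin]
    conv_lhs => rw [hw']
    simp only [Pi.add_apply, map_add, map_sub, add_mul, mul_add, mul_sub, sub_mul,
      Finset.sum_add_distrib, Finset.sum_sub_distrib]
    ring
  rw [hkey]
  obtain ⟨q, rfl⟩ : ∃ k, q = k + 1 := ⟨q - 1, by omega⟩
  refine sub_mem (add_mem (dt_add_sub_mem_OT (hΞd i) (hhd i) _) (sum_mem fun l _ => ?_)) ?_
  · refine add_mem (add_mem ?_ ?_) ?_
    · exact OT_mono (by omega) (mul_mem_OT (pderiv_mem_OT (hh i) l) (hV l))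
    · exact OT_mono (by omega) (mul_mem_OT (pderiv_mem_OT (hΞ i) l) (hw l))
    · exact OT_mono (by omega) (mul_mem_OT (pderiv_mem_OT (hh i) l) (hw l))
  · refine bind_sub_bind_mem_OT (by omega) hΞ1 (fun j => ?_) (fun j => ?_) (hφ i)
    · exact add_mem (hΞ1 j) (OT_mono (by omega) (hh j))
    · simpa using hh j

end Residual

end FastSlow

namespace FastSlow

/-! ### Homogeneous multinomials with slow coefficients -/

section Homogeneous

open MvPolynomial

variable {σ : Type} {T : Set ℝ} {ν κ : ℝ} {q : ℕ}

theorem slowCoeffs_zero (hT : IsOpen T) (hκ : 0 ≤ κ) : (0 : TPoly σ).SlowCoeffs T κ :=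
  fun _ => IsSlow.zero hT hκ

theorem slowCoeffs_add (hT : IsOpen T) {P Q : TPoly σ} (hP : P.SlowCoeffs T κ)
    (hQ : Q.SlowCoeffs T κ) : (P + Q).SlowCoeffs T κ := fun s => by
  rw [coeff_add]
  exact IsSlow.add hT (hP s) (hQ s)

theorem slowCoeffs_sum {ι : Type*} (hT : IsOpen T) (hκ : 0 ≤ κ) (I : Finset ι) {P : ι → TPoly σ}
    (h : ∀ i ∈ I, (P i).SlowCoeffs T κ) : (∑ i ∈ I, P i).SlowCoeffs T κ :=
  Finset.sum_induction _ _ (fun _ _ => slowCoeffs_add hT) (slowCoeffs_zero hT hκ) h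

theorem slowCoeffs_monomial (hT : IsOpen T) (hκ : 0 ≤ κ) {a : ℝ → ℝ} (ha : IsSlow T κ a)
    (s : σ →₀ ℕ) : TPoly.SlowCoeffs T κ (monomial s a : TPoly σ) := fun s' => by
  classical
  rw [coeff_monomial]
  split_ifs
  · exact ha
  · exact IsSlow.zero hT hκ

theorem slowCoeffs_mono {κ' : ℝ} (hκ : 0 ≤ κ) (h : κ ≤ κ') {P : TPoly σ}
    (hP : P.SlowCoeffs T κ) : P.SlowCoeffs T κ' := fun s => IsSlow.mono hκ h (hP s)

/-- Homogeneous of degree `q`, with coefficients slow at rate `κ`. -/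
def HSlow (T : Set ℝ) (κ : ℝ) (q : ℕ) (P : TPoly σ) : Prop :=
  (∀ s : σ →₀ ℕ, s.degree ≠ q → coeff s P = 0) ∧ P.SlowCoeffs T κ

theorem HSlow.zero (hT : IsOpen T) (hκ : 0 ≤ κ) : HSlow T κ q (0 : TPoly σ) :=
  ⟨by simp, slowCoeffs_zero hT hκ⟩

theorem HSlow.add (hT : IsOpen T) {P Q : TPoly σ} (hP : HSlow T κ q P) (hQ : HSlow T κ q Q) :
    HSlow T κ q (P + Q) :=
  ⟨fun s hs => by simp [hP.1 s hs, hQ.1 s hs], slowCoeffs_add hT hP.2 hQ.2⟩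

theorem HSlow.sum {ι : Type*} (hT : IsOpen T) (hκ : 0 ≤ κ) (I : Finset ι) {P : ι → TPoly σ}
    (h : ∀ i ∈ I, HSlow T κ q (P i)) : HSlow T κ q (∑ i ∈ I, P i) :=
  Finset.sum_induction _ _ (fun _ _ => HSlow.add hT) (HSlow.zero hT hκ) h

theorem HSlow.monomial (hT : IsOpen T) (hκ : 0 ≤ κ) {a : ℝ → ℝ} (ha : IsSlow T κ a)
    {s : σ →₀ ℕ} (hs : s.degree = q) : HSlow T κ q (MvPolynomial.monomial s a) := by
  classical
  refine ⟨fun s' hs' => ?_, slowCoeffs_monomial hT hκ ha s⟩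
  rw [coeff_monomial, if_neg]
  rintro rfl
  exact hs' hs

theorem HSlow.mem_OT {P : TPoly σ} (hP : HSlow T κ q P) : P ∈ OT T q := fun s hs t _ => by
  rw [hP.1 s hs.ne]; rfl

theorem HSlow.gSlow (hT : IsOpen T) (hν : 0 ≤ ν) (hq : 1 ≤ q) {P : TPoly σ}
    (hP : HSlow T ((q - 1 : ℕ) * ν) q P) : GSlow T ν 1 P := by
  refine ⟨OT_mono hq hP.mem_OT, fun s => ?_⟩
  by_cases hs : s.degree = q
  · rw [hs]; exact hP.2 s
  · rw [hP.1 s hs]; exact IsSlow.zero hT (by positivity)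

theorem HSlow.differentiableAt (hT : IsOpen T) {P : TPoly σ} (h : HSlow T κ q P) (s : σ →₀ ℕ) :
    ∀ t ∈ T, DifferentiableAt ℝ (coeff s P) t := fun _ ht => IsSlow.differentiableAt hT (h.2 s) ht

theorem dt_zero : dt (0 : TPoly σ) = 0 := by simp [dt]

/-- Time derivatives of combinations of multinomials with constant coefficients. -/
theorem dt_sum_sub_mem_OT {ι : Type*} (I : Finset ι) {c : ι → ℝ → ℝ} (e : ι → σ →₀ ℕ)
    (hc : ∀ i ∈ I, ∀ t ∈ T, DifferentiableAt ℝ (c i) t) :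
    dt (∑ i ∈ I, monomial (e i) (c i)) - ∑ i ∈ I, monomial (e i) (deriv (c i)) ∈ OT T q := by
  classical
  intro s _ t ht
  rw [coeff_sub, coeff_dt, coeff_sum, coeff_sum]
  have h1 : (∑ i ∈ I, coeff s (monomial (e i) (c i))) =
      fun t => ∑ i ∈ I, if e i = s then c i t else 0 := by
    ext t
    rw [Finset.sum_apply]
    refine Finset.sum_congr rfl fun i _ => ?_
    rw [coeff_monomial]
    split_ifs <;> rfl
  rw [Pi.sub_apply, h1, deriv_fun_sum, Finset.sum_apply, sub_eq_zero]
  · refine Finset.sum_congr rfl fun i _ => ?_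
    rw [coeff_monomial]
    split_ifs <;> simp
  · intro i hi
    split_ifs
    · exact hc i hi t ht
    · exact differentiableAt_const _

end Homogeneous

section Derivation

variable {R A ι : Type*} [CommSemiring R] [CommSemiring A] [Algebra R A] [DecidableEq ι]

theorem derivation_prod (D : Derivation R A A) (s : Finset ι) (f : ι → A) :
    D (∏ b ∈ s, f b) = ∑ a ∈ s, D (f a) * ∏ b ∈ s.erase a, f b := by
  induction s using Finset.induction_on with
  | empty => simp
  | insert i s hi ih =>
    rw [Finset.prod_insert hi, D.leibniz, ih, Finset.sum_insert hi, Finset.erase_insert hi,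
      smul_eq_mul, smul_eq_mul, Finset.mul_sum, add_comm, mul_comm]
    congr 1
    refine Finset.sum_congr rfl fun a ha => ?_
    have hia : i ≠ a := fun h => hi (h ▸ ha)
    rw [Finset.erase_insert_of_ne hia, Finset.prod_insert (by simp [hi])]
    ring

end Derivation

/-! ### Monomials listed by tuples of slow variables -/

section Monomials

open MvPolynomial

variable {m n : ℕ}

/-- The exponents of the product of slow variables that is listed by a tuple. -/
noncomputable def tupleExp {k : ℕ} (τ : Fin k → Fin m) : Fin m ⊕ Fin n →₀ ℕ :=
  ∑ a, Finsupp.single (Sum.inl (τ a)) 1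

theorem degree_tupleExp {k : ℕ} (τ : Fin k → Fin m) :
    (tupleExp τ : Fin m ⊕ Fin n →₀ ℕ).degree = k := by
  simp [tupleExp, map_sum]

theorem monomial_tupleExp {k : ℕ} (τ : Fin k → Fin m) (a : ℝ → ℝ) :
    (monomial (tupleExp τ) a : TPoly (Fin m ⊕ Fin n)) = C a * ∏ b, X (Sum.inl (τ b)) := by
  have : (∏ b, X (Sum.inl (τ b)) : TPoly (Fin m ⊕ Fin n)) = monomial (tupleExp τ) 1 := by
    rw [tupleExp, monomial_sum_one]
    rfl
  rw [this, C_mul_monomial, mul_one]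

/-- This sorts monomials by their fast factors; applying it again to the cofactor distinguishes one
fast factor from at least two. -/
theorem exponent_cases (q : ℕ) : ∀ s : Fin m ⊕ Fin n →₀ ℕ, s.degree = q →
    (∃ τ : Fin q → Fin m, s = tupleExp τ) ∨ ∃ s' k, s = s' + Finsupp.single (Sum.inr k) 1 := by
  induction q with
  | zero =>
    intro s hs
    refine .inl ⟨Fin.elim0, ?_⟩
    rw [(Finsupp.degree_eq_zero_iff s).1 hs]
    simp [tupleExp]
  | succ q ih =>
    intro s hs
    obtain ⟨i, hi⟩ : ∃ i, s i ≠ 0 := by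
      by_contra! h
      have : s = 0 := Finsupp.ext h
      simp [this] at hs
    have hs1 : s - Finsupp.single i 1 + Finsupp.single i 1 = s :=
      tsub_add_cancel_of_le (Finsupp.single_le_iff.2 (Nat.one_le_iff_ne_zero.2 hi))
    generalize s - Finsupp.single i 1 = s1 at hs1
    subst hs1
    rcases i with l | k
    · rw [map_add, Finsupp.degree_single] at hs
      rcases ih s1 (by omega) with ⟨τ, rfl⟩ | ⟨s', k, rfl⟩
      · refine .inl ⟨Fin.cons l τ, ?_⟩
        simp [tupleExp, Fin.sum_univ_succ, add_comm]
      · exact .inr ⟨s' + Finsupp.single (Sum.inl l) 1, k, by abel⟩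
    · exact .inr ⟨s1, k, rfl⟩

end Monomials

/-! ### The linear field acting on tensors of coefficients -/

section TensorPoly

open MvPolynomial

variable {m n : ℕ} {T : Set ℝ}

/-- The derivation along the linear field with matrix `Λ`. -/
noncomputable def linDer {σ : Type} [Fintype σ] (Λ : Matrix σ σ ℝ) :
    Derivation (ℝ → ℝ) (TPoly σ) (TPoly σ) :=
  ∑ l, linPoly Λ X l • pderiv l

theorem linDer_apply {σ : Type} [Fintype σ] (Λ : Matrix σ σ ℝ) (P : TPoly σ) :
    linDer Λ P = ∑ l, pderiv l P * linPoly Λ X l := by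
  have : linDer Λ P = ∑ l, (linPoly Λ X l • pderiv l) P := by
    have h := congrFun (map_sum (Derivation.coeFnAddMonoidHom (R := ℝ → ℝ) (A := TPoly σ)
      (M := TPoly σ)) (fun l => linPoly Λ X l • pderiv l) Finset.univ) P
    rw [Finset.sum_apply] at h
    exact h
  rw [this]
  refine Finset.sum_congr rfl fun l _ => ?_
  rw [Derivation.smul_apply, smul_eq_mul, mul_comm]

theorem linDer_X {σ : Type} [Fintype σ] (Λ : Matrix σ σ ℝ) (i : σ) :
    linDer Λ (X i) = linPoly Λ X i := by
  classical
  rw [linDer_apply]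
  simp [pderiv_X, Pi.single_apply]

/-- The swap of a tuple's entry with a separate index. -/
def swapEntry {k : ℕ} {F : Type*} (a : Fin k) : (Fin k → F) × F ≃ (Fin k → F) × F where
  toFun x := (Function.update x.1 a x.2, x.1 a)
  invFun x := (Function.update x.1 a x.2, x.1 a)
  left_inv x := by simp
  right_inv x := by simp

variable (A : Matrix (Fin m) (Fin m) ℝ) (B : Matrix (Fin n) (Fin n) ℝ)

theorem linPoly_fromBlocks_inl (Ξ : Fin m ⊕ Fin n → TPoly (Fin m ⊕ Fin n)) (i : Fin m) :
    linPoly (Matrix.fromBlocks A 0 0 B) Ξ (Sum.inl i) =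
      ∑ l, C (Function.const ℝ (A i l)) * Ξ (Sum.inl l) := by
  have h0 : (Function.const ℝ (0 : ℝ)) = 0 := rfl
  simp [linPoly, Fintype.sum_sum_type, h0]

theorem linPoly_fromBlocks_inr (Ξ : Fin m ⊕ Fin n → TPoly (Fin m ⊕ Fin n)) (j : Fin n) :
    linPoly (Matrix.fromBlocks A 0 0 B) Ξ (Sum.inr j) =
      ∑ l, C (Function.const ℝ (B j l)) * Ξ (Sum.inr l) := by
  have h0 : (Function.const ℝ (0 : ℝ)) = 0 := rfl
  simp [linPoly, Fintype.sum_sum_type, h0]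

theorem linDer_tuple {k : ℕ} (τ : Fin k → Fin m) :
    linDer (Matrix.fromBlocks A 0 0 B) (monomial (tupleExp τ) 1 : TPoly (Fin m ⊕ Fin n)) =
      ∑ a, ∑ l, monomial (tupleExp (Function.update τ a l)) (Function.const ℝ (A (τ a) l)) := by
  classical
  rw [monomial_tupleExp, C_1, one_mul, derivation_prod]
  refine Finset.sum_congr rfl fun a _ => ?_
  rw [linDer_X, linPoly_fromBlocks_inl, Finset.sum_mul]
  refine Finset.sum_congr rfl fun l _ => ?_
  rw [monomial_tupleExp, ← Finset.mul_prod_erase Finset.univ _ (Finset.mem_univ a), mul_assoc]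
  congr 2
  · simp
  · refine Finset.prod_congr rfl fun b hb => ?_
    rw [Function.update_of_ne (Finset.ne_of_mem_erase hb)]

/-- By Leibniz's rule A acts on each entry of the tuple in turn; carried over to the coefficients it
becomes its transpose. Tuples that differ by a permutation give the same monomial, but c need not be
symmetric: solving the tensor equation is sufficient for the multinomial one. -/
theorem linDer_tensor {k : ℕ} (c : (Fin k → Fin m) → ℝ → ℝ) :
    linDer (Matrix.fromBlocks A 0 0 B)
      (∑ τ, monomial (tupleExp τ) (c τ) : TPoly (Fin m ⊕ Fin n)) =
      ∑ τ, monomial (tupleExp τ)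
        (fun t => ∑ a, ∑ l, A l (τ a) * c (Function.update τ a l) t) := by
  have h1 : ∀ τ : Fin k → Fin m, linDer (Matrix.fromBlocks A 0 0 B)
      (monomial (tupleExp τ) (c τ) : TPoly (Fin m ⊕ Fin n)) =
      ∑ a, ∑ l, monomial (tupleExp (Function.update τ a l)) (fun t => A (τ a) l * c τ t) := by
    intro τ
    have : (monomial (tupleExp τ) (c τ) : TPoly (Fin m ⊕ Fin n)) =
        c τ • monomial (tupleExp τ) 1 := by rw [smul_monomial, smul_eq_mul, mul_one]
    rw [this, Derivation.map_smul, linDer_tuple, Finset.smul_sum]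
    simp only [Finset.smul_sum, smul_monomial, smul_eq_mul]
    refine Finset.sum_congr rfl fun a _ => Finset.sum_congr rfl fun l _ => ?_
    congr 1
    ext t
    simp [mul_comm]
  have h2 : ∀ τ : Fin k → Fin m, (monomial (tupleExp τ)
      (fun t => ∑ a, ∑ l, A l (τ a) * c (Function.update τ a l) t) : TPoly (Fin m ⊕ Fin n)) =
      ∑ a, ∑ l, monomial (tupleExp τ) (fun t => A l (τ a) * c (Function.update τ a l) t) := by
    intro τ
    simp only [← map_sum]
    congr 1
    ext t
    simp [Finset.sum_apply]
  rw [map_sum]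
  simp only [h1, h2]
  rw [Finset.sum_comm]
  conv_rhs => rw [Finset.sum_comm]
  refine Finset.sum_congr rfl fun a _ => ?_
  rw [← Fintype.sum_prod_type', ← Fintype.sum_prod_type']
  -- The swap exchanges the entry before the replacement with the one after it, which is what
  -- transposes A.
  rw [← (swapEntry a).sum_comp]
  refine Finset.sum_congr rfl fun x _ => ?_
  simp [swapEntry]

end TensorPoly

end FastSlow

namespace FastSlow

/-! ### Combinations of monomials over a finite index type -/

section Comb

open MvPolynomial

variable {σ ι : Type} [Fintype ι] {T : Set ℝ} {κ : ℝ} {q : ℕ}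

/-- The multinomial with the coefficients `c` at the exponents `e`. -/
noncomputable def comb (e : ι → σ →₀ ℕ) (c : ι → ℝ → ℝ) : TPoly σ := ∑ x, monomial (e x) (c x)

theorem comb_add (e : ι → σ →₀ ℕ) (c c' : ι → ℝ → ℝ) :
    comb e (c + c') = comb e c + comb e c' := by
  simp [comb, Finset.sum_add_distrib]

theorem comb_sub (e : ι → σ →₀ ℕ) (c c' : ι → ℝ → ℝ) :
    comb e (c - c') = comb e c - comb e c' := by
  simp [comb, Finset.sum_sub_distrib]

theorem sum_C_mul_comb {l : Type} [Fintype l] (e : ι → σ →₀ ℕ) (r : l → ℝ)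
    (c : l → ι → ℝ → ℝ) :
    ∑ i, C (Function.const ℝ (r i)) * comb e (c i) = comb e fun x t => ∑ i, r i * c i x t := by
  simp only [comb, Finset.mul_sum, C_mul_monomial]
  rw [Finset.sum_comm]
  refine Finset.sum_congr rfl fun x _ => ?_
  rw [← map_sum]
  congr 1
  ext t
  simp [Finset.sum_apply]

theorem comb_single [DecidableEq ι] (e : ι → σ →₀ ℕ) (x : ι) (a : ℝ → ℝ) :
    comb e (fun y => if y = x then a else 0) = monomial (e x) a := by
  rw [comb, Finset.sum_eq_single x]
  · simp
  · intro y _ hy; simp [hy]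
  · simp

theorem comb_mem_OT (e : ι → σ →₀ ℕ) {c : ι → ℝ → ℝ} (h : ∀ x, ∀ t ∈ T, c x t = 0) :
    comb e c ∈ OT T q := by
  classical
  refine sum_mem fun x _ s _ t ht => ?_
  rw [coeff_monomial]
  split_ifs
  · exact h x t ht
  · rfl

theorem hSlow_comb (hT : IsOpen T) (hκ : 0 ≤ κ) {e : ι → σ →₀ ℕ} (he : ∀ x, (e x).degree = q)
    {c : ι → ℝ → ℝ} (hc : ∀ x, IsSlow T κ (c x)) : HSlow T κ q (comb e c) :=
  HSlow.sum hT hκ _ fun x _ => HSlow.monomial hT hκ (hc x) (he x)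

theorem dt_comb_sub_mem_OT (hT : IsOpen T) (e : ι → σ →₀ ℕ) {c : ι → ℝ → ℝ}
    (hc : ∀ x, IsSlow T κ (c x)) : dt (comb e c) - comb e (fun x => deriv (c x)) ∈ OT T q :=
  dt_sum_sub_mem_OT _ e fun x _ _ ht => (hc x).differentiableAt hT ht

end Comb

/-! ### Solving the homological equation -/

section Correction

open MvPolynomial

variable {m n : ℕ} {T : Set ℝ} {κ : ℝ} {q : ℕ}

/-- The multinomials `x` and `y` of the transform. -/
def NormalForm.substPoly (N : NormalForm m n) : Fin m ⊕ Fin n → TPoly (Fin m ⊕ Fin n) :=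
  Sum.elim N.xi N.eta

/-- The multinomials `F_c + 𝓕 Y Y` and `G Y`. -/
noncomputable def NormalForm.nonlinPoly (N : NormalForm m n) :
    Fin m ⊕ Fin n → TPoly (Fin m ⊕ Fin n) :=
  Sum.elim
    (fun i => rename Sum.inl (N.Fc i) +
      ∑ j, ∑ k, N.quad i j k * X (Sum.inr j) * X (Sum.inr k))
    (fun j => ∑ k, N.G j k * X (Sum.inr k))

noncomputable instance : Zero (NormalForm m n) := ⟨⟨0, 0, 0, 0, 0⟩⟩

noncomputable instance : Add (NormalForm m n) :=
  ⟨fun N N' => ⟨N.xi + N'.xi, N.eta + N'.eta, N.Fc + N'.Fc, N.quad + N'.quad, N.G + N'.G⟩⟩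

theorem NormalForm.substPoly_add (N N' : NormalForm m n) :
    (N + N').substPoly = N.substPoly + N'.substPoly := by
  ext (i | j) <;> rfl

theorem NormalForm.nonlinPoly_add (N N' : NormalForm m n) :
    (N + N').nonlinPoly = N.nonlinPoly + N'.nonlinPoly := by
  have h1 : (N + N').Fc = N.Fc + N'.Fc := rfl
  have h2 : (N + N').quad = N.quad + N'.quad := rfl
  have h3 : (N + N').G = N.G + N'.G := rfl
  funext i
  rcases i with i | j
  · simp only [nonlinPoly, Sum.elim_inl, Pi.add_apply, h1, h2, map_add, add_mul,
      Finset.sum_add_distrib]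
    ring
  · simp only [nonlinPoly, Sum.elim_inr, Pi.add_apply, h3, add_mul, Finset.sum_add_distrib]

theorem NormalForm.substPoly_zero : (0 : NormalForm m n).substPoly = 0 := by
  ext (i | j) <;> rfl

theorem NormalForm.nonlinPoly_zero : (0 : NormalForm m n).nonlinPoly = 0 := by
  have h1 : (0 : NormalForm m n).Fc = 0 := rfl
  have h2 : (0 : NormalForm m n).quad = 0 := rfl
  have h3 : (0 : NormalForm m n).G = 0 := rfl
  funext i
  rcases i with i | j
  · simp [nonlinPoly, h1, h2]
  · simp [nonlinPoly, h3]

theorem NormalForm.slowCoeffs_zero (hT : IsOpen T) (hκ : 0 ≤ κ) :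
    (0 : NormalForm m n).SlowCoeffs T κ :=
  ⟨fun _ => FastSlow.slowCoeffs_zero hT hκ, fun _ => FastSlow.slowCoeffs_zero hT hκ,
    fun _ => FastSlow.slowCoeffs_zero hT hκ, fun _ _ _ => FastSlow.slowCoeffs_zero hT hκ,
    fun _ _ => FastSlow.slowCoeffs_zero hT hκ⟩

theorem NormalForm.SlowCoeffs.add (hT : IsOpen T) {N N' : NormalForm m n}
    (h : N.SlowCoeffs T κ) (h' : N'.SlowCoeffs T κ) : (N + N').SlowCoeffs T κ :=
  ⟨fun i => slowCoeffs_add hT (h.1 i) (h'.1 i), fun i => slowCoeffs_add hT (h.2.1 i) (h'.2.1 i),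
    fun i => slowCoeffs_add hT (h.2.2.1 i) (h'.2.2.1 i),
    fun i j k => slowCoeffs_add hT (h.2.2.2.1 i j k) (h'.2.2.2.1 i j k),
    fun j k => slowCoeffs_add hT (h.2.2.2.2 j k) (h'.2.2.2.2 j k)⟩

theorem NormalForm.SlowCoeffs.mono {κ' : ℝ} (hκ : 0 ≤ κ) (h : κ ≤ κ') {N : NormalForm m n}
    (hN : N.SlowCoeffs T κ) : N.SlowCoeffs T κ' :=
  ⟨fun i => slowCoeffs_mono hκ h (hN.1 i), fun i => slowCoeffs_mono hκ h (hN.2.1 i),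
    fun i => slowCoeffs_mono hκ h (hN.2.2.1 i),
    fun i j k => slowCoeffs_mono hκ h (hN.2.2.2.1 i j k),
    fun j k => slowCoeffs_mono hκ h (hN.2.2.2.2 j k)⟩

variable (A : Matrix (Fin m) (Fin m) ℝ) (B : Matrix (Fin n) (Fin n) ℝ)

/-- The residual `R` of degree `q` can be removed by a correction of the normal form. -/
def Correctable (T : Set ℝ) (κ : ℝ) (q : ℕ) (R : Fin m ⊕ Fin n → TPoly (Fin m ⊕ Fin n)) : Prop :=
  ∃ N : NormalForm m n, N.SlowCoeffs T κ ∧ (∀ i, HSlow T κ q (N.substPoly i)) ∧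
    (∀ i, HSlow T κ q (N.nonlinPoly i)) ∧
    ∀ i, R i + homological (Matrix.fromBlocks A 0 0 B) N.substPoly N.nonlinPoly i ∈ OT T (q + 1)

theorem homological_add_sub_mem_OT {σ : Type} [Fintype σ] (Λ : Matrix σ σ ℝ)
    {h h' w w' : σ → TPoly σ} (hd : ∀ i s, ∀ t ∈ T, DifferentiableAt ℝ (coeff s (h i)) t)
    (hd' : ∀ i s, ∀ t ∈ T, DifferentiableAt ℝ (coeff s (h' i)) t) (i : σ) :
    homological Λ (h + h') (w + w') i - (homological Λ h w i + homological Λ h' w' i) ∈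
      OT T q := by
  convert dt_add_sub_mem_OT (hd i) (hd' i) q using 1
  simp only [homological, linPoly, Pi.add_apply, map_add, add_mul, mul_add,
    Finset.sum_add_distrib]
  ring

theorem homological_zero {σ : Type} [Fintype σ] (Λ : Matrix σ σ ℝ) (w : σ → TPoly σ) :
    homological Λ 0 w = w := by
  ext1 i
  simp [homological, linPoly, dt_zero]

theorem Correctable.zero (hT : IsOpen T) (hκ : 0 ≤ κ) : Correctable A B T κ q 0 := by
  refine ⟨0, NormalForm.slowCoeffs_zero hT hκ, ?_, ?_, ?_⟩
  · rw [NormalForm.substPoly_zero]; exact fun _ => HSlow.zero hT hκ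
  · rw [NormalForm.nonlinPoly_zero]; exact fun _ => HSlow.zero hT hκ
  · rw [NormalForm.substPoly_zero, NormalForm.nonlinPoly_zero, homological_zero]
    simp

variable {A B}

/-- The homological operator is additive modulo terms that vanish on T, so it is enough to remove
residuals monomial by monomial. -/
theorem Correctable.add (hT : IsOpen T) {R R' : Fin m ⊕ Fin n → TPoly (Fin m ⊕ Fin n)}
    (h : Correctable A B T κ q R) (h' : Correctable A B T κ q R') :
    Correctable A B T κ q (R + R') := by
  obtain ⟨N, h1, h2, h3, h4⟩ := h
  obtain ⟨N', h1', h2', h3', h4'⟩ := h'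
  refine ⟨N + N', h1.add hT h1', ?_, ?_, ?_⟩
  · rw [NormalForm.substPoly_add]; exact fun i => (h2 i).add hT (h2' i)
  · rw [NormalForm.nonlinPoly_add]; exact fun i => (h3 i).add hT (h3' i)
  · intro i
    rw [NormalForm.substPoly_add, NormalForm.nonlinPoly_add]
    have h5 := homological_add_sub_mem_OT (q := q + 1) (Matrix.fromBlocks A 0 0 B)
      (w := N.nonlinPoly) (w' := N'.nonlinPoly)
      (fun i => (h2 i).differentiableAt hT) (fun i => (h2' i).differentiableAt hT) i
    convert add_mem (add_mem (h4 i) (h4' i)) h5 using 1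
    simp only [Pi.add_apply]
    ring

theorem Correctable.sum {ι : Type*} (hT : IsOpen T) (hκ : 0 ≤ κ) (I : Finset ι)
    {R : ι → Fin m ⊕ Fin n → TPoly (Fin m ⊕ Fin n)}
    (h : ∀ i ∈ I, Correctable A B T κ q (R i)) : Correctable A B T κ q (∑ i ∈ I, R i) :=
  Finset.sum_induction _ _ (fun _ _ => Correctable.add hT) (Correctable.zero A B hT hκ) h

/-- Residuals that are removed without a change of the transform. -/
theorem Correctable.of_nonlinPoly {R : Fin m ⊕ Fin n → TPoly (Fin m ⊕ Fin n)}
    (hT : IsOpen T) (hκ : 0 ≤ κ) (N : NormalForm m n) (hN : N.SlowCoeffs T κ)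
    (h0 : N.substPoly = 0) (hR : ∀ i, HSlow T κ q (R i)) (h : N.nonlinPoly = R) :
    Correctable A B T κ q (-R) := by
  refine ⟨N, hN, ?_, ?_, ?_⟩
  · rw [h0]; exact fun _ => HSlow.zero hT hκ
  · rw [h]; exact hR
  · rw [h0, homological_zero, h]; simp

theorem hSlow_single (hT : IsOpen T) (hκ : 0 ≤ κ) (i : Fin m ⊕ Fin n)
    {P : TPoly (Fin m ⊕ Fin n)} (hP : HSlow T κ q P) (l : Fin m ⊕ Fin n) :
    HSlow T κ q ((Pi.single i P : Fin m ⊕ Fin n → TPoly (Fin m ⊕ Fin n)) l) := by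
  by_cases h : l = i
  · subst h; simpa using hP
  · rw [Pi.single_eq_of_ne h]; exact HSlow.zero hT hκ

theorem IsSlow.neg {a : ℝ → ℝ} (hT : IsOpen T) (hκ : 0 ≤ κ) (ha : IsSlow T κ a) :
    IsSlow T κ (-a) := ha.clm_apply hT hκ (-ContinuousLinearMap.id ℝ ℝ)

/-- Slow variables alone, in the slow equation. -/
theorem correctable_Fc (hT : IsOpen T) (hκ : 0 ≤ κ) {a : ℝ → ℝ} (ha : IsSlow T κ a) (i : Fin m)
    (τ : Fin q → Fin m) :
    Correctable A B T κ q (Pi.single (Sum.inl i) (monomial (tupleExp τ) a)) := by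
  classical
  -- The velocity correction is minus the residual.
  obtain ⟨a', ha', rfl⟩ : ∃ a', IsSlow T κ a' ∧ a = -a' := ⟨-a, ha.neg hT hκ, (neg_neg a).symm⟩
  have h1 : -(Pi.single (Sum.inl i) (monomial (tupleExp τ) a') :
      Fin m ⊕ Fin n → TPoly (Fin m ⊕ Fin n)) =
      Pi.single (Sum.inl i) (monomial (tupleExp τ) (-a')) := by
    rw [← Pi.single_neg, map_neg]
  rw [← h1]
  let e : Fin m →₀ ℕ := ∑ b, Finsupp.single (τ b) 1
  have he : rename Sum.inl (monomial e a') =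
      (monomial (tupleExp τ) a' : TPoly (Fin m ⊕ Fin n)) := by
    rw [rename_monomial, Finsupp.mapDomain_finsetSum]
    simp only [Finsupp.mapDomain_single]
    rfl
  refine Correctable.of_nonlinPoly hT hκ ⟨0, 0, Pi.single i (monomial e a'), 0, 0⟩ ?_ ?_ ?_ ?_
  · obtain ⟨h2, h3, -, h4, h5⟩ := NormalForm.slowCoeffs_zero (m := m) (n := n) hT hκ
    refine ⟨h2, h3, fun l => ?_, h4, h5⟩
    by_cases h : l = i
    · subst h
      simpa using slowCoeffs_monomial hT hκ ha' e
    · simpa [Pi.single_eq_of_ne h] using FastSlow.slowCoeffs_zero hT hκ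
  · ext (i | j) <;> rfl
  · exact hSlow_single hT hκ _ (HSlow.monomial hT hκ ha' (degree_tupleExp τ))
  · funext l
    rcases l with l | j
    · by_cases h : l = i
      · subst h
        simp [NormalForm.nonlinPoly, he]
      · simp [NormalForm.nonlinPoly, h]
    · simp [NormalForm.nonlinPoly]

/-- At least two fast variables, in the slow equation. -/
theorem correctable_quad (hT : IsOpen T) (hκ : 0 ≤ κ) {a : ℝ → ℝ} (ha : IsSlow T κ a) (i : Fin m)
    (s : Fin m ⊕ Fin n →₀ ℕ) (j k : Fin n)
    (hs : (s + Finsupp.single (Sum.inr j) 1 + Finsupp.single (Sum.inr k) 1).degree = q) :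
    Correctable A B T κ q (Pi.single (Sum.inl i)
      (monomial (s + Finsupp.single (Sum.inr j) 1 + Finsupp.single (Sum.inr k) 1) a)) := by
  classical
  obtain ⟨a', ha', rfl⟩ : ∃ a', IsSlow T κ a' ∧ a = -a' := ⟨-a, ha.neg hT hκ, (neg_neg a).symm⟩
  have h1 : -(Pi.single (Sum.inl i)
      (monomial (s + Finsupp.single (Sum.inr j) 1 + Finsupp.single (Sum.inr k) 1) a') :
      Fin m ⊕ Fin n → TPoly (Fin m ⊕ Fin n)) = Pi.single (Sum.inl i)
      (monomial (s + Finsupp.single (Sum.inr j) 1 + Finsupp.single (Sum.inr k) 1) (-a')) := by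
    rw [← Pi.single_neg, map_neg]
  rw [← h1]
  have he : (monomial s a' * X (Sum.inr j) * X (Sum.inr k) : TPoly (Fin m ⊕ Fin n)) =
      monomial (s + Finsupp.single (Sum.inr j) 1 + Finsupp.single (Sum.inr k) 1) a' := by
    simp [X, monomial_mul]
  refine Correctable.of_nonlinPoly hT hκ ⟨0, 0, 0, fun i' j' k' =>
    if i' = i ∧ j' = j ∧ k' = k then monomial s a' else 0, 0⟩ ?_ ?_ ?_ ?_
  · obtain ⟨h2, h3, h4, -, h5⟩ := NormalForm.slowCoeffs_zero (m := m) (n := n) hT hκ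
    refine ⟨h2, h3, h4, fun i' j' k' => ?_, h5⟩
    simp only
    split_ifs
    · exact slowCoeffs_monomial hT hκ ha' s
    · exact FastSlow.slowCoeffs_zero hT hκ
  · ext (i | j) <;> rfl
  · exact hSlow_single hT hκ _ (HSlow.monomial hT hκ ha' hs)
  · funext l
    rcases l with l | j'
    · by_cases h : l = i
      · subst h
        simp [NormalForm.nonlinPoly, ite_and, he]
      · simp [NormalForm.nonlinPoly, h]
    · simp [NormalForm.nonlinPoly]

/-- At least one fast variable, in the fast equation. -/
theorem correctable_G (hT : IsOpen T) (hκ : 0 ≤ κ) {a : ℝ → ℝ} (ha : IsSlow T κ a) (j : Fin n)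
    (s : Fin m ⊕ Fin n →₀ ℕ) (k : Fin n)
    (hs : (s + Finsupp.single (Sum.inr k) 1).degree = q) :
    Correctable A B T κ q
      (Pi.single (Sum.inr j) (monomial (s + Finsupp.single (Sum.inr k) 1) a)) := by
  classical
  obtain ⟨a', ha', rfl⟩ : ∃ a', IsSlow T κ a' ∧ a = -a' := ⟨-a, ha.neg hT hκ, (neg_neg a).symm⟩
  have h1 : -(Pi.single (Sum.inr j) (monomial (s + Finsupp.single (Sum.inr k) 1) a') :
      Fin m ⊕ Fin n → TPoly (Fin m ⊕ Fin n)) = Pi.single (Sum.inr j)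
      (monomial (s + Finsupp.single (Sum.inr k) 1) (-a')) := by
    rw [← Pi.single_neg, map_neg]
  rw [← h1]
  have he : (monomial s a' * X (Sum.inr k) : TPoly (Fin m ⊕ Fin n)) =
      monomial (s + Finsupp.single (Sum.inr k) 1) a' := by
    simp [X, monomial_mul]
  refine Correctable.of_nonlinPoly hT hκ ⟨0, 0, 0, 0, fun j' k' =>
    if j' = j ∧ k' = k then monomial s a' else 0⟩ ?_ ?_ ?_ ?_
  · obtain ⟨h2, h3, h4, h5, -⟩ := NormalForm.slowCoeffs_zero (m := m) (n := n) hT hκ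
    refine ⟨h2, h3, h4, h5, fun j' k' => ?_⟩
    simp only
    split_ifs
    · exact slowCoeffs_monomial hT hκ ha' s
    · exact FastSlow.slowCoeffs_zero hT hκ
  · ext (i | j) <;> rfl
  · exact hSlow_single hT hκ _ (HSlow.monomial hT hκ ha' hs)
  · funext l
    rcases l with l | j'
    · simp [NormalForm.nonlinPoly]
    · by_cases h : j' = j
      · subst h
        simp [NormalForm.nonlinPoly, ite_and, he]
      · simp [NormalForm.nonlinPoly, h]

variable {a b : ℝ}

/-- Slow variables alone, in the fast equation: the transform of the fast variables changes. -/
theorem correctable_eta (hT : IsOpen T) (hTc : T.OrdConnected) (hκ : 0 ≤ κ) (ha : 0 < a)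
    (hq : 0 < q) (hab : q * a + κ < b) (hA : MatBound A a) {B' : Matrix (Fin n) (Fin n) ℝ}
    (hB : B * B' = 1) (hB' : B' * B = 1) (hBb : MatBound B' b⁻¹)
    {r : ℝ → ℝ} (hr : IsSlow T κ r) (j : Fin n) (τ : Fin q → Fin m) :
    Correctable A B T κ q (Pi.single (Sum.inr j) (monomial (tupleExp τ) r)) := by
  classical
  -- The tuple indexes the slow monomial, on each entry of which the transpose of A acts; the last
  -- index is the component of the fast equation, where −B comes from −Λh. Only the entry (τ, j) is
  -- forced.
  obtain ⟨c, hc, hce⟩ := exists_isSlow_tensor_solution hT hTc hκ ha hq hab (fun _ => A.transpose)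
    (fun _ => hA.transpose) (N := -B) (N' := -B') (by simp [hB]) (by simp [hB']) hBb.neg
    (fun x => if x = (τ, j) then -r else 0) (fun x => by
      split_ifs
      · exact hr.neg hT hκ
      · exact IsSlow.zero hT hκ)
  let E : (Fin q → Fin m) → Fin m ⊕ Fin n →₀ ℕ := tupleExp
  let N : NormalForm m n := ⟨0, fun j => comb E fun τ => c (τ, j), 0, 0, 0⟩
  have hcomb : ∀ j, HSlow T κ q (comb E fun τ => c (τ, j)) := fun j =>
    hSlow_comb hT hκ degree_tupleExp fun τ => hc (τ, j)
  have hw : N.nonlinPoly = 0 := by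
    funext i
    rcases i with i | j <;> simp [NormalForm.nonlinPoly, N]
  refine ⟨N, ?_, ?_, ?_, ?_⟩
  · obtain ⟨h2, -, h3, h4, h5⟩ := NormalForm.slowCoeffs_zero (m := m) (n := n) hT hκ
    exact ⟨h2, fun j => (hcomb j).2, h3, h4, h5⟩
  · rintro (i | j)
    · exact HSlow.zero hT hκ
    · exact hcomb j
  · rw [hw]; exact fun _ => HSlow.zero hT hκ
  · rintro (i | j')
    · have : N.substPoly (Sum.inl i) = 0 := rfl
      have h2 : ∀ l, N.substPoly (Sum.inl l) = 0 := fun _ => rfl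
      rw [homological, this, hw, linPoly_fromBlocks_inl]
      simp [h2, dt_zero]
    · have h2 : ∀ l, N.substPoly (Sum.inr l) = comb E fun τ => c (τ, l) := fun _ => rfl
      have h3 : (Pi.single (Sum.inr j) (monomial (tupleExp τ) r) :
          Fin m ⊕ Fin n → TPoly (Fin m ⊕ Fin n)) (Sum.inr j') =
          comb E (fun y => if (y, j') = (τ, j) then r else 0) := by
        by_cases h : j' = j
        · subst h
          simpa using (comb_single E τ r).symm
        · simp [h, comb]
      rw [homological, ← linDer_apply, hw, linPoly_fromBlocks_inr, h3]
      simp only [h2]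
      rw [sum_C_mul_comb]
      have h4 : linDer (Matrix.fromBlocks A 0 0 B) (comb E fun τ => c (τ, j')) = comb E _ :=
        linDer_tensor A B fun τ => c (τ, j')
      rw [h4]
      have h5 := dt_comb_sub_mem_OT (q := q + 1) hT E fun τ => hc (τ, j')
      -- The coefficients of the new residual, tuple by tuple, vanish by the tensor equation, at
      -- times in T.
      have h6 : ∀ τ', ∀ t ∈ T, (((fun y => if (y, j') = (τ, j) then r else 0) +
          (fun τ => deriv (c (τ, j'))) + (fun τ t => ∑ a, ∑ l, A l (τ a) *
            c (Function.update τ a l, j') t) - (fun τ t => ∑ l, B j' l * c (τ, l) t)) :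
            (Fin q → Fin m) → ℝ → ℝ) τ' t = 0 := by
        intro τ' t ht
        have h7 := hce t ht τ' j'
        simp only [Matrix.transpose_apply, Matrix.neg_apply, neg_mul, Finset.sum_neg_distrib] at h7
        simp only [Pi.add_apply, Pi.sub_apply]
        split_ifs at h7 ⊢ <;> simp only [Pi.neg_apply, Pi.zero_apply] at h7 ⊢ <;> linarith
      convert add_mem h5 (comb_mem_OT E h6) using 1
      rw [comb_sub, comb_add, comb_add]
      simp only [Pi.zero_apply]
      ring

/-- One fast variable, in the slow equation: the transform of the slow variables changes. -/
theorem correctable_xi (hT : IsOpen T) (hTc : T.OrdConnected) (hκ : 0 ≤ κ) (ha : 0 < a)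
    (hab : (q + 1 : ℕ) * a + κ < b) (hA : MatBound A a) {B' : Matrix (Fin n) (Fin n) ℝ}
    (hB : B * B' = 1) (hB' : B' * B = 1) (hBb : MatBound B' b⁻¹)
    {r : ℝ → ℝ} (hr : IsSlow T κ r) (i : Fin m) (τ : Fin q → Fin m) (j : Fin n) :
    Correctable A B T κ (q + 1) (Pi.single (Sum.inl i)
      (monomial (tupleExp τ + Finsupp.single (Sum.inr j) 1) r)) := by
  classical
  -- Slot 0 holds the component of the slow equation, where −A comes from −Λh; the q other slots
  -- list the slow factors, and the last index is the single fast factor. The q + 1 slots account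
  -- for the factor q + 1 in `hab`.
  obtain ⟨c, hc, hce⟩ := exists_isSlow_tensor_solution hT hTc hκ ha q.succ_pos hab
    (Fin.cons (-A) fun _ => A.transpose : Fin (q + 1) → Matrix (Fin m) (Fin m) ℝ)
    (Fin.cases hA.neg fun _ => hA.transpose) (N := B.transpose) (N' := B'.transpose)
    (by rw [← Matrix.transpose_mul, hB', Matrix.transpose_one])
    (by rw [← Matrix.transpose_mul, hB, Matrix.transpose_one]) hBb.transpose
    (fun x => if x = (Fin.cons i τ, j) then -r else 0) (fun x => by
      split_ifs
      · exact hr.neg hT hκ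
      · exact IsSlow.zero hT hκ)
  let E : (Fin q → Fin m) × Fin n → Fin m ⊕ Fin n →₀ ℕ := fun x =>
    tupleExp x.1 + Finsupp.single (Sum.inr x.2) 1
  let c' : Fin m → (Fin q → Fin m) × Fin n → ℝ → ℝ := fun i x => c (Fin.cons i x.1, x.2)
  let N : NormalForm m n := ⟨fun i => comb E (c' i), 0, 0, 0, 0⟩
  have hE : ∀ x, (E x).degree = q + 1 := fun x => by
    simp only [E, map_add, degree_tupleExp, Finsupp.degree_single]
  have hcomb : ∀ i, HSlow T κ (q + 1) (comb E (c' i)) := fun i =>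
    hSlow_comb hT hκ hE fun x => hc _
  have hw : N.nonlinPoly = 0 := by
    funext i
    rcases i with i | j <;> simp [NormalForm.nonlinPoly, N]
  refine ⟨N, ?_, ?_, ?_, ?_⟩
  · obtain ⟨-, h2, h3, h4, h5⟩ := NormalForm.slowCoeffs_zero (m := m) (n := n) hT hκ
    exact ⟨fun i => (hcomb i).2, h2, h3, h4, h5⟩
  · rintro (i | j)
    · exact hcomb i
    · exact HSlow.zero hT hκ
  · rw [hw]; exact fun _ => HSlow.zero hT hκ
  · rintro (i' | j')
    · have h2 : ∀ l, N.substPoly (Sum.inl l) = comb E (c' l) := fun _ => rfl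
      have h3 : (Pi.single (Sum.inl i) (monomial (tupleExp τ + Finsupp.single (Sum.inr j) 1) r) :
          Fin m ⊕ Fin n → TPoly (Fin m ⊕ Fin n)) (Sum.inl i') =
          comb E (fun y => if y = (τ, j) then (if i' = i then r else 0) else 0) := by
        rw [comb_single]
        by_cases h : i' = i
        · subst h
          simp [E]
        · simp [h]
      rw [homological, ← linDer_apply, hw, linPoly_fromBlocks_inl, h3]
      simp only [h2]
      rw [sum_C_mul_comb]
      have h4 : linDer (Matrix.fromBlocks A 0 0 B) (comb E (c' i')) = comb E
          ((fun x t => ∑ a, ∑ l, A l (x.1 a) * c' i' (Function.update x.1 a l, x.2) t) +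
          fun x t => ∑ l, B l x.2 * c' i' (x.1, l) t) := by
        -- With the fast variable factored out, `linDer_tensor` applies to the slow cofactors, and
        -- Leibniz's rule supplies the transpose of B.
        have hsplit : ∀ d : (Fin q → Fin m) × Fin n → ℝ → ℝ, comb E d = ∑ j,
            (∑ τ, monomial (tupleExp τ) (d (τ, j))) * (X (Sum.inr j)) := by
          intro d
          rw [comb, Fintype.sum_prod_type_right]
          simp only [Finset.sum_mul, E, X, monomial_mul, mul_one]
        rw [comb_add, hsplit (c' i'), map_sum]
        simp only [Derivation.leibniz, linDer_X, linPoly_fromBlocks_inr, smul_eq_mul, linDer_tensor]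
        rw [Finset.sum_add_distrib, add_comm]
        congr 1
        · rw [hsplit]
          refine Finset.sum_congr rfl fun j _ => ?_
          rw [mul_comm]
        · rw [hsplit]
          simp only [Finset.mul_sum]
          rw [Finset.sum_comm]
          refine Finset.sum_congr rfl fun l _ => ?_
          simp only [Finset.sum_mul]
          rw [Finset.sum_comm]
          refine Finset.sum_congr rfl fun τ' _ => ?_
          have h8 : (fun t => ∑ l', B l' l * c' i' (τ', l') t) =
              ∑ l', (Function.const ℝ (B l' l)) * c' i' (τ', l') := by
            ext t; simp [Finset.sum_apply]
          rw [h8, map_sum, Finset.sum_mul]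
          refine Finset.sum_congr rfl fun l' _ => ?_
          rw [← C_mul_monomial]
          ring
      rw [h4]
      have h5 := dt_comb_sub_mem_OT (q := q + 1 + 1) hT E (c := c' i') fun x => hc _
      have h6 : ∀ x, ∀ t ∈ T, (((fun y => if y = (τ, j) then (if i' = i then r else 0) else 0) +
          (fun x => deriv (c' i' x)) +
          ((fun x t => ∑ a, ∑ l, A l (x.1 a) * c' i' (Function.update x.1 a l, x.2) t) +
          fun x t => ∑ l, B l x.2 * c' i' (x.1, l) t) -
          (fun x t => ∑ l, A i' l * c' l x t)) :
            (Fin q → Fin m) × Fin n → ℝ → ℝ) x t = 0 := by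
        rintro ⟨τ', j'⟩ t ht
        have h7 := hce t ht (Fin.cons i' τ') j'
        simp only [Fin.sum_univ_succ, Fin.cons_zero, Fin.cons_succ, Fin.update_cons_zero,
          ← Fin.cons_update, Matrix.transpose_apply, Matrix.neg_apply, neg_mul,
          Finset.sum_neg_distrib] at h7
        simp only [Pi.add_apply, Pi.sub_apply, c']
        have h9 : (if (τ', j') = (τ, j) then (if i' = i then r else 0) else 0) =
            -(if ((Fin.cons i' τ' : Fin (q + 1) → Fin m), j') = (Fin.cons i τ, j)
              then -r else 0) := by
          by_cases h : i' = i
          · by_cases h' : τ' = τ <;> by_cases h'' : j' = j <;> simp [h, h', h'']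
          · simp [h]
        rw [h9, Pi.neg_apply, ← h7]
        ring
      convert add_mem h5 (comb_mem_OT E h6) using 1
      simp only [comb_sub, comb_add, Pi.zero_apply]
      ring
    · have h2 : ∀ l, N.substPoly (Sum.inr l) = 0 := fun _ => rfl
      rw [homological, hw, linPoly_fromBlocks_inr]
      simp [h2, dt_zero]

/-- Every monomial residual can be removed. -/
theorem correctable_monomial (hT : IsOpen T) (hTc : T.OrdConnected) (hκ : 0 ≤ κ) (ha : 0 < a)
    (hq : 0 < q) (hab : q * a + κ < b) (hA : MatBound A a) {B' : Matrix (Fin n) (Fin n) ℝ}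
    (hB : B * B' = 1) (hB' : B' * B = 1) (hBb : MatBound B' b⁻¹)
    {r : ℝ → ℝ} (hr : IsSlow T κ r) (i : Fin m ⊕ Fin n) (s : Fin m ⊕ Fin n →₀ ℕ)
    (hs : s.degree = q) : Correctable A B T κ q (Pi.single i (monomial s r)) := by
  rcases i with i | j
  · rcases exponent_cases q s hs with ⟨τ, rfl⟩ | ⟨s', k, rfl⟩
    · exact correctable_Fc hT hκ hr i τ
    · obtain ⟨q, rfl⟩ : ∃ p, q = p + 1 := ⟨q - 1, by omega⟩
      have hs' : s'.degree = q := by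
        rw [map_add, Finsupp.degree_single] at hs
        omega
      rcases exponent_cases q s' hs' with ⟨τ, rfl⟩ | ⟨s'', j, rfl⟩
      · exact correctable_xi hT hTc hκ ha hab hA hB hB' hBb hr i τ k
      · exact correctable_quad hT hκ hr i s'' j k hs
  · rcases exponent_cases q s hs with ⟨τ, rfl⟩ | ⟨s', k, rfl⟩
    · exact correctable_eta hT hTc hκ ha hq hab hA hB hB' hBb hr j τ
    · exact correctable_G hT hκ hr j s' k hs

/-- Every residual of order `q` can be removed to leading order. -/
theorem correctable_of_mem_OT (hT : IsOpen T) (hTc : T.OrdConnected) (hκ : 0 ≤ κ) (ha : 0 < a)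
    (hq : 0 < q) (hab : q * a + κ < b) (hA : MatBound A a) {B' : Matrix (Fin n) (Fin n) ℝ}
    (hB : B * B' = 1) (hB' : B' * B = 1) (hBb : MatBound B' b⁻¹)
    {R : Fin m ⊕ Fin n → TPoly (Fin m ⊕ Fin n)} (hR : ∀ i, R i ∈ OT T q)
    (hRs : ∀ i s, s.degree = q → IsSlow T κ (coeff s (R i))) : Correctable A B T κ q R := by
  classical
  have h1 : Correctable A B T κ q (∑ i, ∑ s ∈ (R i).support with s.degree = q,
      Pi.single i (monomial s (coeff s (R i)))) :=
    Correctable.sum hT hκ _ fun i _ => Correctable.sum hT hκ _ fun s hs =>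
      correctable_monomial hT hTc hκ ha hq hab hA hB hB' hBb
        (hRs i s (Finset.mem_filter.1 hs).2) i s (Finset.mem_filter.1 hs).2
  obtain ⟨N, h2, h3, h4, h5⟩ := h1
  refine ⟨N, h2, h3, h4, fun i => ?_⟩
  -- Lower coefficients of R vanish on T, so modulo order q + 1 only the part of degree q matters.
  have h6 : R i - (∑ i, ∑ s ∈ (R i).support with s.degree = q,
      Pi.single i (monomial s (coeff s (R i))) :
      Fin m ⊕ Fin n → TPoly (Fin m ⊕ Fin n)) i ∈ OT T (q + 1) := by
    have h7 : (∑ i, ∑ s ∈ (R i).support with s.degree = q,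
        Pi.single i (monomial s (coeff s (R i))) :
        Fin m ⊕ Fin n → TPoly (Fin m ⊕ Fin n)) i =
        ∑ s ∈ (R i).support with s.degree = q, monomial s (coeff s (R i)) := by
      rw [Finset.sum_apply, Finset.sum_eq_single i]
      · simp [Finset.sum_apply]
      · intro l _ hl
        rw [Finset.sum_apply]
        exact Finset.sum_eq_zero fun s _ => Pi.single_eq_of_ne (Ne.symm hl) _
      · simp
    rw [h7]
    intro s hs t ht
    rw [coeff_sub, coeff_sum]
    simp only [coeff_monomial, Finset.sum_ite_eq', Finset.mem_filter, mem_support_iff]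
    rcases Nat.lt_succ_iff_lt_or_eq.1 hs with h | h
    · simp [h.ne, hR i s h t ht]
    · by_cases h0 : coeff s (R i) = 0
      · simp [h0]
      · simp [h, h0]
  convert add_mem h6 (h5 i) using 1
  ring

end Correction

end FastSlow

namespace FastSlow

/-! ### Induction on the order of the residual -/

section Induction

open MvPolynomial

variable {m n : ℕ} {T : Set ℝ} {ν μ α β : ℝ}

theorem dt_X {σ : Type} (i : σ) : dt (X i : TPoly σ) = 0 := by
  classical
  ext1 s
  rw [coeff_dt, coeff_X]
  split_ifs
  · exact funext fun t => deriv_const t (1 : ℝ)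
  · exact funext fun t => deriv_const t (0 : ℝ)

/-- The identity transform, with linear dynamics. -/
noncomputable def idForm (m n : ℕ) : NormalForm m n :=
  ⟨fun i => X (Sum.inl i), fun j => X (Sum.inr j), 0, 0, 0⟩

theorem substPoly_idForm : (idForm m n).substPoly = X := by
  ext1 (i | j) <;> rfl

theorem nonlinPoly_idForm : (idForm m n).nonlinPoly = 0 := by
  funext i
  rcases i with i | j <;> simp [NormalForm.nonlinPoly, idForm]

theorem slowCoeffs_idForm {κ : ℝ} (hT : IsOpen T) (hκ : 0 ≤ κ) :
    (idForm m n).SlowCoeffs T κ := by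
  obtain ⟨-, -, h3, h4, h5⟩ := NormalForm.slowCoeffs_zero (m := m) (n := n) hT hκ
  have h1 : IsSlow T κ (1 : ℝ → ℝ) := IsSlow.const hT hκ 1
  exact ⟨fun i => slowCoeffs_monomial hT hκ h1 _, fun i => slowCoeffs_monomial hT hκ h1 _,
    h3, h4, h5⟩

variable (A : Matrix (Fin m) (Fin m) ℝ) (B : Matrix (Fin n) (Fin n) ℝ)

/-- Every velocity of the normal form system, as a multinomial. -/
noncomputable def NormalForm.fieldPoly (N : NormalForm m n) :
    Fin m ⊕ Fin n → TPoly (Fin m ⊕ Fin n) :=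
  linPoly (Matrix.fromBlocks A 0 0 B) X + N.nonlinPoly

variable {A B}

/-- Normal forms that are accurate to order `p`. -/
theorem exists_normalForm (hT : IsOpen T) (hTc : T.OrdConnected) (hν : 0 ≤ ν) (hμ : 0 ≤ μ)
    (hα : 0 ≤ α) (hA : ∀ l ∈ spectrum ℂ (A.map ((↑) : ℝ → ℂ)), ‖l‖ ≤ α)
    (hB : ∀ l ∈ spectrum ℂ (B.map ((↑) : ℝ → ℂ)), β ≤ ‖l‖)
    {φ : Fin m ⊕ Fin n → TPoly (Fin m ⊕ Fin n)} (hφ : ∀ i, φ i ∈ OT T 2)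
    (hφ' : ∀ i s, IsSlow T ν (coeff s (φ i))) {p : ℕ} (hp : 2 ≤ p)
    (hpμ : ((p : ℝ) - 2) * ν ≤ μ) (hgap : μ + ((p : ℝ) - 1) * α < β) :
    ∃ N : NormalForm m n, N.SlowCoeffs T μ ∧ (∀ i, GSlow T ν 1 (N.substPoly i)) ∧
      (∀ i, GSlow T ν 1 (N.nonlinPoly i)) ∧ (∀ i, N.substPoly i - X i ∈ OT T 2) ∧
      (∀ i, N.nonlinPoly i ∈ OT T 2) ∧
      ∀ i, residual (Matrix.fromBlocks A 0 0 B) φ N.substPoly (N.fieldPoly A B) i ∈ OT T p := by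
  suffices H : ∀ q, 2 ≤ q → q ≤ p → ∃ N : NormalForm m n, N.SlowCoeffs T μ ∧
      (∀ i, GSlow T ν 1 (N.substPoly i)) ∧
      (∀ i, GSlow T ν 1 (N.nonlinPoly i)) ∧ (∀ i, N.substPoly i - X i ∈ OT T 2) ∧
      (∀ i, N.nonlinPoly i ∈ OT T 2) ∧
      ∀ i, residual (Matrix.fromBlocks A 0 0 B) φ N.substPoly (N.fieldPoly A B) i ∈ OT T q from
    H p hp le_rfl
  intro q hq
  induction q, hq using Nat.le_induction with
  | base =>
    intro _
    -- The identity with linear dynamics leaves the residual −φ, which is O(2).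
    refine ⟨idForm m n, slowCoeffs_idForm hT hμ, ?_, ?_, ?_, ?_, ?_⟩
    · rw [substPoly_idForm]; exact fun i => GSlow.X hT hν i
    · rw [nonlinPoly_idForm]; exact fun i => GSlow.of_eq_zero hT hν (by simp)
    · rw [substPoly_idForm]; simp
    · rw [nonlinPoly_idForm]; simp
    · intro i
      have h1 := linDer_X (Matrix.fromBlocks A 0 0 B) i
      rw [linDer_apply] at h1
      rw [residual, NormalForm.fieldPoly, substPoly_idForm, nonlinPoly_idForm, add_zero, dt_X, h1,
        zero_add, sub_self, zero_sub]
      exact neg_mem (bind_mem_OT X_mem_OT (hφ i))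
  | succ q hq ih =>
    intro hqp
    obtain ⟨N, h1, h2, h3, h4, h5, h6⟩ := ih (by omega)
    have hqp' : (q : ℝ) ≤ p - 1 := by
      have : ((q + 1 : ℕ) : ℝ) ≤ p := by exact_mod_cast hqp
      push_cast at this
      linarith
    have hq0 : (0 : ℝ) < q := by
      have : 0 < q := by omega
      exact_mod_cast this
    have hcast : ((q - 1 : ℕ) : ℝ) = q - 1 := by
      rw [Nat.cast_sub (by omega), Nat.cast_one]
    -- This is the rate of the residual coefficients of degree q. As q ≤ p − 1, it is at most (p −
    -- 2)ν ≤ μ.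
    set κ : ℝ := (q - 1 : ℕ) * ν with hκdef
    have hκ : 0 ≤ κ := by positivity
    have hκμ : κ ≤ μ := by
      refine le_trans ?_ hpμ
      rw [hκdef, hcast]
      exact mul_le_mul_of_nonneg_right (by linarith) hν
    have hgap' : q * α + κ < β := by
      have : (q : ℝ) * α ≤ (p - 1) * α := mul_le_mul_of_nonneg_right hqp' hα
      linarith
    -- The bounds on matrix powers need b < β and a > α strictly. The choice of a makes q a + κ the
    -- midpoint of q α + κ and b.
    obtain ⟨b, hb1, hb2⟩ := exists_between hgap'
    have hab : q * ((b - κ - q * α) / (2 * q) + α) + κ < b := by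
      field_simp
      linarith
    have haα : α < (b - κ - q * α) / (2 * q) + α := by
      have : 0 < (b - κ - q * α) / (2 * q) := by
        apply div_pos <;> linarith
      linarith
    obtain ⟨B', hB1, hB2, hB3⟩ := exists_inverse_matBound (b := b)
      (by nlinarith [mul_nonneg hq0.le hα]) hb2 hB
    have hV : ∀ i, GSlow T ν 1 (N.fieldPoly A B i) := fun i =>
      (GSlow.linPoly hT hν _ (fun l => GSlow.X hT hν l) i).add hT (h3 i)
    have hres := GSlow.residual hT hν (Matrix.fromBlocks A 0 0 B) h2 hV hφ hφ'
    obtain ⟨δ, d1, d2, d3, d4⟩ := correctable_of_mem_OT hT hTc hκ (hα.trans_lt haα) (by omega) hab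
      (matBound_of_spectrum hα haα hA) hB1 hB2 hB3 h6 (fun i s hs => by
        have := (hres i).2 s
        rwa [hs] at this)
    refine ⟨N + δ, h1.add hT (d1.mono hκ hκμ), ?_, ?_, ?_, ?_, ?_⟩
    · rw [NormalForm.substPoly_add]
      exact fun i => (h2 i).add hT ((d2 i).gSlow hT hν (by omega))
    · rw [NormalForm.nonlinPoly_add]
      exact fun i => (h3 i).add hT ((d3 i).gSlow hT hν (by omega))
    · intro i
      rw [NormalForm.substPoly_add, Pi.add_apply, add_sub_right_comm]
      exact add_mem (h4 i) (OT_mono hq (d2 i).mem_OT)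
    · intro i
      rw [NormalForm.nonlinPoly_add]
      exact add_mem (h5 i) (OT_mono hq (d3 i).mem_OT)
    · intro i
      have h7 := residual_add_sub_mem_OT hq (Matrix.fromBlocks A 0 0 B)
        (fun i => (h2 i).differentiableAt hT) (fun i => (d2 i).differentiableAt hT) h4
        (V := N.fieldPoly A B) (fun i => by
          simpa [NormalForm.fieldPoly] using h5 i) hφ (fun i => (d2 i).mem_OT)
        (fun i => (d3 i).mem_OT) i
      have h8 : (N + δ).fieldPoly A B = N.fieldPoly A B + δ.nonlinPoly := by
        rw [NormalForm.fieldPoly, NormalForm.nonlinPoly_add, NormalForm.fieldPoly, add_assoc]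
      rw [NormalForm.substPoly_add, h8]
      simpa using add_mem h7 (d4 i)

end Induction

end FastSlow

namespace FastSlow

/-! ### Taylor's theorem along rays -/

section Taylor

variable {E F : Type*} [NormedAddCommGroup E] [NormedSpace ℝ E] [NormedAddCommGroup F]
  [NormedSpace ℝ F]

theorem iteratedDeriv_comp_ray {f : E → F} {r : ℝ} {p k : ℕ} (hk : k ≤ p)
    (hf : ContDiffOn ℝ p f (Metric.ball 0 r)) {u : E} {s : ℝ} (hs : s • u ∈ Metric.ball 0 r) :
    iteratedDeriv k (fun s : ℝ => f (s • u)) s = iteratedFDeriv ℝ k f (s • u) fun _ => u := by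
  let L : ℝ →L[ℝ] E := ContinuousLinearMap.toSpanSingleton ℝ u
  have hL : ∀ s, L s = s • u := fun s => ContinuousLinearMap.toSpanSingleton_apply ..
  have hopen : IsOpen (L ⁻¹' Metric.ball 0 r) := Metric.isOpen_ball.preimage L.continuous
  have hsL : L s ∈ Metric.ball 0 r := by rwa [hL]
  have h1 := L.iteratedFDerivWithin_comp_right hf Metric.isOpen_ball.uniqueDiffOn
    hopen.uniqueDiffOn hsL (i := k) (by exact_mod_cast hk)
  rw [iteratedFDerivWithin_of_isOpen k hopen hsL,
    iteratedFDerivWithin_of_isOpen k Metric.isOpen_ball hsL] at h1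
  have h2 : (fun s : ℝ => f (s • u)) = f ∘ L := by ext s; simp [hL]
  rw [iteratedDeriv_eq_iteratedFDeriv, h2, h1, hL]
  simp [hL]

/-- Taylor's theorem along rays. -/
theorem norm_sub_taylor_le {f : E → F} {r M : ℝ} {p : ℕ} (hp : 1 ≤ p)
    (hf : ContDiffOn ℝ p f (Metric.ball 0 r))
    (hM : ∀ v ∈ Metric.ball 0 r, ‖iteratedFDeriv ℝ p f v‖ ≤ M) {u : E}
    (hu : u ∈ Metric.ball 0 r) :
    ‖f u - ∑ k ∈ Finset.range p, ((k.factorial : ℝ)⁻¹) • iteratedFDeriv ℝ k f 0 fun _ => u‖ ≤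
      M * ‖u‖ ^ p := by
  obtain ⟨p, rfl⟩ : ∃ k, p = k + 1 := ⟨p - 1, by omega⟩
  have hseg : ∀ s ∈ Set.Icc (0 : ℝ) 1, s • u ∈ Metric.ball 0 r := by
    intro s hs
    rw [mem_ball_zero_iff] at hu ⊢
    rw [norm_smul, Real.norm_of_nonneg hs.1]
    exact (mul_le_of_le_one_left (norm_nonneg _) hs.2).trans_lt hu
  have hcd : ∀ s ∈ Set.Icc (0 : ℝ) 1, ContDiffAt ℝ (p + 1 : ℕ) (fun s : ℝ => f (s • u)) s := by
    intro s hs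
    have h1 : ContDiffAt ℝ (p + 1 : ℕ) f (s • u) :=
      hf.contDiffAt (Metric.isOpen_ball.mem_nhds (hseg s hs))
    exact h1.comp s (contDiff_id.smul contDiff_const).contDiffAt
  have hder : ∀ k ≤ p + 1, ∀ s ∈ Set.Icc (0 : ℝ) 1,
      iteratedDerivWithin k (fun s : ℝ => f (s • u)) (Set.Icc 0 1) s =
        iteratedFDeriv ℝ k f (s • u) fun _ => u := by
    intro k hk s hs
    rw [iteratedDerivWithin_eq_iteratedDeriv (uniqueDiffOn_Icc zero_lt_one)
      ((hcd s hs).of_le (by exact_mod_cast hk)) hs]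
    exact iteratedDeriv_comp_ray hk hf (hseg s hs)
  have hM0 : 0 ≤ M := (norm_nonneg _).trans (hM u hu)
  have h := taylor_mean_remainder_bound (f := fun s : ℝ => f (s • u)) (a := 0) (b := 1)
    (C := M * ‖u‖ ^ (p + 1)) (x := 1) (n := p) zero_le_one
    (fun s hs => by exact_mod_cast (hcd s hs).contDiffWithinAt) (by simp) (by
      intro s hs
      rw [hder (p + 1) le_rfl s hs]
      refine (ContinuousMultilinearMap.le_opNorm _ _).trans ?_
      rw [Finset.prod_const, Finset.card_univ, Fintype.card_fin]
      gcongr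
      exact hM _ (hseg s hs))
  rw [taylor_within_apply] at h
  simp only [one_smul, sub_zero, one_pow, mul_one] at h
  have h3 : ∑ k ∈ Finset.range (p + 1), ((k.factorial : ℝ)⁻¹) •
      iteratedDerivWithin k (fun s : ℝ => f (s • u)) (Set.Icc 0 1) 0 =
      ∑ k ∈ Finset.range (p + 1), ((k.factorial : ℝ)⁻¹) • iteratedFDeriv ℝ k f 0 fun _ => u := by
    refine Finset.sum_congr rfl fun k hk => ?_
    rw [hder k (Finset.mem_range.1 hk).le 0 (by simp), zero_smul]
  rw [h3] at h
  -- The factorial in the remainder is discarded.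
  refine h.trans (div_le_self (by positivity) ?_)
  exact_mod_cast Nat.one_le_iff_ne_zero.2 (Nat.factorial_ne_zero p)

end Taylor

/-! ### Evaluation of multinomials, coordinates of states -/

section Val

open MvPolynomial

variable {σ : Type} (t : ℝ) (v : σ → ℝ)

theorem val_add (P Q : TPoly σ) : (P + Q).val t v = P.val t v + Q.val t v := eval₂_add ..

theorem val_sub (P Q : TPoly σ) : (P - Q).val t v = P.val t v - Q.val t v :=
  map_sub (eval₂Hom (Pi.evalRingHom (fun _ : ℝ => ℝ) t) v) P Q

theorem val_mul (P Q : TPoly σ) : (P * Q).val t v = P.val t v * Q.val t v := eval₂_mul ..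

theorem val_sum {ι : Type*} (I : Finset ι) (P : ι → TPoly σ) :
    TPoly.val (∑ i ∈ I, P i) t v = ∑ i ∈ I, (P i).val t v :=
  map_sum (eval₂Hom (Pi.evalRingHom (fun _ : ℝ => ℝ) t) v) P I

theorem val_X (i : σ) : TPoly.val (X i) t v = v i := eval₂_X ..

theorem val_C (a : ℝ → ℝ) : TPoly.val (C a : TPoly σ) t v = a t := eval₂_C ..

theorem val_monomial_sum {k : ℕ} (τ : Fin k → σ) (a : ℝ → ℝ) :
    TPoly.val (monomial (∑ b, Finsupp.single (τ b) 1) a : TPoly σ) t v = a t * ∏ b, v (τ b) := by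
  have h : (monomial (∑ b, Finsupp.single (τ b) 1) a : TPoly σ) = C a * ∏ b, X (τ b) := by
    have : (∏ b, X (τ b) : TPoly σ) = monomial (∑ b, Finsupp.single (τ b) 1) 1 := by
      rw [monomial_sum_one]
      rfl
    rw [this, C_mul_monomial, mul_one]
  rw [h, val_mul, val_C]
  congr 1
  exact (map_prod (eval₂Hom (Pi.evalRingHom (fun _ : ℝ => ℝ) t) v) _ _).trans
    (Finset.prod_congr rfl fun b _ => val_X t v _)

theorem val_bind {τ : Type} (Ξ : σ → TPoly τ) (P : TPoly σ) (w : τ → ℝ) :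
    TPoly.val (bind₁ Ξ P) t w = P.val t fun i => (Ξ i).val t w := by
  rw [TPoly.val, TPoly.val, ← coe_eval₂Hom, ← coe_eval₂Hom, eval₂Hom_bind₁]
  rfl

theorem val_rename {τ : Type} (e : σ → τ) (P : TPoly σ) (w : τ → ℝ) :
    TPoly.val (rename e P) t w = P.val t (w ∘ e) := eval₂_rename ..

theorem val_eq_sum [Fintype σ] (P : TPoly σ) :
    P.val t v = ∑ s ∈ P.support, coeff s P t * ∏ i, v i ^ s i := eval₂_eq' ..

end Val

section Coordinates

variable {m n : ℕ}

theorem abs_coords_le (u : State m n) (i : Fin m ⊕ Fin n) : |coords u i| ≤ ‖u‖ := by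
  rcases i with i | j
  · exact (PiLp.norm_apply_le u.1 i).trans (norm_fst_le u)
  · exact (PiLp.norm_apply_le u.2 j).trans (norm_snd_le u)

/-- The unit states. -/
noncomputable def unitState : Fin m ⊕ Fin n → State m n :=
  Sum.elim (fun i => (EuclideanSpace.single i 1, 0)) (fun j => (0, EuclideanSpace.single j 1))

theorem sum_coords_smul (u : State m n) : ∑ i, coords u i • unitState i = u := by
  rw [Fintype.sum_sum_type]
  ext i
  · simp [unitState, coords, Prod.fst_sum, Pi.single_apply]
  · simp [unitState, coords, Prod.snd_sum, Pi.single_apply]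

end Coordinates

/-! ### Taylor multinomials with slow coefficients -/

section TaylorPoly

open MvPolynomial

variable {m n p : ℕ} {V : Type*} [NormedAddCommGroup V] [NormedSpace ℝ V] {T : Set ℝ} {ν : ℝ}

/-- The terms of degrees `2, …, p - 1` of the expansion of `ℓ (f t u)` at `u = 0`. -/
noncomputable def taylorPoly (f : ℝ → State m n → V) (ℓ : V →L[ℝ] ℝ) (p : ℕ) :
    TPoly (Fin m ⊕ Fin n) :=
  ∑ k ∈ Finset.Ico 2 p, ∑ τ : Fin k → Fin m ⊕ Fin n,
    monomial (∑ b, Finsupp.single (τ b) 1) fun t =>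
      (k.factorial : ℝ)⁻¹ * ℓ (iteratedFDeriv ℝ k (f t) 0 fun b => unitState (τ b))

/-- Expanding u in unit states inside the multilinear derivative produces a sum over all index
tuples, so repeated monomials occur with the right multiplicity. -/
theorem val_taylorPoly (f : ℝ → State m n → V) (ℓ : V →L[ℝ] ℝ) (p : ℕ) (t : ℝ) (u : State m n) :
    (taylorPoly f ℓ p).val t (coords u) = ∑ k ∈ Finset.Ico 2 p,
      (k.factorial : ℝ)⁻¹ * ℓ (iteratedFDeriv ℝ k (f t) 0 fun _ => u) := by
  rw [taylorPoly, val_sum]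
  refine Finset.sum_congr rfl fun k _ => ?_
  have h : iteratedFDeriv ℝ k (f t) 0 (fun _ => u) = ∑ τ : Fin k → Fin m ⊕ Fin n,
      (∏ b, coords u (τ b)) • iteratedFDeriv ℝ k (f t) 0 fun b => unitState (τ b) := by
    conv_lhs => rw [← sum_coords_smul u]
    rw [ContinuousMultilinearMap.map_sum]
    refine Finset.sum_congr rfl fun τ _ => ?_
    rw [ContinuousMultilinearMap.map_smul_univ]
  rw [val_sum, h, map_sum, Finset.mul_sum]
  refine Finset.sum_congr rfl fun τ _ => ?_
  rw [val_monomial_sum, map_smul, smul_eq_mul]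
  ring

theorem taylorPoly_mem_OT (f : ℝ → State m n → V) (ℓ : V →L[ℝ] ℝ) (p : ℕ) :
    taylorPoly f ℓ p ∈ OT T 2 := by
  classical
  refine sum_mem fun k hk => sum_mem fun τ _ s hs t _ => ?_
  rw [coeff_monomial, if_neg]
  · rfl
  · rintro rfl
    simp only [map_sum, Finsupp.degree_single, Finset.sum_const, Finset.card_univ,
      Fintype.card_fin, smul_eq_mul, mul_one] at hs
    have := (Finset.mem_Ico.1 hk).1
    omega

theorem taylorPoly_slow (hT : IsOpen T) (hν : 0 ≤ ν) {f : ℝ → State m n → V} (ℓ : V →L[ℝ] ℝ)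
    (h : ∀ k < p, IsSlow T ν fun t => iteratedFDeriv ℝ k (f t) 0) (s : Fin m ⊕ Fin n →₀ ℕ) :
    IsSlow T ν (coeff s (taylorPoly f ℓ p)) := by
  refine slowCoeffs_sum hT hν _ (fun k hk => slowCoeffs_sum hT hν _ fun τ _ =>
    slowCoeffs_monomial hT hν ?_ _) s
  have h1 := ((h k (Finset.mem_Ico.1 hk).2).clm_apply hT hν
    (ContinuousMultilinearMap.apply ℝ (fun _ : Fin k => State m n) V
      fun b => unitState (τ b))).clm_apply hT hν ℓ
  exact h1.clm_apply hT hν (ContinuousLinearMap.mul ℝ ℝ (k.factorial : ℝ)⁻¹)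

/-- The O(2) bound forces the value and the first derivative at 0 to vanish, so the sum starting at
degree 2 is the full Taylor sum. -/
theorem abs_sub_taylorPoly_le (hp : 2 ≤ p) {f : ℝ → State m n → V} {r M : ℝ}
    (hf : ∀ t ∈ T, ContDiffOn ℝ p (f t) (Metric.ball 0 r)) (hf2 : IsOrc T 2 f)
    (hM : ∀ t ∈ T, ∀ v ∈ Metric.ball 0 r, ‖iteratedFDeriv ℝ p (f t) v‖ ≤ M) (ℓ : V →L[ℝ] ℝ)
    {t : ℝ} (ht : t ∈ T) {u : State m n} (hu : u ∈ Metric.ball 0 r) :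
    |ℓ (f t u) - (taylorPoly f ℓ p).val t (coords u)| ≤ ‖ℓ‖ * M * ‖u‖ ^ p := by
  obtain ⟨C, r', hr', hC⟩ := hf2
  have h0 : f t 0 = 0 := by
    have := hC t ht 0 (by simpa using hr')
    simpa using this
  have h1 : fderiv ℝ (f t) 0 = 0 := by
    refine (Asymptotics.IsBigO.hasFDerivAt (n := 2) ?_ one_lt_two).fderiv
    refine Asymptotics.IsBigO.of_bound (2 * |C|) ?_
    filter_upwards [Metric.ball_mem_nhds (0 : State m n) hr'] with w hw
    refine (hC t ht w (mem_ball_zero_iff.1 hw)).trans ?_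
    rw [sub_zero, Real.norm_of_nonneg (by positivity)]
    have h2 : ‖w.1‖ ^ 2 ≤ ‖w‖ ^ 2 := by gcongr; exact norm_fst_le w
    have h3 : ‖w.2‖ ^ 2 ≤ ‖w‖ ^ 2 := by gcongr; exact norm_snd_le w
    calc C * (‖w.1‖ ^ 2 + ‖w.2‖ ^ 2) ≤ |C| * (‖w.1‖ ^ 2 + ‖w.2‖ ^ 2) := by
          gcongr; exact le_abs_self C
      _ ≤ |C| * (‖w‖ ^ 2 + ‖w‖ ^ 2) := by gcongr
      _ = _ := by ring
  have h := norm_sub_taylor_le (by omega) (hf t ht) (hM t ht) hu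
  have hsum : ∑ k ∈ Finset.range p, ((k.factorial : ℝ)⁻¹) • iteratedFDeriv ℝ k (f t) 0 (fun _ => u)
      = ∑ k ∈ Finset.Ico 2 p, ((k.factorial : ℝ)⁻¹) • iteratedFDeriv ℝ k (f t) 0 fun _ => u := by
    rw [Finset.range_eq_Ico, ← Finset.sum_Ico_consecutive _ (Nat.zero_le 2) hp]
    simp [Finset.sum_range_succ, h0, h1, iteratedFDeriv_one_apply]
  rw [hsum] at h
  have h4 : ℓ (f t u) - (taylorPoly f ℓ p).val t (coords u) =
      ℓ (f t u - ∑ k ∈ Finset.Ico 2 p,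
        ((k.factorial : ℝ)⁻¹) • iteratedFDeriv ℝ k (f t) 0 fun _ => u) := by
    rw [val_taylorPoly, map_sub, map_sum]
    simp
  rw [h4, mul_assoc]
  exact (ℓ.le_opNorm _).trans (by gcongr)

end TaylorPoly

end FastSlow

namespace FastSlow

/-! ### Time-dependent families of near-identity maps -/

section NearIdentity

open Set Metric Filter Topology

variable {E : Type*} [NormedAddCommGroup E] [NormedSpace ℝ E] {T : Set ℝ} {Φ : ℝ → E → E} {ρ : ℝ}

theorem exists_equiv_of_norm_sub_id_le [CompleteSpace E] {D : E →L[ℝ] E}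
    (h : ‖D - ContinuousLinearMap.id ℝ E‖ ≤ 1 / 2) : ∃ e : E ≃L[ℝ] E, (e : E →L[ℝ] E) = D := by
  have h1 : IsUnit (1 - (1 - D)) := isUnit_one_sub_of_norm_lt_one (by
    rw [norm_sub_rev]
    exact h.trans_lt (by norm_num))
  rw [sub_sub_cancel] at h1
  obtain ⟨u, hu⟩ := h1
  exact ⟨ContinuousLinearEquiv.unitsEquiv ℝ E u, by rw [← hu]; rfl⟩

theorem contDiffAt_of_mem (hT : IsOpen T)
    (h1 : ContDiffOn ℝ ∞ (fun q : ℝ × E => Φ q.1 q.2) (T ×ˢ ball 0 ρ)) {t : ℝ} (ht : t ∈ T)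
    {U : E} (hU : U ∈ ball 0 ρ) : ContDiffAt ℝ ∞ (fun q : ℝ × E => Φ q.1 q.2) (t, U) :=
  h1.contDiffAt ((hT.prod isOpen_ball).mem_nhds ⟨ht, hU⟩)

theorem hasFDerivAt_of_mem (hT : IsOpen T)
    (h1 : ContDiffOn ℝ ∞ (fun q : ℝ × E => Φ q.1 q.2) (T ×ˢ ball 0 ρ)) {t : ℝ} (ht : t ∈ T)
    {U : E} (hU : U ∈ ball 0 ρ) :
    HasFDerivAt (Φ t) ((fderiv ℝ (fun q : ℝ × E => Φ q.1 q.2) (t, U)).comp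
      (ContinuousLinearMap.inr ℝ ℝ E)) U := by
  have h := ((contDiffAt_of_mem hT h1 ht hU).differentiableAt (by simp)).hasFDerivAt
  exact h.comp U (hasFDerivAt_prodMk_right t U)

/-- By the mean value inequality on the convex ball, Φ t − id is ½-Lipschitz. Injectivity, openness,
the covered ball and the two-sided norm bounds all follow from this. -/
theorem norm_image_sub_sub_le (hT : IsOpen T)
    (h1 : ContDiffOn ℝ ∞ (fun q : ℝ × E => Φ q.1 q.2) (T ×ˢ ball 0 ρ))
    (h2 : ∀ t ∈ T, ∀ U ∈ ball (0 : E) ρ,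
      ‖fderiv ℝ (Φ t) U - ContinuousLinearMap.id ℝ E‖ ≤ 1 / 2) {t : ℝ} (ht : t ∈ T)
    {U V : E} (hU : U ∈ ball (0 : E) ρ) (hV : V ∈ ball (0 : E) ρ) :
    ‖Φ t U - Φ t V - (U - V)‖ ≤ 1 / 2 * ‖U - V‖ :=
  (convex_ball (0 : E) ρ).norm_image_sub_le_of_norm_hasFDerivWithin_le'
    (φ := ContinuousLinearMap.id ℝ E) (fun _ hw =>
      (hasFDerivAt_of_mem hT h1 ht hw).differentiableAt.hasFDerivAt.hasFDerivWithinAt)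
    (h2 t ht) hV hU

/-- A family of near-identity maps, smooth in time, has inverses that are smooth also in time. -/
theorem exists_inverse_family [CompleteSpace E] (hT : IsOpen T) (hρ : 0 < ρ)
    (h1 : ContDiffOn ℝ ∞ (fun q : ℝ × E => Φ q.1 q.2) (T ×ˢ ball 0 ρ))
    (h2 : ∀ t ∈ T, ∀ U ∈ ball (0 : E) ρ,
      ‖fderiv ℝ (Φ t) U - ContinuousLinearMap.id ℝ E‖ ≤ 1 / 2)
    (h3 : ∀ t ∈ T, Φ t 0 = 0) :
    ∃ ψ : ℝ → E → E, (∀ t ∈ T, LeftInvOn (ψ t) (Φ t) (ball 0 ρ) ∧ IsOpen (Φ t '' ball 0 ρ) ∧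
      ball 0 (ρ / 4) ⊆ Φ t '' ball 0 ρ) ∧
      (∀ t ∈ T, ∀ U ∈ ball (0 : E) ρ, ‖Φ t U‖ ≤ 2 * ‖U‖ ∧ ‖U‖ ≤ 2 * ‖Φ t U‖) ∧
      ∀ t ∈ T, ∀ U ∈ ball (0 : E) ρ,
        ContDiffAt ℝ ∞ (fun q : ℝ × E => ψ q.1 q.2) (t, Φ t U) := by
  have hkey : ∀ {t : ℝ}, t ∈ T → ∀ {U V : E}, U ∈ ball (0 : E) ρ → V ∈ ball (0 : E) ρ →
      ‖Φ t U - Φ t V - (U - V)‖ ≤ 1 / 2 * ‖U - V‖ := fun ht _ _ hU hV =>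
    norm_image_sub_sub_le hT h1 h2 ht hU hV
  have hinj : ∀ t ∈ T, InjOn (Φ t) (ball 0 ρ) := by
    intro t ht U hU V hV hUV
    have h := hkey ht hU hV
    rw [hUV, sub_self, zero_sub, norm_neg] at h
    rw [← sub_eq_zero, ← norm_le_zero_iff]
    linarith
  let ψ : ℝ → E → E := fun t => Function.invFunOn (Φ t) (ball 0 ρ)
  have hψ : ∀ t ∈ T, LeftInvOn (ψ t) (Φ t) (ball 0 ρ) := fun t ht =>
    (hinj t ht).leftInvOn_invFunOn
  refine ⟨ψ, fun t ht => ?_, fun t ht U hU => ?_, fun t ht U hU => ?_⟩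
  · have happ : ApproximatesLinearOn (Φ t) (ContinuousLinearMap.id ℝ E) (ball 0 ρ) (1 / 2) :=
      fun U hU V hV => by simpa using hkey ht hU hV
    let R : (ContinuousLinearMap.id ℝ E).NonlinearRightInverse :=
      ⟨fun y => y, 1, fun y => by simp, fun y => rfl⟩
    refine ⟨hψ t ht, happ.open_image R isOpen_ball (.inr ?_), ?_⟩
    · change (1 / 2 : NNReal) < 1⁻¹
      rw [inv_one]
      exact NNReal.half_lt_self one_ne_zero
    · have h := happ.surjOn_closedBall_of_nonlinearRightInverse R (b := 0) (ε := ρ / 2)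
        (by positivity) (closedBall_subset_ball (by linarith))
      rw [h3 t ht] at h
      -- The image of the closed ball of radius ρ/2 covers radius (1 − ½) ρ/2.
      have hR : ((R.nnnorm : ℝ)⁻¹ - ((1 / 2 : NNReal) : ℝ)) * (ρ / 2) = ρ / 4 := by
        change (((1 : NNReal) : ℝ)⁻¹ - ((1 / 2 : NNReal) : ℝ)) * (ρ / 2) = ρ / 4
        push_cast
        ring
      rw [hR] at h
      exact ball_subset_closedBall.trans (h.trans
        (image_mono (closedBall_subset_ball (by linarith))))
  · have h := hkey ht hU (mem_ball_self hρ)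
    rw [h3 t ht, sub_zero, sub_zero] at h
    have h5 := norm_sub_norm_le (Φ t U) U
    have h6 := norm_sub_norm_le U (Φ t U)
    rw [norm_sub_rev] at h6
    constructor <;> linarith [norm_nonneg U]
  · set F : ℝ × E → E := fun q => Φ q.1 q.2 with hF
    have hFc := contDiffAt_of_mem hT h1 ht hU
    have hFd : HasFDerivAt F (fderiv ℝ F (t, U)) (t, U) :=
      (hFc.differentiableAt (by simp)).hasFDerivAt
    obtain ⟨e, he⟩ := exists_equiv_of_norm_sub_id_le (h2 t ht U hU)
    rw [(hasFDerivAt_of_mem hT h1 ht hU).fderiv] at he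
    set F' := fderiv ℝ F (t, U) with hF'
    have he' : ∀ w, e w = F' (0, w) := fun w => by
      have := congrArg (fun L : E →L[ℝ] E => L w) he
      simpa using this
    have hsplit : ∀ s w, F' (s, w) = F' (s, 0) + F' (0, w) := fun s w => by
      rw [← map_add]; simp
    -- For the inverse to be smooth in time as well, the inverse function theorem is applied to (t,
    -- U) ↦ (t, Φ t U). Its derivative is block triangular with diagonal blocks 1 and e, and is
    -- inverted explicitly.
    let G' : (ℝ × E) ≃L[ℝ] (ℝ × E) := ContinuousLinearEquiv.equivOfInverse
      ((ContinuousLinearMap.fst ℝ ℝ E).prod F')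
      ((ContinuousLinearMap.fst ℝ ℝ E).prod ((e.symm : E →L[ℝ] E).comp
        (ContinuousLinearMap.snd ℝ ℝ E - F'.comp ((ContinuousLinearMap.inl ℝ ℝ E).comp
          (ContinuousLinearMap.fst ℝ ℝ E)))))
      (fun q => by
        ext
        · simp
        · rcases q with ⟨s, w⟩
          simp [hsplit s w, ← he'])
      (fun q => by
        ext
        · simp
        · rcases q with ⟨s, w⟩
          simp only [ContinuousLinearMap.prod_apply, ContinuousLinearMap.comp_apply,
            ContinuousLinearMap.coe_fst', sub_apply,
            ContinuousLinearMap.coe_snd', ContinuousLinearMap.inl_apply,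
            ContinuousLinearEquiv.coe_coe]
          rw [hsplit, ← he']
          simp)
    have hG : ContDiffAt ℝ ∞ (fun q : ℝ × E => (q.1, F q)) (t, U) := contDiffAt_fst.prodMk hFc
    have hGd : HasFDerivAt (fun q : ℝ × E => (q.1, F q)) (G' : ℝ × E →L[ℝ] ℝ × E) (t, U) :=
      hasFDerivAt_fst.prodMk hFd
    have hinv := hG.to_localInverse hGd (by simp)
    refine contDiffAt_snd.comp (t, Φ t U) hinv |>.congr_of_eventuallyEq ?_
    -- Near the point the local inverse takes values in T × ball, where Φ t is injective, so it
    -- agrees with ψ.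
    have hs := hG.hasStrictFDerivAt' hGd (by simp)
    have hmem := (hs.localInverse_tendsto.eventually
      ((hT.prod isOpen_ball).mem_nhds ⟨ht, hU⟩))
    filter_upwards [hs.eventually_right_inverse, hmem] with q hq1 hq2
    change ψ q.1 q.2 = (hs.localInverse (fun q : ℝ × E => (q.1, F q)) G' (t, U) q).2
    generalize hs.localInverse (fun q : ℝ × E => (q.1, F q)) G' (t, U) q = z at hq1 hq2 ⊢
    obtain rfl : q = (z.1, F z) := hq1.symm
    exact hψ z.1 hq2.1 hq2.2

end NearIdentity

/-! ### Uniqueness for linear equations -/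

section LinearUniqueness

/-- A solution of a linear system that vanishes once vanishes always. -/
theorem eq_zero_of_linear_ode {E : Type*} [NormedAddCommGroup E] [NormedSpace ℝ E] {J : Set ℝ}
    (hJ : J.OrdConnected) {y : ℝ → E} {K : ℝ → E →L[ℝ] E}
    (hK : ContinuousOn K J) (hy : ∀ t ∈ J, HasDerivAt y (K t (y t)) t) {t₀ : ℝ} (ht₀ : t₀ ∈ J)
    (h0 : y t₀ = 0) : ∀ t ∈ J, y t = 0 := by
  -- K is bounded on compact subintervals, so Grönwall's inequality applies forward in time, and
  -- backward after the reflection s ↦ −s.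
  have hbd : ∀ a b, Set.Icc a b ⊆ J → ∃ M, ∀ t ∈ Set.Icc a b, ‖K t‖ ≤ M := fun a b hab =>
    isCompact_Icc.exists_bound_of_continuousOn (hK.mono hab)
  intro t ht
  rcases le_total t₀ t with h | h
  · have hsub : Set.Icc t₀ t ⊆ J := hJ.out ht₀ ht
    obtain ⟨M, hM⟩ := hbd _ _ hsub
    refine eq_zero_of_abs_deriv_le_mul_abs_self_of_eq_zero_right (f' := fun s => K s (y s))
      (K := M) (fun s hs => (hy s (hsub hs)).continuousAt.continuousWithinAt)
      (fun s hs => (hy s (hsub (Set.Ico_subset_Icc_self hs))).hasDerivWithinAt) h0 ?_ t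
      (Set.right_mem_Icc.2 h)
    intro s hs
    exact (ContinuousLinearMap.le_opNorm _ _).trans
      (mul_le_mul_of_nonneg_right (hM s (Set.Ico_subset_Icc_self hs)) (norm_nonneg _))
  · have hsub : Set.Icc t t₀ ⊆ J := hJ.out ht ht₀
    obtain ⟨M, hM⟩ := hbd _ _ hsub
    have hneg : ∀ s ∈ Set.Icc (-t₀) (-t), -s ∈ Set.Icc t t₀ := fun s hs =>
      ⟨by linarith [hs.2], by linarith [hs.1]⟩
    have hd : ∀ s ∈ Set.Icc (-t₀) (-t),
        HasDerivAt (fun s => y (-s)) (-K (-s) (y (-s))) s := by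
      intro s hs
      simpa [Function.comp_def] using (hy (-s) (hsub (hneg s hs))).scomp s (hasDerivAt_neg s)
    have := eq_zero_of_abs_deriv_le_mul_abs_self_of_eq_zero_right (f := fun s => y (-s))
      (f' := fun s => -K (-s) (y (-s)))
      (K := M) (fun s hs => (hd s hs).continuousAt.continuousWithinAt)
      (fun s hs => (hd s (Set.Ico_subset_Icc_self hs)).hasDerivWithinAt) (by simpa using h0) (by
        intro s hs
        rw [norm_neg]
        exact (ContinuousLinearMap.le_opNorm _ _).trans (mul_le_mul_of_nonneg_right
          (hM _ (hneg s (Set.Ico_subset_Icc_self hs))) (norm_nonneg _))) (-t)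
      (Set.right_mem_Icc.2 (by linarith))
    simpa using this

end LinearUniqueness

end FastSlow

namespace FastSlow

/-! ### Size and derivatives of multinomials as functions -/

section Calculus

open MvPolynomial

variable {m n q : ℕ} {T : Set ℝ}

/-- The state with given coordinates. -/
noncomputable def assemble (m n : ℕ) : (Fin m ⊕ Fin n → ℝ) →L[ℝ] State m n :=
  LinearMap.toContinuousLinearMap
    { toFun := fun w => (WithLp.toLp 2 fun i => w (Sum.inl i), WithLp.toLp 2 fun j => w (Sum.inr j))
      map_add' := fun _ _ => rfl
      map_smul' := fun _ _ => rfl }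

theorem assemble_apply (w : Fin m ⊕ Fin n → ℝ) : assemble m n w =
    (WithLp.toLp 2 fun i => w (Sum.inl i), WithLp.toLp 2 fun j => w (Sum.inr j)) := rfl

theorem assemble_coords (U : State m n) : assemble m n (coords U) = U := rfl

theorem coords_assemble (w : Fin m ⊕ Fin n → ℝ) : coords (assemble m n w) = w := by
  ext (i | j) <;> rfl

/-- A coordinate. -/
noncomputable def coordCLM (i : Fin m ⊕ Fin n) : State m n →L[ℝ] ℝ :=
  LinearMap.toContinuousLinearMap
    { toFun := fun U => coords U i
      map_add' := fun _ _ => by rcases i with i | j <;> rfl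
      map_smul' := fun _ _ => by rcases i with i | j <;> rfl }

theorem norm_assemble_le {w : Fin m ⊕ Fin n → ℝ} {c : ℝ} (hc : 0 ≤ c) (h : ∀ i, |w i| ≤ c) :
    ‖assemble m n w‖ ≤ ‖assemble m n‖ * c :=
  (ContinuousLinearMap.le_opNorm _ _).trans
    (mul_le_mul_of_nonneg_left ((pi_norm_le_iff_of_nonneg hc).2 h) (norm_nonneg _))

/-- The coefficients are bounded over `T`. -/
def BddCoeffs {σ : Type} (T : Set ℝ) (P : TPoly σ) : Prop :=
  ∀ s, ∃ M, ∀ t ∈ T, |coeff s P t| ≤ M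

theorem GSlow.bddCoeffs {σ : Type} {ν : ℝ} {j : ℕ} {P : TPoly σ} (h : GSlow T ν j P) :
    BddCoeffs T P := fun s => by
  obtain ⟨M, -, hM⟩ := (h.2 s).exists_norm_le
  exact ⟨M, hM⟩

theorem BddCoeffs.sub {σ : Type} {P Q : TPoly σ} (hP : BddCoeffs T P) (hQ : BddCoeffs T Q) :
    BddCoeffs T (P - Q) := fun s => by
  obtain ⟨M, hM⟩ := hP s
  obtain ⟨M', hM'⟩ := hQ s
  refine ⟨M + M', fun t ht => ?_⟩
  rw [coeff_sub]
  exact (abs_sub _ _).trans (add_le_add (hM t ht) (hM' t ht))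

theorem BddCoeffs.pderiv {σ : Type} {P : TPoly σ} (hP : BddCoeffs T P) (i : σ) :
    BddCoeffs T (pderiv i P) := fun s => by
  obtain ⟨M, hM⟩ := hP (s + Finsupp.single i 1)
  refine ⟨M * (s i + 1), fun t ht => ?_⟩
  rw [coeff_pderiv]
  have h : ((s i : ℝ → ℝ) + 1) t = (s i : ℝ) + 1 := rfl
  rw [Pi.mul_apply, h, abs_mul, abs_of_nonneg (by positivity : (0 : ℝ) ≤ s i + 1)]
  gcongr
  exact hM t ht

/-- For ‖U‖ ≤ 1 every monomial of degree at least q is at most ‖U‖^q; bounded coefficients make the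
constant uniform in time. -/
theorem exists_abs_val_le {P : TPoly (Fin m ⊕ Fin n)} (hP : P ∈ OT T q) (hb : BddCoeffs T P) :
    ∃ C, 0 ≤ C ∧ ∀ t ∈ T, ∀ U : State m n, ‖U‖ ≤ 1 →
      |P.val t (coords U)| ≤ C * ‖U‖ ^ q := by
  choose M hM using hb
  refine ⟨∑ s ∈ P.support, |M s|, by positivity, fun t ht U hU => ?_⟩
  rw [val_eq_sum, Finset.sum_mul]
  refine (Finset.abs_sum_le_sum_abs _ _).trans (Finset.sum_le_sum fun s _ => ?_)
  rcases lt_or_ge s.degree q with h | h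
  · rw [hP s h t ht, zero_mul, abs_zero]
    positivity
  rw [abs_mul, Finset.abs_prod]
  refine mul_le_mul ((hM s t ht).trans (le_abs_self _)) ?_ (by positivity) (abs_nonneg _)
  calc ∏ i, |coords U i ^ s i| ≤ ∏ i, ‖U‖ ^ s i := by
        refine Finset.prod_le_prod (fun _ _ => abs_nonneg _) fun i _ => ?_
        rw [abs_pow]
        exact pow_le_pow_left₀ (abs_nonneg _) (abs_coords_le U i) _
    _ = ‖U‖ ^ s.degree := by rw [Finset.prod_pow_eq_pow_sum, Finsupp.degree_eq_sum]
    _ ≤ ‖U‖ ^ q := pow_le_pow_of_le_one (norm_nonneg _) hU h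

theorem exists_forall_abs_val_le {ι : Type*} [Finite ι] {P : ι → TPoly (Fin m ⊕ Fin n)}
    (hP : ∀ i, P i ∈ OT T q) (hb : ∀ i, BddCoeffs T (P i)) :
    ∃ C, 0 ≤ C ∧ ∀ t ∈ T, ∀ U : State m n, ‖U‖ ≤ 1 → ∀ i,
      |(P i).val t (coords U)| ≤ C * ‖U‖ ^ q := by
  have := Fintype.ofFinite ι
  choose C hC h using fun i => exists_abs_val_le (hP i) (hb i)
  refine ⟨∑ i, C i, Finset.sum_nonneg fun i _ => hC i, fun t ht U hU i => ?_⟩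
  refine (h i t ht U hU).trans (mul_le_mul_of_nonneg_right ?_ (by positivity))
  exact Finset.single_le_sum (f := C) (fun i _ => hC i) (Finset.mem_univ i)

/-- The norm of a pair is the larger of the two norms, so its q-th power is one of the summands. -/
theorem isOrc_of_norm_le {V : Type*} [NormedAddCommGroup V] {h : ℝ → State m n → V} {C r : ℝ}
    (hr : 0 < r) (hC : ∀ t ∈ T, ∀ U : State m n, ‖U‖ < r → ‖h t U‖ ≤ C * ‖U‖ ^ q) :
    IsOrc T q h := by
  refine ⟨max C 0, r, hr, fun t ht U hU => (hC t ht U hU).trans ?_⟩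
  have h1 : ‖U‖ ^ q ≤ ‖U.1‖ ^ q + ‖U.2‖ ^ q := by
    rcases le_total ‖U.1‖ ‖U.2‖ with h | h
    · rw [Prod.norm_def, max_eq_right h]
      exact le_add_of_nonneg_left (by positivity)
    · rw [Prod.norm_def, max_eq_left h]
      exact le_add_of_nonneg_right (by positivity)
  exact mul_le_mul (le_max_left _ _) h1 (by positivity) (le_max_right _ _)

theorem val_zero {σ : Type} (t : ℝ) (v : σ → ℝ) : TPoly.val (0 : TPoly σ) t v = 0 :=
  map_zero (eval₂Hom (Pi.evalRingHom (fun _ : ℝ => ℝ) t) v)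

theorem val_one {σ : Type} (t : ℝ) (v : σ → ℝ) : TPoly.val (1 : TPoly σ) t v = 1 :=
  map_one (eval₂Hom (Pi.evalRingHom (fun _ : ℝ => ℝ) t) v)

/-- The derivative of a multinomial in its variables. -/
noncomputable def dval (P : TPoly (Fin m ⊕ Fin n)) (t : ℝ) (U : State m n) : State m n →L[ℝ] ℝ :=
  ∑ l, TPoly.val (pderiv l P) t (coords U) • coordCLM l

theorem dval_apply (P : TPoly (Fin m ⊕ Fin n)) (t : ℝ) (U w : State m n) :
    dval P t U w = ∑ l, TPoly.val (pderiv l P) t (coords U) * coords w l := by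
  rw [dval, sum_apply]
  rfl

theorem hasFDerivAt_val (P : TPoly (Fin m ⊕ Fin n)) (t : ℝ) (U : State m n) :
    HasFDerivAt (fun U => P.val t (coords U)) (dval P t U) U := by
  classical
  induction P using MvPolynomial.induction_on with
  | C a =>
    have h : dval (C a) t U = (0 : State m n →L[ℝ] ℝ) := by
      refine Finset.sum_eq_zero fun l _ => ?_
      rw [pderiv_C, val_zero, zero_smul]
    rw [h]
    simp only [val_C]
    exact hasFDerivAt_const _ _
  | add P Q hP hQ =>
    have h : dval (P + Q) t U = dval P t U + dval Q t U := by
      simp only [dval, map_add, val_add, add_smul, Finset.sum_add_distrib]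
    rw [h]
    simp only [val_add]
    exact hP.add hQ
  | mul_X P i hP =>
    have h : dval (P * X i) t U =
        TPoly.val P t (coords U) • coordCLM i + coords U i • dval P t U := by
      simp only [dval, pderiv_mul, val_add, val_mul, val_X, add_smul, Finset.sum_add_distrib,
        Finset.smul_sum, smul_smul]
      rw [add_comm]
      congr 1
      · rw [Finset.sum_eq_single i]
        · rw [pderiv_X_self]
          congr 1
          rw [val_one, mul_one]
        · intro l _ hl
          rw [pderiv_X_of_ne (Ne.symm hl)]
          rw [val_zero, mul_zero, zero_smul]
        · exact fun h => absurd (Finset.mem_univ i) h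
      · simp only [mul_comm]
    rw [h]
    simp only [val_mul, val_X]
    exact hP.mul (coordCLM i).hasFDerivAt

theorem dval_X (i : Fin m ⊕ Fin n) (t : ℝ) (U : State m n) :
    dval (X i) t U = (coordCLM i : State m n →L[ℝ] ℝ) := by
  have h := hasFDerivAt_val (X i) t U
  simp only [val_X] at h
  exact h.unique (coordCLM i).hasFDerivAt

theorem dval_sub (P Q : TPoly (Fin m ⊕ Fin n)) (t : ℝ) (U : State m n) :
    dval (P - Q) t U = dval P t U - dval Q t U := by
  refine ContinuousLinearMap.ext fun w => ?_
  simp only [sub_apply, dval_apply, map_sub, val_sub, sub_mul, Finset.sum_sub_distrib]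

theorem hasDerivAt_val_time {P : TPoly (Fin m ⊕ Fin n)} {t : ℝ}
    (h : ∀ s, DifferentiableAt ℝ (coeff s P) t) (v : Fin m ⊕ Fin n → ℝ) :
    HasDerivAt (fun t => P.val t v) ((dt P).val t v) t := by
  have h1 : (dt P).val t v = ∑ s ∈ P.support, deriv (coeff s P) t * ∏ i, v i ^ s i := by
    rw [dt, val_sum]
    refine Finset.sum_congr rfl fun s _ => ?_
    rw [TPoly.val, eval₂_monomial, Finsupp.prod_fintype _ _ (fun _ => pow_zero _)]
    rfl
  rw [h1]
  simp only [val_eq_sum]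
  exact HasDerivAt.fun_sum fun s _ => (h s).hasDerivAt.mul_const _

theorem contDiffOn_val {P : TPoly (Fin m ⊕ Fin n)} (h : ∀ s, ContDiffOn ℝ ∞ (coeff s P) T) :
    ContDiffOn ℝ ∞ (fun q : ℝ × State m n => P.val q.1 (coords q.2)) (T ×ˢ Set.univ) := by
  simp only [val_eq_sum]
  refine ContDiffOn.sum fun s _ => ContDiffOn.mul ?_ ?_
  · exact (h s).comp contDiffOn_fst fun q hq => hq.1
  · refine contDiffOn_prod fun i _ => ContDiffOn.pow ?_ _
    exact ((coordCLM i).contDiff.comp contDiff_snd).contDiffOn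

theorem val_linPoly {σ : Type} [Fintype σ] (Λ : Matrix σ σ ℝ) (Ξ : σ → TPoly σ) (i : σ)
    (t : ℝ) (v : σ → ℝ) : (linPoly Λ Ξ i).val t v = ∑ l, Λ i l * (Ξ l).val t v := by
  rw [linPoly, val_sum]
  simp only [val_mul, val_C, Function.const_apply]

theorem val_residual {σ : Type} [Fintype σ] (Λ : Matrix σ σ ℝ) (φ Ξ V : σ → TPoly σ) (i : σ)
    (t : ℝ) (v : σ → ℝ) : (residual Λ φ Ξ V i).val t v =
      (dt (Ξ i)).val t v + ∑ l, TPoly.val (pderiv l (Ξ i)) t v * (V l).val t v -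
        ∑ l, Λ i l * (Ξ l).val t v - (φ i).val t fun l => (Ξ l).val t v := by
  rw [residual, val_sub, val_sub, val_add, val_sum, val_linPoly, val_bind]
  simp only [val_mul]

end Calculus

/-! ### The normal form in terms of its multinomials -/

section NormalFormCalculus

open MvPolynomial

variable {m n : ℕ} {T : Set ℝ} (N : NormalForm m n)
  (A : Matrix (Fin m) (Fin m) ℝ) (B : Matrix (Fin n) (Fin n) ℝ)

theorem NormalForm.transform_eq (t : ℝ) (U : State m n) :
    N.transform t U = assemble m n fun i => (N.substPoly i).val t (coords U) := rfl

theorem NormalForm.nonlin_eq (t : ℝ) (U : State m n) :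
    (N.FVec t U, N.GVec t U) = assemble m n fun i => (N.nonlinPoly i).val t (coords U) := by
  rw [assemble_apply]
  refine Prod.ext ?_ ?_
  · ext i
    simp only [FVec, FcVec, nonlinPoly, Sum.elim_inl, val_add, val_sum, val_mul, val_X, val_rename,
      PiLp.add_apply]
    rfl
  · ext j
    simp only [GVec, nonlinPoly, Sum.elim_inr, val_sum, val_mul, val_X]
    rfl

theorem lin_eq (u : State m n) :
    (Matrix.toEuclideanLin A u.1, Matrix.toEuclideanLin B u.2) =
      assemble m n fun i => ∑ l, Matrix.fromBlocks A 0 0 B i l * coords u l := by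
  rw [assemble_apply]
  refine Prod.ext ?_ ?_
  · ext i
    simp [coords, Matrix.toLpLin_apply, Matrix.mulVec, dotProduct]
  · ext j
    simp [coords, Matrix.toLpLin_apply, Matrix.mulVec, dotProduct]

theorem NormalForm.field_eq (t : ℝ) (U : State m n) :
    N.field A B t U = assemble m n fun i => (N.fieldPoly A B i).val t (coords U) := by
  have h : N.field A B t U = (Matrix.toEuclideanLin A U.1, Matrix.toEuclideanLin B U.2) +
      (N.FVec t U, N.GVec t U) := rfl
  rw [h, lin_eq, N.nonlin_eq, ← map_add]
  congr 1
  ext i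
  simp only [fieldPoly, Pi.add_apply, val_add, val_linPoly, val_X]

theorem givenField_eq (f : ℝ → State m n → Vec m) (g : ℝ → State m n → Vec n) (t : ℝ)
    (u : State m n) : givenField A B f g t u = assemble m n fun i =>
      ∑ l, Matrix.fromBlocks A 0 0 B i l * coords u l + coords (f t u, g t u) i := by
  have h : givenField A B f g t u = (Matrix.toEuclideanLin A u.1, Matrix.toEuclideanLin B u.2) +
      (f t u, g t u) := rfl
  rw [h, lin_eq]
  conv_lhs => rw [← assemble_coords (f t u, g t u), ← map_add]
  rfl

theorem NormalForm.hasFDerivAt_transform (t : ℝ) (U : State m n) :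
    HasFDerivAt (N.transform t)
      ((assemble m n).comp (ContinuousLinearMap.pi fun i => dval (N.substPoly i) t U)) U :=
  (assemble m n).hasFDerivAt.comp U
    (hasFDerivAt_pi.2 fun i => hasFDerivAt_val (N.substPoly i) t U)

variable {N} in
theorem NormalForm.velocity_eq {t : ℝ}
    (h : ∀ i s, DifferentiableAt ℝ (coeff s (N.substPoly i)) t) (U : State m n) :
    N.velocity A B t U = assemble m n fun i => (dt (N.substPoly i)).val t (coords U) +
      ∑ l, TPoly.val (pderiv l (N.substPoly i)) t (coords U) *
        (N.fieldPoly A B l).val t (coords U) := by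
  have h1 : HasDerivAt (fun s => N.transform s U)
      (assemble m n fun i => (dt (N.substPoly i)).val t (coords U)) t :=
    (assemble m n).hasFDerivAt.comp_hasDerivAt t
      (hasDerivAt_pi.2 fun i => hasDerivAt_val_time (h i) (coords U))
  rw [velocity, h1.deriv, (N.hasFDerivAt_transform t U).fderiv, ContinuousLinearMap.comp_apply,
    ← map_add]
  congr 1
  ext i
  rw [Pi.add_apply, ContinuousLinearMap.pi_apply, dval_apply]
  congr 1
  refine Finset.sum_congr rfl fun l _ => ?_
  rw [N.field_eq, coords_assemble]

theorem NormalForm.fderiv_transform_sub_id (t : ℝ) (U : State m n) :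
    fderiv ℝ (N.transform t) U - ContinuousLinearMap.id ℝ (State m n) =
      (assemble m n).comp
        (ContinuousLinearMap.pi fun i => dval (N.substPoly i - X i) t U) := by
  rw [(N.hasFDerivAt_transform t U).fderiv]
  refine ContinuousLinearMap.ext fun w => ?_
  simp only [sub_apply, ContinuousLinearMap.comp_apply, dval_sub, dval_X]
  have h : ContinuousLinearMap.id ℝ (State m n) w = assemble m n (coords w) := rfl
  rw [h, ← map_sub]
  rfl

variable {N} in
-- The derivatives of Ξ − X have order 1 and bounded coefficients, so a single radius makes the
-- transform near-identity at all times in T.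
theorem NormalForm.exists_fderiv_bound (h2 : ∀ i, N.substPoly i - X i ∈ OT T 2)
    (hb : ∀ i, BddCoeffs T (N.substPoly i - X i)) :
    ∃ K, 0 ≤ K ∧ ∀ t ∈ T, ∀ U : State m n, ‖U‖ ≤ 1 →
      ‖fderiv ℝ (N.transform t) U - ContinuousLinearMap.id ℝ (State m n)‖ ≤ K * ‖U‖ := by
  obtain ⟨C, hC, h⟩ := exists_forall_abs_val_le
    (P := fun x : (Fin m ⊕ Fin n) × (Fin m ⊕ Fin n) => pderiv x.2 (N.substPoly x.1 - X x.1))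
    (fun x => pderiv_mem_OT (q := 1) (h2 x.1) x.2) (fun x => (hb x.1).pderiv x.2)
  refine ⟨‖assemble m n‖ * (Fintype.card (Fin m ⊕ Fin n) * C), by positivity,
    fun t ht U hU => ?_⟩
  rw [N.fderiv_transform_sub_id]
  refine ContinuousLinearMap.opNorm_le_bound _ (by positivity) fun w => ?_
  rw [ContinuousLinearMap.comp_apply]
  refine (norm_assemble_le (c := Fintype.card (Fin m ⊕ Fin n) * (C * ‖U‖ * ‖w‖))
    (by positivity) fun i => ?_).trans (le_of_eq (by ring))
  rw [ContinuousLinearMap.pi_apply, dval_apply]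
  refine (Finset.abs_sum_le_sum_abs _ _).trans ?_
  rw [← nsmul_eq_mul, ← Finset.card_univ]
  refine Finset.sum_le_card_nsmul _ _ _ fun l _ => ?_
  rw [abs_mul]
  refine mul_le_mul ?_ (abs_coords_le w l) (abs_nonneg _) (by positivity)
  simpa using h t ht U hU (i, l)

end NormalFormCalculus

end FastSlow

namespace FastSlow

/-! ### Invariance of the slow manifold -/

section SlowManifold

open Set Metric

variable {m n : ℕ} {T : Set ℝ} {ρ : ℝ} {N : NormalForm m n} {ψ : ℝ → State m n → State m n}
  {A : Matrix (Fin m) (Fin m) ℝ} {B : Matrix (Fin n) (Fin n) ℝ}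

theorem NormalForm.hasDerivAt_transform_comp (hT : IsOpen T)
    (h1 : ContDiffOn ℝ ∞ (fun q : ℝ × State m n => N.transform q.1 q.2) (T ×ˢ ball 0 ρ))
    {U : ℝ → State m n} {V : State m n} {t : ℝ} (ht : t ∈ T) (hU : U t ∈ ball 0 ρ)
    (h : HasDerivAt U V t) :
    HasDerivAt (fun s => N.transform s (U s))
      (fderiv ℝ (fun q : ℝ × State m n => N.transform q.1 q.2) (t, U t) (1, V)) t := by
  have hF := ((contDiffAt_of_mem (Φ := N.transform) hT h1 ht hU).differentiableAt (by simp)).hasFDerivAt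
  exact hF.comp_hasDerivAt t ((hasDerivAt_id t).prodMk h)

/-- The partial derivatives in t and U combine into one derivative of the joint map in the direction
(1, field), the form delivered by the chain rule along a curve. -/
theorem NormalForm.velocity_eq_fderiv (hT : IsOpen T)
    (h1 : ContDiffOn ℝ ∞ (fun q : ℝ × State m n => N.transform q.1 q.2) (T ×ˢ ball 0 ρ))
    {t : ℝ} (ht : t ∈ T) {U : State m n} (hU : U ∈ ball 0 ρ) :
    N.velocity A B t U =
      fderiv ℝ (fun q : ℝ × State m n => N.transform q.1 q.2) (t, U) (1, N.field A B t U) := by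
  have h2 := (N.hasDerivAt_transform_comp hT h1 (U := fun _ => U) ht hU (hasDerivAt_const t U)).deriv
  rw [velocity, h2, (hasFDerivAt_of_mem (Φ := N.transform) hT h1 ht hU).fderiv, ContinuousLinearMap.comp_apply,
    ContinuousLinearMap.inr_apply, ← map_add]
  simp

theorem NormalForm.FVec_prodMk_zero (t : ℝ) (X : Vec m) : N.FVec t (X, 0) = N.FcVec t X := by
  ext i
  simp [FVec]

theorem NormalForm.GVec_prodMk_zero (t : ℝ) (X : Vec m) : N.GVec t (X, 0) = 0 := by
  ext i
  simp [GVec]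

theorem NormalForm.field_prodMk_zero (t : ℝ) (X : Vec m) :
    N.field A B t (X, 0) = (Matrix.toEuclideanLin A X + N.FcVec t X, 0) := by
  rw [field, N.FVec_prodMk_zero, N.GVec_prodMk_zero]
  simp

/-- The matrix `B + G`. -/
noncomputable def NormalForm.fastMatrix (N : NormalForm m n) (B : Matrix (Fin n) (Fin n) ℝ) (t : ℝ)
    (U : State m n) : Matrix (Fin n) (Fin n) ℝ :=
  B + Matrix.of fun j k => (N.G j k).val t (coords U)

theorem NormalForm.toEuclideanLin_fastMatrix (t : ℝ) (U : State m n) :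
    Matrix.toEuclideanLin (N.fastMatrix B t U) U.2 = (N.field A B t U).2 := by
  have h : (N.field A B t U).2 = Matrix.toEuclideanLin B U.2 + N.GVec t U := rfl
  rw [h, fastMatrix, map_add, LinearMap.add_apply]
  congr 1

theorem NormalForm.continuousOn_fastMatrix {J : Set ℝ} (hJ : J ⊆ T)
    (hG : ∀ j k s, ContDiffOn ℝ ∞ (MvPolynomial.coeff s (N.G j k)) T) {U : ℝ → State m n}
    (hU : ContinuousOn U J) : ContinuousOn (fun t => N.fastMatrix B t (U t)) J := by
  refine continuousOn_const.add (continuousOn_pi.2 fun j => continuousOn_pi.2 fun k => ?_)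
  exact (contDiffOn_val (hG j k)).continuousOn.comp (continuousOn_id.prodMk hU)
    fun t ht => ⟨hJ ht, mem_univ _⟩

/-- The manifold `Y = 0` is an exact slow manifold of the transformed system. -/
theorem NormalForm.hasSlowManifold (hT : IsOpen T)
    (h1 : ContDiffOn ℝ ∞ (fun q : ℝ × State m n => N.transform q.1 q.2) (T ×ˢ ball 0 ρ))
    (h2 : ∀ t ∈ T, ∀ U ∈ ball (0 : State m n) ρ,
      ‖fderiv ℝ (N.transform t) U - ContinuousLinearMap.id ℝ (State m n)‖ ≤ 1 / 2)
    (hG : ∀ j k s, ContDiffOn ℝ ∞ (MvPolynomial.coeff s (N.G j k)) T)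
    (hψ : ∀ t ∈ T, LeftInvOn (ψ t) (N.transform t) (ball 0 ρ))
    (hψ' : ∀ t ∈ T, ∀ U ∈ ball (0 : State m n) ρ,
      ContDiffAt ℝ ∞ (fun q : ℝ × State m n => ψ q.1 q.2) (t, N.transform t U)) :
    HasSlowManifold N A T ρ fun t u => N.velocity A B t (ψ t u) := by
  intro J hJo hJc hJT
  refine ⟨fun u hu hdom h0 => ?_, fun X hX hXρ => ?_⟩
  · have hmem : ∀ t ∈ J, ψ t (u t) ∈ ball 0 ρ ∧ N.transform t (ψ t (u t)) = u t := by
      intro t ht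
      obtain ⟨U, hU, hUt⟩ := hdom t ht
      rw [← hUt, hψ t (hJT ht) hU]
      exact ⟨hU, rfl⟩
    -- The pulled-back curve solves (2): differentiate the identity that its image under the
    -- transform is u, compare with the velocity, and cancel the invertible spatial derivative.
    have hdiff : ∀ t ∈ J, HasDerivAt (fun t => ψ t (u t))
        (N.field A B t (ψ t (u t))) t := by
      intro t ht
      have hd : DifferentiableAt ℝ (fun t => ψ t (u t)) t := by
        have h3 := hψ' t (hJT ht) _ (hmem t ht).1
        rw [(hmem t ht).2] at h3
        exact (h3.differentiableAt (by simp)).comp t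
          (differentiableAt_id.prodMk (hu t ht).differentiableAt)
      have h4 := N.hasDerivAt_transform_comp hT h1 (U := fun t => ψ t (u t)) (hJT ht) (hmem t ht).1 hd.hasDerivAt
      have h5 : (fun s => N.transform s (ψ s (u s))) =ᶠ[nhds t] u := by
        filter_upwards [hJo.mem_nhds ht] with s hs using (hmem s hs).2
      have h6 := (h4.congr_of_eventuallyEq h5.symm).unique (hu t ht)
      change _ = N.velocity A B t (ψ t (u t)) at h6
      rw [N.velocity_eq_fderiv hT h1 (hJT ht) (hmem t ht).1, ← sub_eq_zero, ← map_sub] at h6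
      obtain ⟨e, he⟩ := exists_equiv_of_norm_sub_id_le (h2 t (hJT ht) _ (hmem t ht).1)
      rw [(hasFDerivAt_of_mem (Φ := N.transform) hT h1 (hJT ht) (hmem t ht).1).fderiv] at he
      have h7 : e (deriv (fun t => ψ t (u t)) t - N.field A B t (ψ t (u t))) = 0 := by
        rw [← h6, ← ContinuousLinearEquiv.coe_coe, he, ContinuousLinearMap.comp_apply,
          ContinuousLinearMap.inr_apply]
        simp
      have h8 := hd.hasDerivAt
      rwa [sub_eq_zero.1 ((map_eq_zero_iff e e.injective).1 h7)] at h8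
    have hcont : ContinuousOn (fun t => ψ t (u t)) J := fun t ht =>
      (hdiff t ht).continuousAt.continuousWithinAt
    obtain ⟨t₀, ht₀, U₀, ⟨hU₀, hY₀⟩, hU₀u⟩ := h0
    let L : Matrix (Fin n) (Fin n) ℝ →ₗ[ℝ] (Vec n →L[ℝ] Vec n) :=
      (LinearMap.toContinuousLinearMap : (Vec n →ₗ[ℝ] Vec n) ≃ₗ[ℝ] (Vec n →L[ℝ] Vec n)).toLinearMap
        ∘ₗ (Matrix.toEuclideanLin : Matrix (Fin n) (Fin n) ℝ ≃ₗ[ℝ] (Vec n →ₗ[ℝ] Vec n)).toLinearMap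
    have hLc : Continuous L := L.continuous_of_finiteDimensional
    -- With the solution inserted in G, the equation Y' = (B + G) Y is linear with continuous
    -- coefficients, so one zero of Y forces Y = 0 throughout J.
    have hY : ∀ t ∈ J, (ψ t (u t)).2 = 0 :=
      eq_zero_of_linear_ode hJc (K := fun t => L (N.fastMatrix B t (ψ t (u t))))
        (hLc.comp_continuousOn (N.continuousOn_fastMatrix hJT hG hcont))
        (fun t ht => by
          have h3 : L (N.fastMatrix B t (ψ t (u t))) (ψ t (u t)).2 =
            (N.field A B t (ψ t (u t))).2 := N.toEuclideanLin_fastMatrix t _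
          rw [h3]
          exact (ContinuousLinearMap.snd ℝ (Vec m) (Vec n)).hasFDerivAt.comp_hasDerivAt t
            (hdiff t ht)) ht₀
        (by rw [← hU₀u, hψ t₀ (hJT ht₀) hU₀, hY₀])
    have hXY : ∀ t ∈ J, ψ t (u t) = ((ψ t (u t)).1, 0) := fun t ht =>
      Prod.ext rfl (hY t ht)
    refine ⟨fun t ht => ⟨_, ⟨(hmem t ht).1, hY t ht⟩, (hmem t ht).2⟩,
      fun t => (ψ t (u t)).1, fun t ht => ?_, fun t ht => ⟨?_, ?_⟩⟩
    · have h3 := (ContinuousLinearMap.fst ℝ (Vec m) (Vec n)).hasFDerivAt.comp_hasDerivAt t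
        (hdiff t ht)
      rw [hXY t ht, N.field_prodMk_zero] at h3
      exact h3
    · exact (norm_fst_le _).trans_lt (mem_ball_zero_iff.1 (hmem t ht).1)
    · rw [← hXY t ht, (hmem t ht).2]
  · intro t ht
    have hball : (X t, (0 : Vec n)) ∈ ball (0 : State m n) ρ := by
      rw [mem_ball_zero_iff, Prod.norm_def, norm_zero, max_eq_left (norm_nonneg _)]
      exact hXρ t ht
    have h3 := N.hasDerivAt_transform_comp hT h1 (U := fun t => (X t, 0)) (hJT ht) hball
      ((hX t ht).prodMk (hasDerivAt_const t (0 : Vec n)))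
    change HasDerivAt _ (N.velocity A B t (ψ t (N.transform t (X t, 0)))) t
    rw [hψ t (hJT ht) hball, N.velocity_eq_fderiv hT h1 (hJT ht) hball, N.field_prodMk_zero]
    exact h3

end SlowManifold

end FastSlow

namespace FastSlow

/-! ### Order estimates for the transform and the defect -/

section Estimates

open Set Metric MvPolynomial

variable {m n p : ℕ} {T : Set ℝ} {ν : ℝ} {N : NormalForm m n}
  {A : Matrix (Fin m) (Fin m) ℝ} {B : Matrix (Fin n) (Fin n) ℝ}

theorem NormalForm.contDiffOn_transform
    (h : ∀ i s, ContDiffOn ℝ ∞ (coeff s (N.substPoly i)) T) :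
    ContDiffOn ℝ ∞ (fun q : ℝ × State m n => N.transform q.1 q.2) (T ×ˢ univ) :=
  (assemble m n).contDiff.comp_contDiffOn (contDiffOn_pi.2 fun i => contDiffOn_val (h i))

theorem exists_norm_assemble_val_le {q : ℕ} {P : Fin m ⊕ Fin n → TPoly (Fin m ⊕ Fin n)}
    (hP : ∀ i, P i ∈ OT T q) (hb : ∀ i, BddCoeffs T (P i)) :
    ∃ C, ∀ t ∈ T, ∀ U : State m n, ‖U‖ ≤ 1 →
      ‖assemble m n fun i => (P i).val t (coords U)‖ ≤ C * ‖U‖ ^ q := by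
  obtain ⟨C, hC, h⟩ := exists_forall_abs_val_le hP hb
  refine ⟨‖assemble m n‖ * C, fun t ht U hU => ?_⟩
  rw [mul_assoc]
  exact norm_assemble_le (by positivity) (h t ht U hU)

theorem NormalForm.isOrc_transform_sub (h : ∀ i, N.substPoly i - X i ∈ OT T 2)
    (hb : ∀ i, BddCoeffs T (N.substPoly i - X i)) :
    IsOrc T 2 fun t U => N.transform t U - U := by
  obtain ⟨C, hC⟩ := exists_norm_assemble_val_le h hb
  refine isOrc_of_norm_le (C := C) one_pos fun t ht U hU => ?_
  have h1 : N.transform t U - U =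
      assemble m n fun i => (N.substPoly i - X i).val t (coords U) := by
    rw [N.transform_eq]
    refine (congrArg (_ - ·) (assemble_coords U).symm).trans ((map_sub _ _ _).symm.trans ?_)
    congr 1
    ext i
    rw [val_sub, val_X]
    rfl
  rw [h1]
  exact hC t ht U hU.le

theorem NormalForm.isOrc_nonlin {q : ℕ} (h : ∀ i, N.nonlinPoly i ∈ OT T q)
    (hb : ∀ i, BddCoeffs T (N.nonlinPoly i)) : IsOrc T q N.FVec ∧ IsOrc T q N.GVec := by
  obtain ⟨C, hC⟩ := exists_norm_assemble_val_le h hb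
  refine ⟨isOrc_of_norm_le (C := C) one_pos fun t ht U hU => ?_,
    isOrc_of_norm_le (C := C) one_pos fun t ht U hU => ?_⟩ <;>
  have h1 := hC t ht U hU.le <;>
  rw [← N.nonlin_eq] at h1
  · exact (norm_fst_le _).trans h1
  · exact (norm_snd_le _).trans h1

theorem NormalForm.transform_zero (h : ∀ i, N.substPoly i ∈ OT T 1)
    (hb : ∀ i, BddCoeffs T (N.substPoly i)) {t : ℝ} (ht : t ∈ T) : N.transform t 0 = 0 := by
  obtain ⟨C, hC⟩ := exists_norm_assemble_val_le h hb
  have h1 := hC t ht 0 (by simp)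
  rw [← N.transform_eq] at h1
  simpa using h1

/-- The defect of the transformed system, in terms of the multinomial residual. -/
theorem NormalForm.velocity_sub_givenField {t : ℝ}
    (h : ∀ i s, DifferentiableAt ℝ (coeff s (N.substPoly i)) t)
    (φ : Fin m ⊕ Fin n → TPoly (Fin m ⊕ Fin n)) (f : ℝ → State m n → Vec m)
    (g : ℝ → State m n → Vec n) (U : State m n) :
    N.velocity A B t U - givenField A B f g t (N.transform t U) =
      assemble m n fun i =>
        (residual (Matrix.fromBlocks A 0 0 B) φ N.substPoly (N.fieldPoly A B) i).val t (coords U) -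
        (coords (f t (N.transform t U), g t (N.transform t U)) i -
          (φ i).val t (coords (N.transform t U))) := by
  rw [N.velocity_eq A B h, givenField_eq, ← map_sub]
  congr 1
  ext i
  have h1 : coords (N.transform t U) = fun i => (N.substPoly i).val t (coords U) := by
    rw [N.transform_eq, coords_assemble]
  rw [Pi.sub_apply, val_residual, ← h1]
  simp only [h1]
  ring

/-- The defect is the multinomial residual minus the Taylor error at the image point. The latter is
at most M (2‖U‖)^p, whence the factor 2^p. -/
theorem NormalForm.exists_defect_bound (hT : IsOpen T) (hν : 0 ≤ ν)
    (h1 : ∀ i, GSlow T ν 1 (N.substPoly i)) (h2 : ∀ i, GSlow T ν 1 (N.nonlinPoly i))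
    {φ : Fin m ⊕ Fin n → TPoly (Fin m ⊕ Fin n)} (hφ : ∀ i, φ i ∈ OT T 2)
    (hφ' : ∀ i s, IsSlow T ν (coeff s (φ i)))
    (h3 : ∀ i, residual (Matrix.fromBlocks A 0 0 B) φ N.substPoly (N.fieldPoly A B) i ∈ OT T p)
    {f : ℝ → State m n → Vec m} {g : ℝ → State m n → Vec n} {r M : ℝ} (hM : 0 ≤ M)
    (hfg : ∀ t ∈ T, ∀ u ∈ ball (0 : State m n) r, ∀ i,
      |coords (f t u, g t u) i - (φ i).val t (coords u)| ≤ M * ‖u‖ ^ p) :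
    ∃ C, 0 ≤ C ∧ ∀ t ∈ T, ∀ U : State m n, ‖U‖ ≤ 1 → 2 * ‖U‖ < r →
      ‖N.transform t U‖ ≤ 2 * ‖U‖ →
      ‖N.velocity A B t U - givenField A B f g t (N.transform t U)‖ ≤ C * ‖U‖ ^ p := by
  have hV : ∀ i, GSlow T ν 1 (N.fieldPoly A B i) := fun i =>
    (GSlow.linPoly hT hν _ (fun l => GSlow.X hT hν l) i).add hT (h2 i)
  obtain ⟨C, hC, h⟩ := exists_forall_abs_val_le h3 fun i =>
    (GSlow.residual hT hν (Matrix.fromBlocks A 0 0 B) h1 hV hφ hφ' i).bddCoeffs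
  refine ⟨‖assemble m n‖ * (C + M * 2 ^ p), by positivity, fun t ht U hU hUr hΦ => ?_⟩
  rw [N.velocity_sub_givenField (fun i s => (h1 i).differentiableAt hT s t ht) φ, mul_assoc]
  refine norm_assemble_le (by positivity) fun i => (abs_sub _ _).trans ?_
  rw [add_mul]
  refine add_le_add (h t ht U hU i) ((hfg t ht _ (mem_ball_zero_iff.2 (hΦ.trans_lt hUr)) i).trans ?_)
  rw [mul_assoc, ← mul_pow]
  gcongr

end Estimates

/-! ### The nearby system -/

section Main

open Set Metric MvPolynomial

variable {m n p : ℕ} {T : Set ℝ} {μ ν r M : ℝ} {d : Set (State m n)} {N : NormalForm m n}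
  {A : Matrix (Fin m) (Fin m) ℝ} {B : Matrix (Fin n) (Fin n) ℝ}
  {f : ℝ → State m n → Vec m} {g : ℝ → State m n → Vec n}
  {φ : Fin m ⊕ Fin n → TPoly (Fin m ⊕ Fin n)}

/-- A normal form of small multinomial residual is conjugate to a system near the given one. -/
theorem NormalForm.exists_nearby_system (hT : IsOpen T) (hν : 0 ≤ ν) (hN : N.SlowCoeffs T μ)
    (h1 : ∀ i, GSlow T ν 1 (N.substPoly i)) (h2 : ∀ i, GSlow T ν 1 (N.nonlinPoly i))
    (h3 : ∀ i, N.substPoly i - X i ∈ OT T 2)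
    (hφ : ∀ i, φ i ∈ OT T 2) (hφ' : ∀ i s, IsSlow T ν (coeff s (φ i)))
    (h4 : ∀ i, residual (Matrix.fromBlocks A 0 0 B) φ N.substPoly (N.fieldPoly A B) i ∈ OT T p)
    (hr : 0 < r) (hd : ball 0 r ⊆ d) (hM : 0 ≤ M)
    (hfg : ∀ t ∈ T, ∀ u ∈ ball (0 : State m n) r, ∀ i,
      |coords (f t u, g t u) i - (φ i).val t (coords u)| ≤ M * ‖u‖ ^ p) :
    IsOrc T p (fun t U => N.velocity A B t U - givenField A B f g t (N.transform t U)) ∧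
    ∃ ρ > 0, ∃ ψ : ℝ → State m n → State m n, N.IsDiffeo T d ρ ψ ∧
      IsOrc T p (fun t u => N.velocity A B t (ψ t u) - givenField A B f g t u) ∧
      HasSlowManifold N A T ρ (fun t u => N.velocity A B t (ψ t u)) := by
  obtain ⟨K, hK, hKb⟩ := N.exists_fderiv_bound h3 fun i =>
    (h1 i).bddCoeffs.sub (GSlow.X hT hν i).bddCoeffs
  obtain ⟨C, hC, hCb⟩ := N.exists_defect_bound hT hν h1 h2 hφ hφ' h4 hM hfg
  -- ρ ≤ 1 is for the bounds on multinomials, K ρ ≤ ½ for nearness to the identity, and 2ρ ≤ r keeps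
  -- the images, of norm at most twice that of U, in the ball where the Taylor estimate holds.
  obtain ⟨ρ, hρ, hρ1, hρK, hρr⟩ : ∃ ρ > 0, ρ ≤ 1 ∧ K * ρ ≤ 1 / 2 ∧ 2 * ρ ≤ r := by
    refine ⟨min 1 (min (1 / (2 * (K + 1))) (r / 2)), by positivity, min_le_left _ _, ?_, ?_⟩
    · calc K * min 1 (min (1 / (2 * (K + 1))) (r / 2)) ≤ (K + 1) * (1 / (2 * (K + 1))) := by
            gcongr
            · linarith
            · exact (min_le_right _ _).trans (min_le_left _ _)
        _ = 1 / 2 := by field_simp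
    · have := (min_le_right 1 _).trans (min_le_right (1 / (2 * (K + 1))) (r / 2))
      linarith
  have hsm : ContDiffOn ℝ ∞ (fun q : ℝ × State m n => N.transform q.1 q.2) (T ×ˢ ball 0 ρ) :=
    (N.contDiffOn_transform fun i s => ((h1 i).2 s).contDiffOn).mono
      (prod_mono_right (subset_univ _))
  have hid : ∀ t ∈ T, ∀ U ∈ ball (0 : State m n) ρ,
      ‖fderiv ℝ (N.transform t) U - ContinuousLinearMap.id ℝ (State m n)‖ ≤ 1 / 2 := by
    intro t ht U hU
    rw [mem_ball_zero_iff] at hU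
    exact (hKb t ht U (hU.le.trans hρ1)).trans
      ((mul_le_mul_of_nonneg_left hU.le hK).trans hρK)
  obtain ⟨ψ, hψ, hnorm, hψs⟩ := exists_inverse_family hT hρ hsm hid fun t ht =>
    N.transform_zero (fun i => (h1 i).mem_OT) (fun i => (h1 i).bddCoeffs) ht
  have hdef : ∀ t ∈ T, ∀ U ∈ ball (0 : State m n) ρ,
      ‖N.velocity A B t U - givenField A B f g t (N.transform t U)‖ ≤ C * ‖U‖ ^ p := by
    intro t ht U hU
    have hU' := mem_ball_zero_iff.1 hU
    exact hCb t ht U (hU'.le.trans hρ1) (by linarith) (hnorm t ht U hU).1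
  refine ⟨isOrc_of_norm_le hρ fun t ht U hU => hdef t ht U (mem_ball_zero_iff.2 hU),
    ρ, hρ, ψ, ⟨fun t ht => ⟨(hψ t ht).1, (hψ t ht).2.1, ?_⟩, hsm, ?_, ρ / 4, by positivity,
      fun t ht => (hψ t ht).2.2⟩, ?_, ?_⟩
  · rintro _ ⟨U, hU, rfl⟩
    have hU' := mem_ball_zero_iff.1 hU
    have := (hnorm t ht U hU).1
    exact hd (mem_ball_zero_iff.2 (by linarith))
  · rintro ⟨t, u⟩ ⟨ht, U, hU, hUu⟩
    change N.transform t U = u at hUu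
    rw [← hUu]
    exact (hψs t ht U hU).contDiffWithinAt
  -- The bound passes to the variables u through ‖U‖ ≤ 2‖u‖, on the common ball of radius ρ/4.
  · refine isOrc_of_norm_le (C := C * 2 ^ p) (r := ρ / 4) (by positivity) fun t ht u hu => ?_
    obtain ⟨U, hU, rfl⟩ := (hψ t ht).2.2 (mem_ball_zero_iff.2 hu)
    rw [(hψ t ht).1 hU, mul_assoc, ← mul_pow]
    refine (hdef t ht U hU).trans ?_
    gcongr
    exact (hnorm t ht U hU).2
  · exact N.hasSlowManifold hT hsm hid (fun j k s => IsSlow.contDiffOn (hN.2.2.2.2 j k s))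
      (fun t ht => (hψ t ht).1) hψs

end Main

end FastSlow

namespace FastSlow

/-! ### Taylor multinomials of the nonlinear terms -/

section TaylorField

open Metric MvPolynomial

variable {m n p : ℕ} {T : Set ℝ} {ν r M : ℝ} {f : ℝ → State m n → Vec m}
  {g : ℝ → State m n → Vec n}

/-- The components of the Taylor multinomials of `(f, g)`. -/
noncomputable def taylorField (f : ℝ → State m n → Vec m) (g : ℝ → State m n → Vec n) (p : ℕ) :
    Fin m ⊕ Fin n → TPoly (Fin m ⊕ Fin n) :=
  Sum.elim (fun i => taylorPoly f (EuclideanSpace.proj i) p)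
    (fun j => taylorPoly g (EuclideanSpace.proj j) p)

theorem taylorField_mem_OT (i : Fin m ⊕ Fin n) : taylorField f g p i ∈ OT T 2 := by
  rcases i with i | j
  · exact taylorPoly_mem_OT f _ p
  · exact taylorPoly_mem_OT g _ p

theorem taylorField_slow (hT : IsOpen T) (hν : 0 ≤ ν)
    (hf : ∀ k < p, IsSlow T ν fun t => iteratedFDeriv ℝ k (f t) 0)
    (hg : ∀ k < p, IsSlow T ν fun t => iteratedFDeriv ℝ k (g t) 0) (i : Fin m ⊕ Fin n)
    (s : Fin m ⊕ Fin n →₀ ℕ) : IsSlow T ν (coeff s (taylorField f g p i)) := by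
  rcases i with i | j
  · exact taylorPoly_slow hT hν _ hf s
  · exact taylorPoly_slow hT hν _ hg s

theorem abs_coords_sub_taylorField_le (hp : 2 ≤ p) (hM : 0 ≤ M)
    (hf : ∀ t ∈ T, ContDiffOn ℝ p (f t) (ball 0 r)) (hg : ∀ t ∈ T, ContDiffOn ℝ p (g t) (ball 0 r))
    (hf2 : IsOrc T 2 f) (hg2 : IsOrc T 2 g)
    (hfM : ∀ t ∈ T, ∀ v ∈ ball 0 r, ‖iteratedFDeriv ℝ p (f t) v‖ ≤ M)
    (hgM : ∀ t ∈ T, ∀ v ∈ ball 0 r, ‖iteratedFDeriv ℝ p (g t) v‖ ≤ M) {t : ℝ} (ht : t ∈ T)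
    {u : State m n} (hu : u ∈ ball 0 r) (i : Fin m ⊕ Fin n) :
    |coords (f t u, g t u) i - (taylorField f g p i).val t (coords u)| ≤ M * ‖u‖ ^ p := by
  rcases i with i | j
  · have h : ‖(EuclideanSpace.proj i : Vec m →L[ℝ] ℝ)‖ ≤ 1 :=
      ContinuousLinearMap.opNorm_le_bound _ zero_le_one fun w => by
        rw [one_mul]
        exact PiLp.norm_apply_le w i
    refine (abs_sub_taylorPoly_le hp hf hf2 hfM (EuclideanSpace.proj i) ht hu).trans ?_
    exact mul_le_mul_of_nonneg_right (mul_le_of_le_one_left hM h) (by positivity)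
  · have h : ‖(EuclideanSpace.proj j : Vec n →L[ℝ] ℝ)‖ ≤ 1 :=
      ContinuousLinearMap.opNorm_le_bound _ zero_le_one fun w => by
        rw [one_mul]
        exact PiLp.norm_apply_le w j
    refine (abs_sub_taylorPoly_le hp hg hg2 hgM (EuclideanSpace.proj j) ht hu).trans ?_
    exact mul_le_mul_of_nonneg_right (mul_le_of_le_one_left hM h) (by positivity)

end TaylorField

end FastSlow

/-! ### The fast-slow separation theorem -/

theorem mainTheorem8 {m n : ℕ}
    (A : Matrix (Fin m) (Fin m) ℝ) (B : Matrix (Fin n) (Fin n) ℝ)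
    (α β μ ν : ℝ) (P : ℕ)
    -- the spectral gap, for the highest order `P` and the threshold rate `μ`
    (hP : 2 ≤ P) (hα : 0 ≤ α) (hαμ : α < μ) (hPμ : (P : ℝ) * α ≤ μ)
    (hμβ : μ < β - ((P : ℝ) - 1) * α)
    -- `x` is slow and `y` is fast
    (hA : ∀ l ∈ spectrum ℂ (A.map ((↑) : ℝ → ℂ)), ‖l‖ ≤ α)
    (hB : ∀ l ∈ spectrum ℂ (B.map ((↑) : ℝ → ℂ)), β ≤ ‖l‖)
    -- the time interval and the domain
    (T : Set ℝ) (hTo : IsOpen T) (hTc : T.OrdConnected)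
    (d : Set (FastSlow.State m n)) (hdo : IsOpen d) (hdc : IsConnected d)
    (hdb : Bornology.IsBounded d) (hd0 : (0 : FastSlow.State m n) ∈ d)
    -- the strictly nonlinear terms
    (f : ℝ → FastSlow.State m n → FastSlow.Vec m)
    (g : ℝ → FastSlow.State m n → FastSlow.Vec n)
    (hf : ∀ t ∈ T, ContDiffOn ℝ P (f t) d) (hg : ∀ t ∈ T, ContDiffOn ℝ P (g t) d)
    (hf2 : FastSlow.IsOrc T 2 f) (hg2 : FastSlow.IsOrc T 2 g)
    -- their explicit time dependence is slow, uniformly near the origin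
    (hν : 0 ≤ ν)
    (hslow : ∃ M : ℝ, ∃ r > 0, ∀ u ∈ d, ‖u‖ < r → ∀ k ≤ P,
      FastSlow.SlowOn T ν M (fun t => iteratedFDeriv ℝ k (f t) u) ∧
      FastSlow.SlowOn T ν M (fun t => iteratedFDeriv ℝ k (g t) u))
    -- the order of approximation; products of `p - 2` time dependent factors are still slow
    (p : ℕ) (hp : 2 ≤ p) (hpP : p ≤ P) (hpν : ((p : ℝ) - 2) * ν ≤ μ) :
    ∃ N : FastSlow.NormalForm m n,
      N.SlowCoeffs T μ ∧
      FastSlow.IsOrc T 2 (fun t U => N.transform t U - U) ∧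
      FastSlow.IsOrc T 2 N.FVec ∧
      FastSlow.IsOrc T 2 N.GVec ∧
      FastSlow.IsOrc T p (fun t U =>
        N.velocity A B t U - FastSlow.givenField A B f g t (N.transform t U)) ∧
      ∃ ρ > 0, ∃ ψ : ℝ → FastSlow.State m n → FastSlow.State m n,
        N.IsDiffeo T d ρ ψ ∧
        FastSlow.IsOrc T p (fun t u =>
          N.velocity A B t (ψ t u) - FastSlow.givenField A B f g t u) ∧
        FastSlow.HasSlowManifold N A T ρ (fun t u => N.velocity A B t (ψ t u)) := by
  obtain ⟨M, r, hr, hM⟩ := hslow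
  obtain ⟨δ, hδ, hδd⟩ := Metric.isOpen_iff.1 hdo 0 hd0
  have hball : Metric.ball 0 (min r δ) ⊆ d :=
    (Metric.ball_subset_ball (min_le_right _ _)).trans hδd
  have hM' : ∀ u ∈ Metric.ball (0 : FastSlow.State m n) (min r δ), ∀ k ≤ P,
      FastSlow.SlowOn T ν M (fun t => iteratedFDeriv ℝ k (f t) u) ∧
      FastSlow.SlowOn T ν M (fun t => iteratedFDeriv ℝ k (g t) u) := fun u hu =>
    hM u (hball hu) ((mem_ball_zero_iff.1 hu).trans_le (min_le_left _ _))
  have h0 : (0 : FastSlow.State m n) ∈ Metric.ball 0 (min r δ) :=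
    Metric.mem_ball_self (lt_min hr hδ)
  have hpP' : (p : WithTop ℕ∞) ≤ P := by exact_mod_cast hpP
  -- The gap assumed for P passes to p ≤ P because α ≥ 0.
  have hgap : μ + ((p : ℝ) - 1) * α < β := by
    have h1 : ((p : ℝ) - 1) * α ≤ ((P : ℝ) - 1) * α := by gcongr
    linarith
  have hφ := FastSlow.taylorField_slow hTo hν
    (fun k hk => ⟨M, (hM' 0 h0 k (hk.le.trans hpP)).1⟩)
    (fun k hk => ⟨M, (hM' 0 h0 k (hk.le.trans hpP)).2⟩)
  obtain ⟨N, h1, h2, h3, h4, h5, h6⟩ := FastSlow.exists_normalForm hTo hTc hν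
    (hα.trans hαμ.le) hα hA hB (fun i => FastSlow.taylorField_mem_OT i) hφ hp hpν hgap
  have hF := N.isOrc_nonlin h5 fun i => (h3 i).bddCoeffs
  refine ⟨N, h1, N.isOrc_transform_sub h4 fun i =>
    (h2 i).bddCoeffs.sub (FastSlow.GSlow.X hTo hν i).bddCoeffs, hF.1, hF.2, ?_⟩
  -- M could be negative if T is empty, hence `max M 0`.
  refine N.exists_nearby_system hTo hν h1 h2 h3 h4 (fun i => FastSlow.taylorField_mem_OT i) hφ h6
    (lt_min hr hδ) hball (le_max_right M 0) fun t ht u hu i => ?_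
  refine FastSlow.abs_coords_sub_taylorField_le hp (le_max_right M 0)
    (fun t ht => ((hf t ht).mono hball).of_le hpP')
    (fun t ht => ((hg t ht).mono hball).of_le hpP') hf2 hg2
    (fun t ht v hv => ?_) (fun t ht v hv => ?_) ht hu i
  -- The case j = 0 of slowness bounds the spatial derivative of order p itself.
  · exact le_max_of_le_left (by simpa using (hM' v hv p hpP).1.2 0 t ht)
  · exact le_max_of_le_left (by simpa using (hM' v hv p hpP).2.2 0 t ht)
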